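/- **Proposition 2.1 (the Chilean arrangement is free).** Let $S=\mathbb{C}[x,y,z]$, let $\omega$ be a primitive cube root of unity and let $a\in\mathbb{C}$ with $a\neq 0$, $a^3\neq 1$, $a^3\neq -8$. The Chilean arrangement $\mathcal{CH}=\mathcal{CH}_a\subset\mathbb{P}^2_{\mathbb{C}}$ with parameter $a$ consists of the twelve conics $$yz=ax^2,\qquad zx=ay^2,\qquad xy=az^2,$$ $$x^2+\omega^{2i}y^2+\omega^{2j}z^2+(1+a\omega^{i+j})\left(\omega^{i}xy+\omega^{j}xz+\omega^{i+j}yz\right)=0\qquad (i,j\in\{0,1,2\}).$$ Let $F\in S$ be the product of the twelve quadratic forms, of degree $24$. For a singular point $p$ of the curve $F=0$ with local equation $f(u,w)=0$ in affine coordinates centred at $p$, and $\mathcal{O}_p$ the local ring of the plane at $p$, let $\tau_p=\dim_{\mathbb{C}}\mathcal{O}_p/(f,f_u,f_w)$ and $\mu_p=\dim_{\mathbb{C}}\mathcal{O}_p/(f_u,f_w)$ be its Tjurina and Milnor numbers; $p$ is called quasi-homogeneous if $\tau_p=\mu_p$. Then: 1. The twelve conics are irreducible and pairwise distinct. There are exactly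 $9$ points through which exactly $8$ of the conics pass, each conic contains exactly $6$ of these points, there are exactly $12$ points through which exactly two of the conics pass, and these $9+12$ points are precisely the singular points of the curve $F=0$. 2. $\mathcal{CH}$ is free in the sense of Saito, i.e. the $S$-module $D(F)=\{\theta\in\mathrm{Der}_{\mathbb{C}}(S): \theta(F)\in\langle F\rangle\}$ is free. Its exponents are $(7,16)$, i.e. the $S$-module $D_0(F)=\{\theta\in\mathrm{Der}_{\mathbb{C}}(S):\theta(F)=0\}$ of syzygies of the Jacobian ideal of $F$ has a basis consisting of two homogeneous derivations with coefficients of degrees $7$ and $16$. 3. The sum of $\tau_p$ over all singular points $p$ is $417$ and the sum of $\mu_p$ over all singular points is $453$. In particular, not all singular points of $\mathcal{CH}$ are quasi-homogeneous. -/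

import Mathlib

open MvPolynomial
open scoped LinearAlgebra.Projectivization

noncomputable section

namespace PlaneCurve

/-- The homogeneous coordinate ring `ℂ[x, y, z]` of the projective plane. -/
abbrev S : Type := MvPolynomial (Fin 3) ℂ

/-- The complex projective plane. -/
abbrev Plane : Type := ℙ ℂ (Fin 3 → ℂ)

/-- A point lies on the curve `G = 0` (used for homogeneous `G`, where the choice of the
representative does not matter). -/
def Passes (G : S) (p : Plane) : Prop := eval p.rep G = 0

/-- The singular points of the plane curve `F = 0`. -/
def singularPoints (F : S) : Set Plane :=
  {p | Passes F p ∧ ∀ i, Passes (pderiv i F) p}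

/-! ### Logarithmic derivations, freeness, exponents -/

/-- The module `D(F)` of polynomial derivations `θ` tangent to `F = 0`, that is,
`θ(F) ∈ ⟨F⟩`. -/
def logDer (F : S) : Submodule S (Derivation ℂ S S) where
  carrier := {θ | θ F ∈ Ideal.span {F}}
  zero_mem' := by simp
  add_mem' := fun {θ η} h h' => by
    simpa using Ideal.add_mem _ h h'
  smul_mem' := fun c θ h => by
    simpa using Ideal.mul_mem_left _ c h

/-- The submodule `D₀(F)` of derivations killing `F`; writing `θ = ∑ gᵢ ∂ᵢ`, these are the
syzygies `∑ gᵢ ∂ᵢF = 0` of the Jacobian ideal of `F`. -/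
def logDerZero (F : S) : Submodule S (Derivation ℂ S S) where
  carrier := {θ | θ F = 0}
  zero_mem' := by simp
  add_mem' := fun {θ η} h h' => by
    have h1 : θ F = 0 := h
    have h2 : η F = 0 := h'
    simp [h1, h2]
  smul_mem' := fun c θ h => by
    have h1 : θ F = 0 := h
    simp [h1]

/-- The curve `F = 0` is free in the sense of Saito: its module of logarithmic derivations is a
free module over the polynomial ring. -/
def IsFree (F : S) : Prop := Module.Free S (logDer F)

/-- `d₁, d₂` are the exponents of `F = 0`: the syzygy module `D₀(F)` has a basis of two
homogeneous elements, with coefficients of degrees `d₁` and `d₂`. With `d = deg F`, this is a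
graded free resolution
`0 → S(-d₁-(d-1)) ⊕ S(-d₂-(d-1)) → S(-(d-1))³ → S` of the Milnor algebra `S / J_F`. -/
def HasExponents (F : S) (d₁ d₂ : ℕ) : Prop :=
  ∃ b : Module.Basis (Fin 2) S (logDerZero F),
    ∀ j, ((b 0 : Derivation ℂ S S) (X j)).IsHomogeneous d₁ ∧
      ((b 1 : Derivation ℂ S S) (X j)).IsHomogeneous d₂

/-! ### Milnor and Tjurina numbers -/

/-- The index of the first nonzero coordinate; it selects the affine chart used at a point. -/
def chartIndex (v : Fin 3 → ℂ) : Fin 3 :=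
  open scoped Classical in if v 0 ≠ 0 then 0 else if v 1 ≠ 0 then 1 else 2

/-- The representative of `p` whose first nonzero coordinate is `1`. -/
def normalized (p : Plane) : Fin 3 → ℂ :=
  (p.rep (chartIndex p.rep))⁻¹ • p.rep

/-- The equation of `F = 0` in the standard affine chart `xᵢ = 1` around `p`
(`i = chartIndex p.rep`), in the two remaining coordinates, translated so that `p` is the
origin. -/
def localEquation (F : S) (p : Plane) : MvPolynomial (Fin 2) ℂ :=
  aeval (fun l : Fin 3 =>
    C (normalized p l) +
      Fin.insertNth (α := fun _ => MvPolynomial (Fin 2) ℂ) (chartIndex p.rep) 0 X l) F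

/-- The maximal ideal of the origin in `ℂ[u, w]`. -/
abbrev originIdeal : Ideal (MvPolynomial (Fin 2) ℂ) :=
  RingHom.ker (constantCoeff : MvPolynomial (Fin 2) ℂ →+* ℂ)

instance originIdeal_isPrime : originIdeal.IsPrime := RingHom.ker_isPrime _

/-- The local ring of the affine plane at the origin. -/
abbrev LocalRing : Type := Localization.AtPrime originIdeal

/-- The dimension over `ℂ` (possibly `∞`) of the quotient of the local ring at the origin by the
ideal generated by `I`. -/
def localDim (I : Ideal (MvPolynomial (Fin 2) ℂ)) : ℕ∞ :=
  Cardinal.toENat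
    (Module.rank ℂ (LocalRing ⧸ I.map (algebraMap (MvPolynomial (Fin 2) ℂ) LocalRing)))

/-- The Milnor number `dim 𝒪_p / (f_u, f_w)` of `F = 0` at `p`, with `f` the local equation. -/
def milnorNumber (F : S) (p : Plane) : ℕ∞ :=
  localDim (Ideal.span
    {pderiv 0 (localEquation F p), pderiv 1 (localEquation F p)})

/-- The Tjurina number `dim 𝒪_p / (f, f_u, f_w)` of `F = 0` at `p`. -/
def tjurinaNumber (F : S) (p : Plane) : ℕ∞ :=
  localDim (Ideal.span
    {localEquation F p, pderiv 0 (localEquation F p), pderiv 1 (localEquation F p)})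

/-- A singular point is quasi-homogeneous if its Tjurina and Milnor numbers coincide. -/
def IsQuasiHomogeneousAt (F : S) (p : Plane) : Prop :=
  tjurinaNumber F p = milnorNumber F p

/-- The total Milnor number. A sum with infinitely many nonzero terms would be `0`. -/
def totalMilnor (F : S) : ℕ∞ := ∑ᶠ p ∈ singularPoints F, milnorNumber F p

/-- The total Tjurina number. A sum with infinitely many nonzero terms would be `0`. -/
def totalTjurina (F : S) : ℕ∞ := ∑ᶠ p ∈ singularPoints F, tjurinaNumber F p

/-! ### The Chilean arrangement -/

/-- The index set of the twelve conics. -/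
abbrev ConicIndex : Type := Fin 3 ⊕ Fin 3 × Fin 3

/-- The twelve conics of the Chilean arrangement with parameter `a`, where `ω` is a primitive cube
root of unity: `yz = a x²`, `zx = a y²`, `xy = a z²`, and for `i, j ∈ {0, 1, 2}`
`x² + ω²ⁱ y² + ω²ʲ z² + (1 + a ωⁱ⁺ʲ) (ωⁱ xy + ωʲ xz + ωⁱ⁺ʲ yz) = 0`.

The nine points are the orbit of `(a : 1 : 1)` under the Heisenberg group generated by
`(x : y : z) ↦ (y : z : x)` and `(x : y : z) ↦ (x : ωy : ω²z)`; they are the cusps of the dual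
curve of the member `x³ + y³ + z³ - 3a xyz = 0` of the Hesse pencil. Labelling them by the
affine plane over the field with three elements, each conic passes through the six points in the
complement of one of the twelve lines. The three conics belonging to parallel lines form a
sextic with double points at all nine points, a member of a Halphen pencil of index `2`. -/
def chileanConic (a ω : ℂ) : ConicIndex → S
  | Sum.inl k => X (k + 1) * X (k + 2) - C a * X k ^ 2
  | Sum.inr (i, j) =>
      X 0 ^ 2 + C (ω ^ (2 * (i : ℕ))) * X 1 ^ 2 + C (ω ^ (2 * (j : ℕ))) * X 2 ^ 2
        + C (1 + a * ω ^ ((i : ℕ) + (j : ℕ))) *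
          (C (ω ^ (i : ℕ)) * (X 0 * X 1) + C (ω ^ (j : ℕ)) * (X 0 * X 2)
            + C (ω ^ ((i : ℕ) + (j : ℕ))) * (X 1 * X 2))

/-- The defining polynomial, of degree `24`, of the Chilean arrangement. -/
def chilean (a ω : ℂ) : S := ∏ k, chileanConic a ω k

/-- The multiplicity of a point in the arrangement: the number of conics through it. -/
def chileanMult (a ω : ℂ) (p : Plane) : ℕ := Set.ncard {k | Passes (chileanConic a ω k) p}

end PlaneCurve

end

/-!
Everything about the arrangement is read off a pencil. Put `A = a³` and let `C` (`cubic`) be the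
member of the Hesse pencil through `(a : 1 : 1)`, and `G` (`sextic`) the product of the three conics
`x_{k+1} x_{k+2} = a x_k²`. The nine points of the orbit of `(a : 1 : 1)` are the intersections of
`C = 0` and `G = 0`, and the other nine conics fall into three triples with products proportional to
`C² + c_m G` for three constants `c_m`; so the arrangement consists of four members of the Halphen
pencil spanned by `C²` and `G`, and `a⁶ F = P(G, C)` for the form
`P = G (C² + (A - 4) G)³ + 27 A² G⁴` (`chilean_eq_octic`).

*Incidences.* In suitable linear coordinates (`frameForm`) each triple becomes
`L_{k+1} L_{k+2} = b L_k²` for a parameter `b` satisfying the same restrictions as `a`, with the same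
cubic (`conic_eq_frame`, `exists_cubic_frame`). Two conics of different triples meet on `C = 0` only,
hence in the nine base points, each of which omits one conic of every triple (`fibre_unique`,
`exists_frame_basePoint`). Two conics of one triple meet outside of `C = 0` only in a vertex of the
coordinate triangle (`exists_eq_vertex`), transversally. The conics are smooth, so there are no
other singular points.

*Freeness.* The derivation `∇G × ∇C` has degree `7` and kills `F`. A second syzygy `w`, of degree
`16`, satisfies `w(C) = -3 P_G` and `w(G) = 3 P_C`; it is a combination of the Euler derivation and of
the vector fields `(x⁴, y⁴, z⁴)` and `(y²z², z²x², x²y²)` with invariant coefficients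
(`syzygySixteen_cubic`, `syzygySixteen_sextic`). The cross product of the two is then
`3 P_G ∇G + 3 P_C ∇C = 3 a⁶ ∇F`, and since the partial derivatives of `F` have no common factor,
Saito's criterion (`exists_basis_syzygies`) applies. `D(F)` is the sum of the syzygies and the
multiples of the Euler derivation (`free_logDer`).

*Milnor and Tjurina numbers.* At a node they are `1`. At a base point the germ of `F` is `P(g, c)`,
where `c` has nonzero differential and `g` is tangent to `c` to order two. The ideal of the partial
derivatives is analysed through the Jacobian determinant `d` of `c` and `g`: up to units,
`c_y f_z ≡ P_g d` modulo `f_y`, and `P_g`, `d` meet `f_y` with multiplicities `42` and `7`, which gives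
`μ = 49` (`IsBaseGerm.colength_milnor`). The multiplicity for `d` comes from the mirror `j = 0`
through the point, for which `j²` is the discriminant of the invariants `c`, `p = xyz`, `g`, a
multiple of `g` by a unit up to terms divisible by `c²`. The same relations give `τ = 45`
(`IsBaseGerm.colength_tjurina`). The totals are `9 · 49 + 12` and `9 · 45 + 12`. All multiplicities
are computed from the additivity of colengths, `colength_smul_sup`.
-/

noncomputable section

namespace PlaneCurve

/-! ### Colengths of ideals and intersection multiplicities -/

section Colength

variable {R : Type} [CommRing R] [Algebra ℂ R]

/-- The dimension over `ℂ` of the quotient by an ideal. -/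
def colength (I : Ideal R) : ℕ∞ := Cardinal.toENat (Module.rank ℂ (R ⧸ I))

/-- Multiplication by `a` identifies `R / (K + (c))` with the kernel of
`R / (a K + (c)) → R / (a, c)` if `a` is a nonzerodivisor modulo `c`. With `K = (b)` this is the
additivity of intersection multiplicities. -/
lemma colength_smul_sup (a c : R) (K : Ideal R) (h : ∀ x, c ∣ a * x → c ∣ x) :
    colength (Ideal.span {a} * K ⊔ Ideal.span {c}) =
      colength (Ideal.span {a, c}) + colength (K ⊔ Ideal.span {c}) := by
  set M := Ideal.span {a} * K ⊔ Ideal.span {c} with hM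
  set N := K ⊔ Ideal.span {c} with hN
  have hle : M ≤ Ideal.span {a, c} := by
    rw [hM, Ideal.span_insert]
    exact sup_le_sup Ideal.mul_le_left le_rfl
  have hmul : ∀ x ∈ N, a * x ∈ M := by
    intro x hx
    obtain ⟨k, hk, y, hy, rfl⟩ := Submodule.mem_sup.1 hx
    rw [mul_add]
    refine add_mem (Ideal.mem_sup_left ?_) (Ideal.mem_sup_right (Ideal.mul_mem_left _ _ hy))
    exact Ideal.mul_mem_mul (Ideal.mem_span_singleton_self a) hk
  have hinj : ∀ x, a * x ∈ M → x ∈ N := by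
    intro x hx
    obtain ⟨y, hy, z, hz, hyz⟩ := Submodule.mem_sup.1 hx
    obtain ⟨k, hk, rfl⟩ := Ideal.mem_span_singleton_mul.1 hy
    obtain ⟨w, rfl⟩ := Ideal.mem_span_singleton.1 hz
    have hd : c ∣ x - k := h _ ⟨w, by linear_combination -hyz⟩
    have : x = k + (x - k) := by ring
    rw [this]
    exact add_mem (Ideal.mem_sup_left hk) (Ideal.mem_sup_right (Ideal.mem_span_singleton.2 hd))
  let f : (R ⧸ N) →ₗ[R] (R ⧸ M) := Submodule.mapQ N M (LinearMap.mulLeft R a) hmul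
  let g : (R ⧸ M) →ₗ[R] (R ⧸ Ideal.span {a, c}) := Submodule.factor hle
  have hf : Function.Injective f := by
    rw [← LinearMap.ker_eq_bot, LinearMap.ker_eq_bot']
    intro x hx
    obtain ⟨x, rfl⟩ := Submodule.Quotient.mk_surjective _ x
    have : (Submodule.Quotient.mk (a * x) : R ⧸ M) = 0 := hx
    rw [Submodule.Quotient.mk_eq_zero] at this ⊢
    exact hinj x this
  have hg : Function.Surjective g := Submodule.factor_surjective hle
  have hfg : LinearMap.range f = LinearMap.ker g := by
    ext x
    obtain ⟨x, rfl⟩ := Submodule.Quotient.mk_surjective _ x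
    have e : g (Submodule.Quotient.mk x) = Submodule.Quotient.mk x := rfl
    rw [LinearMap.mem_ker, e, Submodule.Quotient.mk_eq_zero, LinearMap.mem_range]
    constructor
    · rintro ⟨y, hy⟩
      obtain ⟨y, rfl⟩ := Submodule.Quotient.mk_surjective _ y
      have : (Submodule.Quotient.mk (a * y) : R ⧸ M) = Submodule.Quotient.mk x := hy
      rw [Submodule.Quotient.eq] at this
      have h1 : x = a * y - (a * y - x) := by ring
      rw [h1]
      exact sub_mem (Ideal.mul_mem_right _ _ (Ideal.subset_span (by simp))) (hle this)
    · intro hx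
      obtain ⟨y, w, rfl⟩ := Ideal.mem_span_pair.1 hx
      refine ⟨Submodule.Quotient.mk y, ?_⟩
      change (Submodule.Quotient.mk (a * y) : R ⧸ M) = _
      rw [Submodule.Quotient.eq]
      refine Ideal.mem_sup_right (Ideal.mem_span_singleton.2 ⟨-w, by ring⟩)
  have h1 := LinearMap.rank_range_add_rank_ker (g.restrictScalars ℂ)
  have h2 : Module.rank ℂ (LinearMap.range (g.restrictScalars ℂ)) =
      Module.rank ℂ (R ⧸ Ideal.span {a, c}) :=
    rank_range_of_surjective _ hg
  have h3 : Module.rank ℂ (LinearMap.ker (g.restrictScalars ℂ)) = Module.rank ℂ (R ⧸ N) := by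
    have h4 : LinearMap.ker (g.restrictScalars ℂ) = LinearMap.range (f.restrictScalars ℂ) := by
      ext x
      have := SetLike.ext_iff.1 hfg x
      simpa [LinearMap.mem_ker] using this.symm
    rw [h4]
    exact rank_range_of_injective _ hf
  rw [h2, h3] at h1
  unfold colength
  rw [← h1, map_add]

/-- The ideal `I` has colength `n` and is contained in no proper principal ideal. For
`I = (a, b)` the second condition says that `a` and `b` are relatively prime, so this is the
statement that `n` is the intersection multiplicity of `a` and `b`. -/
structure HasColength (I : Ideal R) (n : ℕ) : Prop where
  isUnit_of_le : ∀ d, I ≤ Ideal.span {d} → IsUnit d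
  colength_eq : colength I = n

lemma HasColength.isRelPrime {a b : R} {n : ℕ} (h : HasColength (Ideal.span {a, b}) n) :
    IsRelPrime a b := by
  intro d ha hb
  refine h.isUnit_of_le d ?_
  rw [Ideal.span_le]
  rintro x (rfl | rfl) <;> simpa [Ideal.mem_span_singleton]

lemma HasColength.of_isRelPrime {a b : R} {n : ℕ} (h : IsRelPrime a b)
    (h' : colength (Ideal.span {a, b}) = n) : HasColength (Ideal.span {a, b}) n :=
  ⟨fun _ hd => h (Ideal.mem_span_singleton.1 (hd (Ideal.subset_span (by simp))))
    (Ideal.mem_span_singleton.1 (hd (Ideal.subset_span (by simp)))), h'⟩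

lemma HasColength.symm {a b : R} {n : ℕ} (h : HasColength (Ideal.span {a, b}) n) :
    HasColength (Ideal.span {b, a}) n := by
  rwa [Ideal.span_pair_comm]

/-- Intersection multiplicities of `b` with `a` and `a'` agree if `a` and `a'` differ, up to units,
by a multiple of `b`. -/
lemma HasColength.congr {a a' b u v t : R} {n : ℕ} (h : HasColength (Ideal.span {a, b}) n)
    (hu : IsUnit u) (hv : IsUnit v) (e : u * a' = v * a + t * b) :
    HasColength (Ideal.span {a', b}) n := by
  suffices Ideal.span {a', b} = Ideal.span {a, b} by rwa [this]
  obtain ⟨u, rfl⟩ := hu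
  obtain ⟨v, rfl⟩ := hv
  have hu := u.inv_mul
  have hv := v.inv_mul
  apply le_antisymm
  · rw [Ideal.span_le]
    rintro x (rfl | rfl)
    · exact Ideal.mem_span_pair.2 ⟨↑u⁻¹ * v, ↑u⁻¹ * t, by
        linear_combination x * hu - (↑u⁻¹ : R) * e⟩
    · exact Ideal.subset_span (by simp)
  · rw [Ideal.span_le]
    rintro x (rfl | rfl)
    · exact Ideal.mem_span_pair.2 ⟨↑v⁻¹ * u, -(↑v⁻¹ * t), by
        linear_combination x * hv + (↑v⁻¹ : R) * e⟩
    · exact Ideal.subset_span (by simp)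

variable [DecompositionMonoid R]

lemma HasColength.mul {a b c : R} {m n : ℕ} (ha : HasColength (Ideal.span {a, c}) m)
    (hb : HasColength (Ideal.span {b, c}) n) : HasColength (Ideal.span {a * b, c}) (m + n) := by
  refine .of_isRelPrime (ha.isRelPrime.mul_left hb.isRelPrime) ?_
  have := colength_smul_sup a c (Ideal.span {b})
    (fun x hx => ha.isRelPrime.symm.dvd_of_dvd_mul_left hx)
  rw [Ideal.span_singleton_mul_span_singleton, ← Ideal.span_insert, ← Ideal.span_insert,
    ha.colength_eq, hb.colength_eq] at this
  rw [this]
  norm_cast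

lemma HasColength.pow {a c : R} {m : ℕ} (ha : HasColength (Ideal.span {a, c}) m) (k : ℕ) :
    HasColength (Ideal.span {a ^ (k + 1), c}) (m * (k + 1)) := by
  induction k with
  | zero => simpa using ha
  | succ k ih =>
    rw [pow_succ]
    exact ih.mul ha

end Colength

/-! ### The basic invariants and their relations -/

section Forms

variable {R : Type*} [CommRing R]

/-- The weighted form `P` with `a⁶ F = P(G, C)`, where `C` is the Hesse cubic through the nine base
points, `G` is the product of the three conics `yz = ax²`, `zx = ay²`, `xy = az²`, and `A = a³`. -/
def octic (A g c : R) : R := g * (c ^ 2 + (A - 4) * g) ^ 3 + 27 * A ^ 2 * g ^ 4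

/-- The partial derivative of `octic` with respect to `g`. -/
def octicG (A g c : R) : R :=
  (c ^ 2 + (A - 4) * g) ^ 3 + 3 * (A - 4) * g * (c ^ 2 + (A - 4) * g) ^ 2 + 108 * A ^ 2 * g ^ 3

/-- The partial derivative of `octic` with respect to `c`. -/
def octicC (A g c : R) : R := c * g * (c ^ 2 + (A - 4) * g) ^ 2 * 6

/-- The discriminant `A² ((x³ - y³) (y³ - z³) (z³ - x³))²` as a polynomial in the cubic `C`, the
product `p = xyz` and the sextic `G`. -/
def disc (A c p g : R) : R :=
  4 * (A - 1) ^ 3 * g * p ^ 4 + (A - 1) ^ 2 * c ^ 2 * p ^ 4 + (2 * A + 2) * c ^ 3 * p ^ 3 +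
    2 * (5 * A + 4) * (A - 1) * g * c * p ^ 3 +
    p ^ 2 * ((A ^ 2 - 20 * A - 8) * g ^ 2 + (8 * A - 2) * g * c ^ 2 + c ^ 4) +
    p * ((2 * A - 8) * g ^ 2 * c + 2 * g * c ^ 3) - 4 * g ^ 3 + g ^ 2 * c ^ 2

/-- The partial derivative of `disc` with respect to `c`. -/
def discC (A c p g : R) : R :=
  2 * (A - 1) ^ 2 * c * p ^ 4 + 3 * (2 * A + 2) * c ^ 2 * p ^ 3 +
    2 * (5 * A + 4) * (A - 1) * g * p ^ 3 +
    p ^ 2 * (2 * (8 * A - 2) * g * c + 4 * c ^ 3) +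
    p * ((2 * A - 8) * g ^ 2 + 6 * g * c ^ 2) + 2 * g ^ 2 * c

/-- The partial derivative of `disc` with respect to `p`. -/
def discP (A c p g : R) : R :=
  16 * (A - 1) ^ 3 * g * p ^ 3 + 4 * (A - 1) ^ 2 * c ^ 2 * p ^ 3 + 3 * (2 * A + 2) * c ^ 3 * p ^ 2 +
    6 * (5 * A + 4) * (A - 1) * g * c * p ^ 2 +
    2 * p * ((A ^ 2 - 20 * A - 8) * g ^ 2 + (8 * A - 2) * g * c ^ 2 + c ^ 4) +
    ((2 * A - 8) * g ^ 2 * c + 2 * g * c ^ 3)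

/-- The partial derivative of `disc` with respect to `g`. -/
def discG (A c p g : R) : R :=
  4 * (A - 1) ^ 3 * p ^ 4 + 2 * (5 * A + 4) * (A - 1) * c * p ^ 3 +
    p ^ 2 * (2 * (A ^ 2 - 20 * A - 8) * g + (8 * A - 2) * c ^ 2) +
    p * (2 * (2 * A - 8) * g * c + 2 * c ^ 3) - 12 * g ^ 2 + 2 * g * c ^ 2

/-- The coefficient of `g` in `disc`, after the terms free of `g` are split off. -/
def discU (A c p g : R) : R :=
  4 * (A - 1) ^ 3 * p ^ 4 + 2 * (5 * A + 4) * (A - 1) * c * p ^ 3 +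
    p ^ 2 * ((A ^ 2 - 20 * A - 8) * g + (8 * A - 2) * c ^ 2) +
    p * ((2 * A - 8) * g * c + 2 * c ^ 3) - 4 * g ^ 2 + g * c ^ 2

/-- The terms of `disc` free of `g`, divided by `c²`. -/
def discT (A c p : R) : R :=
  (A - 1) ^ 2 * p ^ 4 + (2 * A + 2) * c * p ^ 3 + c ^ 2 * p ^ 2

lemma disc_eq (A c p g : R) : disc A c p g = g * discU A c p g + c ^ 2 * discT A c p := by
  simp only [disc, discU, discT]; ring

section Maps

variable {R' F : Type*} [CommRing R'] [FunLike F R R'] [RingHomClass F R R'] (f : F) (A c p g : R)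

lemma map_octic : f (octic A g c) = octic (f A) (f g) (f c) := by simp [octic, map_ofNat]
lemma map_octicG : f (octicG A g c) = octicG (f A) (f g) (f c) := by simp [octicG, map_ofNat]
lemma map_octicC : f (octicC A g c) = octicC (f A) (f g) (f c) := by simp [octicC, map_ofNat]
lemma map_disc : f (disc A c p g) = disc (f A) (f c) (f p) (f g) := by simp [disc, map_ofNat]
lemma map_discC : f (discC A c p g) = discC (f A) (f c) (f p) (f g) := by simp [discC, map_ofNat]
lemma map_discP : f (discP A c p g) = discP (f A) (f c) (f p) (f g) := by simp [discP, map_ofNat]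
lemma map_discG : f (discG A c p g) = discG (f A) (f c) (f p) (f g) := by simp [discG, map_ofNat]

lemma map_relation {A c p g m m' c' p' g' : R} (h : 2 * m * m' =
    discC A c p g * c' + discP A c p g * p' + discG A c p g * g') :
    2 * f m * f m' = discC (f A) (f c) (f p) (f g) * f c' + discP (f A) (f c) (f p) (f g) * f p' +
      discG (f A) (f c) (f p) (f g) * f g' := by
  have := congrArg f h
  simpa only [map_add, map_mul, map_ofNat, map_discC, map_discP, map_discG] using this

end Maps

/-- By weighted homogeneity, `octic` is `c ^ 8` times its value at `(ν, 1)` on a curve `d = 0` on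
which `g = ν c²`. -/
lemma dvd_octic_sub {d A g c ν : R} (h : d ∣ g - ν * c ^ 2) :
    d ∣ octic A g c - c ^ 8 * octic A ν 1 := by
  rw [← Ideal.mem_span_singleton, ← Ideal.Quotient.mk_eq_mk_iff_sub_mem] at h ⊢
  rw [map_octic, h]
  simp only [octic, map_add, map_mul, map_pow, map_sub, map_ofNat, map_one]
  ring

lemma dvd_octicG_sub {d A g c ν : R} (h : d ∣ g - ν * c ^ 2) :
    d ∣ octicG A g c - c ^ 6 * octicG A ν 1 := by
  rw [← Ideal.mem_span_singleton, ← Ideal.Quotient.mk_eq_mk_iff_sub_mem] at h ⊢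
  rw [map_octicG, h]
  simp only [octicG, map_add, map_mul, map_pow, map_sub, map_ofNat, map_one]
  ring

lemma dvd_octicC_sub {d A g c ν : R} (h : d ∣ g - ν * c ^ 2) :
    d ∣ octicC A g c - c ^ 7 * octicC A ν 1 := by
  rw [← Ideal.mem_span_singleton, ← Ideal.Quotient.mk_eq_mk_iff_sub_mem] at h ⊢
  rw [map_octicC, h]
  simp only [octicC, map_add, map_mul, map_pow, map_sub, map_ofNat, map_one]
  ring

/-- The value of `2 g Φ_g + c Φ_c - 2 Φ` for `Φ = disc` along the curve `g = ν c²`, divided by `c³`.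
The operator multiplies the terms of weight `k` by `k - 2`, where `c` has weight `1` and `g` has
weight `2`, so it removes the terms of weight `2`; there are no terms of smaller weight. -/
def discTail (A c p ν : R) : R :=
  (2 * A + 2) * p ^ 3 + 2 * (5 * A + 4) * (A - 1) * ν * p ^ 3 +
    c * (2 * p ^ 2 * ((A ^ 2 - 20 * A - 8) * ν ^ 2 + (8 * A - 2) * ν + 1)) +
    c ^ 2 * (3 * p * ((2 * A - 8) * ν ^ 2 + 2 * ν)) + c ^ 3 * (4 * (-4 * ν ^ 3 + ν ^ 2))

lemma dvd_logDeriv_disc_sub {d A c p g ν : R} (h : d ∣ g - ν * c ^ 2) :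
    d ∣ 2 * g * discG A c p g + c * discC A c p g - 2 * disc A c p g - c ^ 3 * discTail A c p ν := by
  rw [← Ideal.mem_span_singleton, ← Ideal.Quotient.eq_zero_iff_mem]
  rw [← Ideal.mem_span_singleton, ← Ideal.Quotient.mk_eq_mk_iff_sub_mem] at h
  rw [map_sub, map_sub, map_add, map_mul, map_mul, map_mul, map_mul, map_mul, map_discG, map_discC,
    map_disc, h]
  simp only [disc, discC, discG, discTail, map_add, map_mul, map_pow, map_sub, map_ofNat, map_one,
    map_neg]
  ring

end Forms

lemma isUnit_of_sub_mem {R : Type*} [CommRing R] [IsLocalRing R] {x y : R} (hx : IsUnit x)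
    (h : y - x ∈ IsLocalRing.maximalIdeal R) : IsUnit y := by
  by_contra hy
  have h1 : y ∈ IsLocalRing.maximalIdeal R := hy
  have h2 : x = y - (y - x) := by ring
  exact (h2 ▸ sub_mem h1 h : x ∈ IsLocalRing.maximalIdeal R) hx

/-! ### Intersection multiplicities at a base point -/

section LocalRing

variable {R : Type} [CommRing R] [IsLocalRing R] [Algebra ℂ R]

/-- The situation in the local ring of the plane at one of the nine base points, in a standard
affine chart with coordinates `y, z`. The elements `c`, `g`, `p`, `j` are the germs of the Hesse
cubic `C`, the sextic `G`, the product `xyz` and `a³ (x³ - y³) (y³ - z³) (z³ - x³)`; the suffixes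
`y` and `z` stand for their partial derivatives. The constants are `A = a³` and the factor `κ` in the
formula for the Jacobian determinant of the three invariants `p`, `c`, `g`, in which Euler's identity
eliminates the derivatives with respect to the third homogeneous coordinate. -/
structure IsBaseGerm (A κ c g p j cy cz gy gz py pz jy jz : R) : Prop where
  isUnit_two : IsUnit (2 : R)
  isUnit_three : IsUnit (3 : R)
  isUnit_A : IsUnit A
  isUnit_A_sub_one : IsUnit (A - 1)
  isUnit_A_add_eight : IsUnit (A + 8)
  isUnit_κ : IsUnit κ
  isUnit_p : IsUnit p
  isUnit_cy : IsUnit cy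
  hasColength : HasColength (Ideal.span {j, c}) 1
  j_mem : j ∈ IsLocalRing.maximalIdeal R
  c_mem : c ∈ IsLocalRing.maximalIdeal R
  g_mem : g ∈ IsLocalRing.maximalIdeal R
  sq_j : j ^ 2 = disc A c p g
  two_mul_j_jy : 2 * j * jy = discC A c p g * cy + discP A c p g * py + discG A c p g * gy
  two_mul_j_jz : 2 * j * jz = discC A c p g * cz + discP A c p g * pz + discG A c p g * gz
  jacobian : 3 * p * (cy * gz - cz * gy) - 6 * g * (cy * pz - cz * py) +
    3 * c * (gy * pz - gz * py) = κ * j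

namespace IsBaseGerm

variable {A κ c g p j cy cz gy gz py pz jy jz : R}

section
variable (h : IsBaseGerm A κ c g p j cy cz gy gz py pz jy jz)
include h

lemma isUnit_lead : IsUnit (4 * (A - 1) ^ 3 * p ^ 4) := by
  have h4 : (4 : R) = 2 * 2 := by norm_num
  rw [h4]
  exact ((h.isUnit_two.mul h.isUnit_two).mul (h.isUnit_A_sub_one.pow 3)).mul (h.isUnit_p.pow 4)

lemma isUnit_discU : IsUnit (discU A c p g) := by
  refine isUnit_of_sub_mem h.isUnit_lead ?_
  have : discU A c p g - 4 * (A - 1) ^ 3 * p ^ 4 =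
      (2 * (5 * A + 4) * (A - 1) * p ^ 3 + p ^ 2 * (8 * A - 2) * c +
        p * ((2 * A - 8) * g + 2 * c ^ 2) + g * c) * c +
      (p ^ 2 * (A ^ 2 - 20 * A - 8) - 4 * g) * g := by
    simp only [discU]; ring
  rw [this]
  exact add_mem (Ideal.mul_mem_left _ _ h.c_mem) (Ideal.mul_mem_left _ _ h.g_mem)

lemma isUnit_discG : IsUnit (discG A c p g) := by
  refine isUnit_of_sub_mem h.isUnit_lead ?_
  have : discG A c p g - 4 * (A - 1) ^ 3 * p ^ 4 =
      (2 * (5 * A + 4) * (A - 1) * p ^ 3 + p ^ 2 * (8 * A - 2) * c +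
        p * (2 * (2 * A - 8) * g + 2 * c ^ 2) + 2 * g * c) * c +
      (2 * p ^ 2 * (A ^ 2 - 20 * A - 8) - 12 * g) * g := by
    simp only [discG]; ring
  rw [this]
  exact add_mem (Ideal.mul_mem_left _ _ h.c_mem) (Ideal.mul_mem_left _ _ h.g_mem)

variable [DecompositionMonoid R]

/-- Since `j² = U g + c² T` with a unit `U`, the sextic is tangent to order two to the cubic. -/
lemma hasColength_g_c : HasColength (Ideal.span {g, c}) 2 :=
  (h.hasColength.pow 1).congr (t := -c * discT A c p) (v := 1) h.isUnit_discU isUnit_one (by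
    linear_combination -h.sq_j - disc_eq A c p g)

/-- The intersection multiplicity of the two partial derivatives of `octic`. The second one is
`6 c g V²` with `V = c² + (A - 4) g`, and modulo each of `g`, `V`, `c` the first one is a unit times
a power of `V`, `g`, `g`, respectively. -/
lemma hasColength_octicG_octicC :
    HasColength (Ideal.span {octicC A g c, octicG A g c}) 42 := by
  have h6 : IsUnit (6 : R) := by
    have : (6 : R) = 2 * 3 := by norm_num
    rw [this]; exact h.isUnit_two.mul h.isUnit_three
  have h4 : IsUnit (4 : R) := by
    have : (4 : R) = 2 * 2 := by norm_num
    rw [this]; exact h.isUnit_two.mul h.isUnit_two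
  have h108 : IsUnit (108 * A ^ 2) := by
    have : (108 : R) = 2 * 2 * (3 * 3 * 3) := by norm_num
    rw [this]
    exact ((h.isUnit_two.mul h.isUnit_two).mul
      ((h.isUnit_three.mul h.isUnit_three).mul h.isUnit_three)).mul (h.isUnit_A.pow 2)
  have hgc := h.hasColength_g_c
  have hVg : HasColength (Ideal.span {c ^ 2 + (A - 4) * g, g}) 4 :=
    (hgc.symm.pow 1).congr (t := A - 4) (v := 1) isUnit_one isUnit_one (by ring)
  have h1 : HasColength (Ideal.span {octicG A g c, g}) 12 :=
    (hVg.pow 2).congr (v := 1) (t := 3 * (A - 4) * (c ^ 2 + (A - 4) * g) ^ 2 + 108 * A ^ 2 * g ^ 2)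
      isUnit_one isUnit_one (by simp only [octicG]; ring)
  have h2 : HasColength (Ideal.span {octicG A g c, c ^ 2 + (A - 4) * g}) 12 :=
    (hVg.symm.pow 2).congr (v := 108 * A ^ 2)
      (t := (c ^ 2 + (A - 4) * g) ^ 2 + 3 * (A - 4) * g * (c ^ 2 + (A - 4) * g))
      isUnit_one h108 (by simp only [octicG]; ring)
  have h3 : HasColength (Ideal.span {octicG A g c, c}) 6 :=
    (hgc.pow 2).congr (v := 4 * ((A - 1) * (A + 8) ^ 2))
      (t := c * ((c ^ 2 + (A - 4) * g) ^ 2 + (c ^ 2 + (A - 4) * g) * ((A - 4) * g)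
        + (A - 4) ^ 2 * g ^ 2 + 3 * (A - 4) * g * (c ^ 2 + 2 * ((A - 4) * g))))
      isUnit_one (h4.mul (h.isUnit_A_sub_one.mul (h.isUnit_A_add_eight.pow 2)))
      (by simp only [octicG]; ring)
  exact ((h3.symm.mul h1.symm).mul (h2.symm.pow 1)).congr (t := 0) isUnit_one h6
    (by simp only [octicC]; ring)

/-- If `w` is a derivative of `octic`, for which `c` has the unit `cw` as its derivative, then `w`
meets the `g`-derivative of `octic` with the same multiplicity as the `c`-derivative does. -/
lemma hasColength_octicG {w cw : R} (gw : R) (hcw : IsUnit cw)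
    (hw : w = octicG A g c * gw + octicC A g c * cw) :
    HasColength (Ideal.span {octicG A g c, w}) 42 :=
  (h.hasColength_octicG_octicC.congr (u := 1) (v := cw) (t := gw) isUnit_one hcw
    (by linear_combination hw)).symm

end

/-- The discriminant relation determines the value at the point of the leading coefficient `ν` of
`g = ν c²` along the curve `j = 0`: it is `-1 / (4 (A - 1))`. -/
lemma lead_add_one_mem (h : IsBaseGerm A κ c g p j cy cz gy gz py pz jy jz) {e ν : R}
    (hν : discU A c p g * ν = -discT A c p + e * c ^ 2) :
    4 * (A - 1) * ν + 1 ∈ IsLocalRing.maximalIdeal R := by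
  have hu : IsUnit ((A - 1) ^ 2 * p ^ 4) := (h.isUnit_A_sub_one.pow 2).mul (h.isUnit_p.pow 4)
  have e1 : (A - 1) ^ 2 * p ^ 4 * (4 * (A - 1) * ν + 1) =
      (-(2 * (5 * A + 4) * (A - 1) * p ^ 3 + p ^ 2 * (8 * A - 2) * c +
        p * ((2 * A - 8) * g + 2 * c ^ 2) + g * c) * ν - (2 * A + 2) * p ^ 3 - c * p ^ 2 +
        e * c) * c +
      (-(p ^ 2 * (A ^ 2 - 20 * A - 8) - 4 * g) * ν) * g := by
    simp only [discU, discT] at hν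
    linear_combination hν
  have : (A - 1) ^ 2 * p ^ 4 * (4 * (A - 1) * ν + 1) ∈ IsLocalRing.maximalIdeal R := by
    rw [e1]
    exact add_mem (Ideal.mul_mem_left _ _ h.c_mem) (Ideal.mul_mem_left _ _ h.g_mem)
  exact (Ideal.unit_mul_mem_iff_mem _ hu).1 this

/-- The lines `g = λ c²` of the four special members of the Halphen pencil differ from the tangent
direction `g = ν c²` of the curve `j = 0`. -/
lemma isUnit_octic_lead (h : IsBaseGerm A κ c g p j cy cz gy gz py pz jy jz) {ν : R}
    (hν : 4 * (A - 1) * ν + 1 ∈ IsLocalRing.maximalIdeal R) : IsUnit (octic A ν 1) := by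
  set ε := 4 * (A - 1) * ν + 1 with hε
  have h3 := h.isUnit_three
  have h27 : IsUnit (-(3 * 3 * 3 * A ^ 2 * (A - 1))) :=
    ((((h3.mul h3).mul h3).mul (h.isUnit_A.pow 2)).mul h.isUnit_A_sub_one).neg
  have e1 : (4 * (A - 1)) ^ 4 * octic A ν 1 =
      (-1 + ε) * ((3 * A + (A - 4) * ε) ^ 3 + 27 * A ^ 2 * (-1 + ε) ^ 3) := by
    simp only [octic, hε]; ring
  have h1 : IsUnit ((4 * (A - 1)) ^ 4 * octic A ν 1) := by
    refine isUnit_of_sub_mem h27 ?_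
    have : (4 * (A - 1)) ^ 4 * octic A ν 1 - -(3 * 3 * 3 * A ^ 2 * (A - 1)) =
        (((3 * A + (A - 4) * ε) ^ 3 + 27 * A ^ 2 * (-1 + ε) ^ 3) -
        (27 * A ^ 2 * (A - 4) + 9 * A * (A - 4) ^ 2 * ε + (A - 4) ^ 3 * ε ^ 2
        + 27 * A ^ 2 * (3 - 3 * ε + ε ^ 2))) * ε := by
      rw [e1]; ring
    rw [this]
    exact Ideal.mul_mem_left _ _ hν
  exact isUnit_of_mul_isUnit_right h1

/-- With `ν = -1 / (4 (A - 1))` the coefficient of `p³` in `discTail` is `-A / 2`. -/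
lemma isUnit_discTail (h : IsBaseGerm A κ c g p j cy cz gy gz py pz jy jz) {ν : R}
    (hν : 4 * (A - 1) * ν + 1 ∈ IsLocalRing.maximalIdeal R) : IsUnit (discTail A c p ν) := by
  have h1 : IsUnit (2 * discTail A c p ν) := by
    refine isUnit_of_sub_mem (h.isUnit_A.mul (h.isUnit_p.pow 3)).neg ?_
    have : 2 * discTail A c p ν - -(A * p ^ 3) = (5 * A + 4) * p ^ 3 * (4 * (A - 1) * ν + 1) +
        (2 * ((2 * p ^ 2 * ((A ^ 2 - 20 * A - 8) * ν ^ 2 + (8 * A - 2) * ν + 1)) +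
        c * (3 * p * ((2 * A - 8) * ν ^ 2 + 2 * ν)) + c ^ 2 * (4 * (-4 * ν ^ 3 + ν ^ 2)))) * c := by
      simp only [discTail]; ring
    rw [this]
    exact add_mem (Ideal.mul_mem_left _ _ hν) (Ideal.mul_mem_left _ _ h.c_mem)
  exact isUnit_of_mul_isUnit_right h1

end IsBaseGerm

end LocalRing

/-! ### The Milnor and Tjurina numbers of a base point -/

namespace IsBaseGerm

variable {R : Type} [CommRing R] [IsLocalRing R] [Algebra ℂ R]
  {A κ c g p j cy cz gy gz py pz jy jz : R}

/-- The critical curve of the pencil, on which the Jacobian determinant of `c` and `g` vanishes, agrees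
with the mirror `j = 0` up to terms of order two in `c`. -/
lemma j_mem_span (h : IsBaseGerm A κ c g p j cy cz gy gz py pz jy jz) :
    ∃ e f : R, j = e * (cy * gz - cz * gy) + f * c ^ 2 := by
  obtain ⟨tc, tg, hC⟩ : ∃ tc tg, discC A c p g = c * tc + g * tg :=
    ⟨2 * (A - 1) ^ 2 * p ^ 4 + 3 * (2 * A + 2) * c * p ^ 3 +
      p ^ 2 * (2 * (8 * A - 2) * g + 4 * c ^ 2) + 6 * p * g * c + 2 * g ^ 2,
      2 * (5 * A + 4) * (A - 1) * p ^ 3 + p * (2 * A - 8) * g, by simp only [discC]; ring⟩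
  set U := discU A c p g with hU
  set T := discT A c p with hT
  set Φ := discG A c p g with hΦ
  set M := cy * pz - cz * py with hM
  set N := jy * pz - jz * py with hN
  have hu : IsUnit (U * Φ * κ + j * (6 * Φ * M) + c * (3 * M * tg * j - 6 * U * N)) := by
    refine isUnit_of_sub_mem ((h.isUnit_discU.mul h.isUnit_discG).mul h.isUnit_κ) ?_
    have : U * Φ * κ + j * (6 * Φ * M) + c * (3 * M * tg * j - 6 * U * N) - U * Φ * κ =
      (6 * Φ * M) * j + (3 * M * tg * j - 6 * U * N) * c := by ring
    rw [this]
    exact add_mem (Ideal.mul_mem_left _ _ h.j_mem) (Ideal.mul_mem_left _ _ h.c_mem)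
  obtain ⟨w, hw⟩ := hu
  have hw' := w.inv_mul
  have hgU : g * U = j ^ 2 - c ^ 2 * T := by
    linear_combination -h.sq_j - disc_eq A c p g
  have key : (w : R) * j = 3 * p * U * Φ * (cy * gz - cz * gy) +
      c ^ 2 * (6 * Φ * T * M - 3 * M * U * tc + 3 * c * M * tg * T) := by
    rw [hw]
    linear_combination -U * Φ * h.jacobian - 3 * c * U * pz * h.two_mul_j_jy
      + 3 * c * U * py * h.two_mul_j_jz - 3 * c * U * M * hC -
      (6 * Φ * M + 3 * c * M * tg) * hgU
  refine ⟨↑w⁻¹ * (3 * p * U * Φ), ↑w⁻¹ * (6 * Φ * T * M - 3 * M * U * tc + 3 * c * M * tg * T), ?_⟩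
  linear_combination (↑w⁻¹ : R) * key - j * hw'

/-- Euler's relation for `disc`, combined with the derivative of the discriminant relation. -/
lemma discG_mul (h : IsBaseGerm A κ c g p j cy cz gy gz py pz jy jz) :
    discG A c p g * (p * (2 * g * cy - c * gy)) =
      (2 * g * discG A c p g + c * discC A c p g) * (p * cy - c * py) +
        j * c * (6 * j * py - 2 * p * jy) := by
  have e : p * discP A c p g =
      6 * disc A c p g - (2 * g * discG A c p g + c * discC A c p g) := by
    simp only [disc, discC, discP, discG]; ring
  linear_combination c * p * h.two_mul_j_jy + c * py * e - 6 * c * py * h.sq_j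

/-- The critical curve is transversal to the cubic, as the mirror is. -/
lemma hasColength_jacobian_c (h : IsBaseGerm A κ c g p j cy cz gy gz py pz jy jz) :
    HasColength (Ideal.span {cy * gz - cz * gy, c}) 1 := by
  have hu : IsUnit (discU A c p g * κ + j * (6 * (cy * pz - cz * py))) := by
    refine isUnit_of_sub_mem (h.isUnit_discU.mul h.isUnit_κ) ?_
    rw [add_sub_cancel_left]
    exact Ideal.mul_mem_right _ _ h.j_mem
  refine h.hasColength.congr (u := discU A c p g * (3 * p))
    (t := -(6 * (cy * pz - cz * py)) * c * discT A c p
      - 3 * discU A c p g * (gy * pz - gz * py))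
    (h.isUnit_discU.mul (h.isUnit_three.mul h.isUnit_p)) hu ?_
  linear_combination discU A c p g * h.jacobian - (6 * (cy * pz - cz * py)) *
    (h.sq_j + disc_eq A c p g)

variable [DecompositionMonoid R]

/-- The first partial derivative of the octic has order `7` on the critical curve
`cy * gz - cz * gy = 0`. There `c` is a local coordinate and `g = ν c²`, the octic is a unit times
`c ^ 8`, and the order of its derivative in the direction of the curve drops by one. -/
lemma hasColength_jacobian (h : IsBaseGerm A κ c g p j cy cz gy gz py pz jy jz) {w : R}
    (hw : w = octicG A g c * gy + octicC A g c * cy) :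
    HasColength (Ideal.span {cy * gz - cz * gy, w}) 7 := by
  obtain ⟨e, f, hj⟩ := h.j_mem_span
  set d := cy * gz - cz * gy with hd
  have hdc : HasColength (Ideal.span {d, c}) 1 := h.hasColength_jacobian_c
  obtain ⟨U, hU⟩ := h.isUnit_discU
  have hU' := U.inv_mul
  set ν : R := ↑U⁻¹ * (-discT A c p + f ^ 2 * c ^ 2) with hν
  have hlead : 4 * (A - 1) * ν + 1 ∈ IsLocalRing.maximalIdeal R :=
    h.lead_add_one_mem (e := f ^ 2) (by
      rw [hν, ← hU]; linear_combination (-discT A c p + f ^ 2 * c ^ 2) * hU')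
  have hgd : d ∣ g - ν * c ^ 2 := by
    refine ⟨↑U⁻¹ * (e * (j + f * c ^ 2)), ?_⟩
    rw [hν]
    have e1 := disc_eq A c p g
    rw [← hU] at e1
    linear_combination -g * hU' - ↑U⁻¹ * h.sq_j - ↑U⁻¹ * e1 +
      ↑U⁻¹ * (j + f * c ^ 2) * hj
  obtain ⟨t1, ht1⟩ := dvd_octic_sub (A := A) hgd
  obtain ⟨t2, ht2⟩ := dvd_octicG_sub (A := A) hgd
  obtain ⟨t3, ht3⟩ := dvd_logDeriv_disc_sub (A := A) (p := p) hgd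
  obtain ⟨V, hV⟩ := h.isUnit_discG.mul h.isUnit_p
  have hV' := V.inv_mul
  obtain ⟨r, t4, hr⟩ : ∃ r t, 2 * g * cy - c * gy = c ^ 3 * r + d * t := by
    refine ⟨↑V⁻¹ * ((2 * f ^ 2 * c + discTail A c p ν) * (p * cy - c * py) +
      f * (6 * j * py - 2 * p * jy)), ↑V⁻¹ * ((2 * e * (j + f * c ^ 2) + t3) * (p * cy - c * py) +
      e * c * (6 * j * py - 2 * p * jy)), ?_⟩
    have e1 := h.discG_mul
    linear_combination -(2 * g * cy - c * gy) * hV' + ↑V⁻¹ * (2 * g * cy - c * gy) * hV +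
      ↑V⁻¹ * e1 + ↑V⁻¹ * (p * cy - c * py) * (ht3 - 2 * h.sq_j + 2 * (j + f * c ^ 2) * hj) +
      ↑V⁻¹ * c * (6 * j * py - 2 * p * jy) * hj
  have h8 : 8 * octic A g c = 2 * g * octicG A g c + c * octicC A g c := by
    simp only [octic, octicG, octicC]; ring
  have hcw : d ∣ c * (w - c ^ 7 * (8 * octic A ν 1 * cy - octicG A ν 1 * r * c)) := by
    refine ⟨8 * cy * t1 - t2 * (c ^ 3 * r) - octicG A g c * t4, ?_⟩
    rw [hw]
    linear_combination -cy * h8 + 8 * cy * ht1 - (c ^ 3 * r) * ht2 - octicG A g c * hr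
  obtain ⟨t, ht⟩ := hdc.isRelPrime.dvd_of_dvd_mul_left hcw
  have h8u : IsUnit (8 * octic A ν 1 * cy) := by
    have : (8 : R) = 2 * 2 * 2 := by norm_num
    rw [this]
    exact (((h.isUnit_two.mul h.isUnit_two).mul h.isUnit_two).mul (h.isUnit_octic_lead hlead)).mul
      h.isUnit_cy
  have hu : IsUnit (8 * octic A ν 1 * cy - octicG A ν 1 * r * c) := by
    refine isUnit_of_sub_mem h8u ?_
    rw [sub_sub_cancel_left]
    exact neg_mem (Ideal.mul_mem_left _ _ h.c_mem)
  exact ((hdc.symm.pow 6).congr (t := t) (u := 1) isUnit_one hu (by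
    linear_combination ht)).symm

/-- The Milnor number of an octuple point of the arrangement. The curves `P_g = 0` and
`cy * gz - cz * gy = 0` make up the second polar curve, up to multiples of the first polar, and meet
the latter with multiplicities `42` and `7`. -/
theorem colength_milnor (h : IsBaseGerm A κ c g p j cy cz gy gz py pz jy jz) {wy wz : R}
    (hy : wy = octicG A g c * gy + octicC A g c * cy)
    (hz : wz = octicG A g c * gz + octicC A g c * cz) :
    colength (Ideal.span {wy, wz}) = 49 := by
  have h1 := (h.hasColength_octicG gy h.isUnit_cy hy).mul (h.hasColength_jacobian hy)
  have h2 : HasColength (Ideal.span {wz, wy}) 49 :=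
    h1.congr (v := 1) (t := cz) h.isUnit_cy isUnit_one (by rw [hy, hz]; ring)
  simpa using h2.symm.colength_eq

/-- The Tjurina number of an octuple point of the arrangement. The Tjurina ideal is
`P_g (j, c³) + (q)`, where `q = p f_y - 8 f p_y` is the numerator of the derivative of the rational
function `f / p⁸` of degree `0`. The curve `q = 0` meets `P_g = 0` with multiplicity `42`, and
`(j, c³)` has colength `3`. -/
theorem colength_tjurina (h : IsBaseGerm A κ c g p j cy cz gy gz py pz jy jz) {w wy wz : R}
    (hw : w = octic A g c)
    (hy : wy = octicG A g c * gy + octicC A g c * cy)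
    (hz : wz = octicG A g c * gz + octicC A g c * cz) :
    colength (Ideal.span {w, wy, wz}) = 45 := by
  obtain ⟨U, hU⟩ := h.isUnit_discU
  have hU' := U.inv_mul
  set ν : R := ↑U⁻¹ * (-discT A c p) with hν
  have hlead : 4 * (A - 1) * ν + 1 ∈ IsLocalRing.maximalIdeal R :=
    h.lead_add_one_mem (e := 0) (by
      rw [hν, ← hU]; linear_combination (-discT A c p) * hU')
  have hgd : j ∣ g - ν * c ^ 2 := by
    refine ⟨↑U⁻¹ * j, ?_⟩
    rw [hν]
    have e1 := disc_eq A c p g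
    rw [← hU] at e1
    linear_combination -g * hU' - ↑U⁻¹ * h.sq_j - ↑U⁻¹ * e1
  obtain ⟨t2, ht2⟩ := dvd_octicG_sub (A := A) hgd
  obtain ⟨t1, ht1⟩ := dvd_octicC_sub (A := A) hgd
  obtain ⟨t3, ht3⟩ := dvd_logDeriv_disc_sub (A := A) (p := p) hgd
  have h8 : 8 * octic A g c = 2 * g * octicG A g c + c * octicC A g c := by
    simp only [octic, octicG, octicC]; ring
  set γ := p * cy - c * py with hγ
  have hγu : IsUnit γ := by
    refine isUnit_of_sub_mem (h.isUnit_p.mul h.isUnit_cy) ?_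
    rw [hγ, sub_sub_cancel_left]
    exact neg_mem (Ideal.mul_mem_right _ _ h.c_mem)
  set q := p * wy - 8 * w * py with hq
  set q' := p * wz - 8 * w * pz with hq'
  have hqe : q = octicG A g c * (p * gy - 2 * g * py) + octicC A g c * γ := by
    rw [hq, hy, hw]; linear_combination -py * h8
  have hqe' : q' = octicG A g c * (p * gz - 2 * g * pz) + octicC A g c * (p * cz - c * pz) := by
    rw [hq', hz, hw]; linear_combination -pz * h8
  -- the radial combination of `w` and `q` is the multiple of `octicG` by a function of order `3`
  -- along the curve `j = 0`
  obtain ⟨r, t4, hru, hr⟩ : ∃ r t, IsUnit r ∧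
      discG A c p g * (p * (2 * g * cy - c * gy)) = c ^ 3 * r + j * t := by
    refine ⟨discTail A c p ν * γ, (2 * j + t3) * γ + c * (6 * j * py - 2 * p * jy),
      (h.isUnit_discTail hlead).mul hγu, ?_⟩
    linear_combination h.discG_mul + γ * ht3 - 2 * γ * h.sq_j
  obtain ⟨r, rfl⟩ := hru
  have hr' := r.inv_mul
  obtain ⟨Φ, hΦ⟩ := h.isUnit_discG
  have hΦ' := Φ.inv_mul
  rw [← hΦ] at hr
  have e8 : 8 * γ * w = octicG A g c * (p * (2 * g * cy - c * gy)) + c * q := by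
    rw [hqe, hw]; linear_combination γ * h8
  have ej : 3 * (γ * q' - (p * cz - c * pz) * q) = octicG A g c * (p * (κ * j)) := by
    rw [hqe, hqe']; linear_combination octicG A g c * p * h.jacobian
  set P := octicG A g c with hP
  have h8u : IsUnit (8 * γ) := by
    have : (8 : R) = 2 * 2 * 2 := by norm_num
    rw [this]
    exact ((h.isUnit_two.mul h.isUnit_two).mul h.isUnit_two).mul hγu
  have hPq : HasColength (Ideal.span {P, q}) 42 := h.hasColength_octicG _ hγu hqe
  have hjc : HasColength (Ideal.span {j, c ^ 3}) 3 := (h.hasColength.symm.pow 2).symm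
  have hqmem : q ∈ Ideal.span {j, c ^ 3} := by
    refine Ideal.mem_span_pair.2 ⟨t2 * (p * gy - 2 * g * py) + t1 * γ,
      c ^ 3 * octicG A ν 1 * (p * gy - 2 * g * py) + c ^ 4 * octicC A ν 1 * γ, ?_⟩
    rw [hqe]
    linear_combination -(p * gy - 2 * g * py) * ht2 - γ * ht1
  have hT : Ideal.span {w, wy, wz} = Ideal.span {P} * Ideal.span {j, c ^ 3} ⊔ Ideal.span {q} := by
    apply le_antisymm
    · set T := Ideal.span {P} * Ideal.span {j, c ^ 3} ⊔ Ideal.span {q} with hTdef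
      have hq1 : q ∈ T := Ideal.mem_sup_right (Ideal.mem_span_singleton_self q)
      have hj1 : P * j ∈ T := Ideal.mem_sup_left (Ideal.mul_mem_mul
        (Ideal.mem_span_singleton_self P) (Ideal.subset_span (by simp)))
      have hc1 : P * c ^ 3 ∈ T := Ideal.mem_sup_left (Ideal.mul_mem_mul
        (Ideal.mem_span_singleton_self P) (Ideal.subset_span (by simp)))
      have hw1 : w ∈ T := by
        refine (Ideal.unit_mul_mem_iff_mem _ (Φ.isUnit.mul h8u)).1 ?_
        have : ↑Φ * (8 * γ) * w = ↑r * (P * c ^ 3) + t4 * (P * j) + ↑Φ * c * q := by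
          linear_combination (Φ : R) * e8 + P * hr
        rw [this]
        exact add_mem (add_mem (Ideal.mul_mem_left _ _ hc1) (Ideal.mul_mem_left _ _ hj1))
          (Ideal.mul_mem_left _ _ hq1)
      have hq1' : q' ∈ T := by
        refine (Ideal.unit_mul_mem_iff_mem _ (h.isUnit_three.mul hγu)).1 ?_
        have : 3 * γ * q' = p * κ * (P * j) + 3 * (p * cz - c * pz) * q := by
          linear_combination ej
        rw [this]
        exact add_mem (Ideal.mul_mem_left _ _ hj1) (Ideal.mul_mem_left _ _ hq1)
      rw [Ideal.span_le]
      rintro x (rfl | rfl | rfl)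
      · exact hw1
      · refine (Ideal.unit_mul_mem_iff_mem _ h.isUnit_p).1 ?_
        have : p * x = q + 8 * py * w := by rw [hq]; ring
        rw [this]
        exact add_mem hq1 (Ideal.mul_mem_left _ _ hw1)
      · refine (Ideal.unit_mul_mem_iff_mem _ h.isUnit_p).1 ?_
        have : p * x = q' + 8 * pz * w := by rw [hq']; ring
        rw [this]
        exact add_mem hq1' (Ideal.mul_mem_left _ _ hw1)
    · set T := Ideal.span {w, wy, wz} with hTdef
      have hw1 : w ∈ T := Ideal.subset_span (by simp)
      have hq1 : q ∈ T := sub_mem (Ideal.mul_mem_left _ _ (Ideal.subset_span (by simp)))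
        (Ideal.mul_mem_right _ _ (Ideal.mul_mem_left _ _ hw1))
      have hq1' : q' ∈ T := sub_mem (Ideal.mul_mem_left _ _ (Ideal.subset_span (by simp)))
        (Ideal.mul_mem_right _ _ (Ideal.mul_mem_left _ _ hw1))
      have hj1 : P * j ∈ T := by
        refine (Ideal.unit_mul_mem_iff_mem _ (h.isUnit_p.mul h.isUnit_κ)).1 ?_
        have : p * κ * (P * j) = 3 * γ * q' - 3 * (p * cz - c * pz) * q := by
          linear_combination -ej
        rw [this]
        exact sub_mem (Ideal.mul_mem_left _ _ hq1') (Ideal.mul_mem_left _ _ hq1)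
      have hc1 : P * c ^ 3 ∈ T := by
        refine (Ideal.unit_mul_mem_iff_mem _ r.isUnit).1 ?_
        have : ↑r * (P * c ^ 3) = ↑Φ * (8 * γ) * w - (t4 * (P * j) + ↑Φ * c * q) := by
          linear_combination -(Φ : R) * e8 - P * hr
        rw [this]
        exact sub_mem (Ideal.mul_mem_left _ _ hw1)
          (add_mem (Ideal.mul_mem_left _ _ hj1) (Ideal.mul_mem_left _ _ hq1))
      refine sup_le ?_ ((Ideal.span_singleton_le_iff_mem _).2 hq1)
      rw [Ideal.span_singleton_mul_le_iff]
      intro x hx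
      obtain ⟨u, v, rfl⟩ := Ideal.mem_span_pair.1 hx
      have : P * (u * j + v * c ^ 3) = u * (P * j) + v * (P * c ^ 3) := by ring
      rw [this]
      exact add_mem (Ideal.mul_mem_left _ _ hj1) (Ideal.mul_mem_left _ _ hc1)
  rw [hT, colength_smul_sup _ _ _ (fun x hx => hPq.isRelPrime.symm.dvd_of_dvd_mul_left hx),
    hPq.colength_eq, sup_eq_left.2 ((Ideal.span_singleton_le_iff_mem _).2 hqmem), hjc.colength_eq]
  norm_num

end IsBaseGerm
/-! ### Germs at the origin of the affine plane -/

section OriginGerms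

lemma exists_eq_C_add (f : MvPolynomial (Fin 2) ℂ) :
    ∃ g h, f = C (constantCoeff f) + X 0 * g + X 1 * h := by
  induction f using MvPolynomial.induction_on with
  | C a => exact ⟨0, 0, by simp⟩
  | add p q hp hq =>
    obtain ⟨g, h, e⟩ := hp
    obtain ⟨g', h', e'⟩ := hq
    exact ⟨g + g', h + h', by rw [map_add, C_add]; linear_combination e + e'⟩
  | mul_X p i hp =>
    obtain ⟨g, h, e⟩ := hp
    fin_cases i
    · exact ⟨p, 0, by simp [mul_comm]⟩
    · exact ⟨0, p, by simp [mul_comm]⟩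

lemma constantCoeff_pderiv_eq {f g h : MvPolynomial (Fin 2) ℂ}
    (e : f = C (constantCoeff f) + X 0 * g + X 1 * h) :
    constantCoeff (pderiv 0 f) = constantCoeff g ∧ constantCoeff (pderiv 1 f) = constantCoeff h := by
  constructor <;>
  · conv_lhs => rw [e]
    simp [Derivation.leibniz, pderiv_X]

/-- The germ at the origin of a polynomial in two variables. -/
abbrev germ : MvPolynomial (Fin 2) ℂ →ₐ[ℂ] LocalRing := IsScalarTower.toAlgHom ℂ _ LocalRing

lemma germ_mem_maximalIdeal {f : MvPolynomial (Fin 2) ℂ} :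
    germ f ∈ IsLocalRing.maximalIdeal LocalRing ↔ constantCoeff f = 0 :=
  (IsLocalization.AtPrime.to_map_mem_maximal_iff LocalRing originIdeal f).trans RingHom.mem_ker

lemma isUnit_germ {f : MvPolynomial (Fin 2) ℂ} : IsUnit (germ f) ↔ constantCoeff f ≠ 0 := by
  rw [← not_iff_not, not_not, ← germ_mem_maximalIdeal]
  rfl

lemma maximalIdeal_eq_map :
    originIdeal.map (algebraMap _ LocalRing) = IsLocalRing.maximalIdeal LocalRing :=
  Localization.AtPrime.map_eq_maximalIdeal

/-- By Nakayama's lemma, two functions vanishing at the origin with linearly independent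
differentials generate the maximal ideal. -/
lemma span_germ_eq_maximalIdeal {f g : MvPolynomial (Fin 2) ℂ} (hf : constantCoeff f = 0)
    (hg : constantCoeff g = 0)
    (hfg : constantCoeff (pderiv 0 f * pderiv 1 g - pderiv 1 f * pderiv 0 g) ≠ 0) :
    Ideal.span {germ f, germ g} = IsLocalRing.maximalIdeal LocalRing := by
  set m := IsLocalRing.maximalIdeal LocalRing with hm
  apply le_antisymm
  · rw [Ideal.span_le]
    rintro x (rfl | rfl)
    · exact germ_mem_maximalIdeal.2 hf
    · exact germ_mem_maximalIdeal.2 hg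
  obtain ⟨f0, f1, ef⟩ := exists_eq_C_add f
  obtain ⟨g0, g1, eg⟩ := exists_eq_C_add g
  have df := constantCoeff_pderiv_eq ef
  have dg := constantCoeff_pderiv_eq eg
  rw [hf, C_0, zero_add] at ef
  rw [hg, C_0, zero_add] at eg
  have hu : IsUnit (germ (f0 * g1 - f1 * g0)) := by
    rw [isUnit_germ]
    simpa [df.1, df.2, dg.1, dg.2] using hfg
  have h0 : germ (X 0) ∈ Ideal.span {germ f, germ g} := by
    refine (Ideal.unit_mul_mem_iff_mem _ hu).1 (Ideal.mem_span_pair.2 ⟨germ g1, -germ f1, ?_⟩)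
    rw [← map_mul, ← map_neg, ← map_mul, ← map_add, ← map_mul]
    congr 1
    linear_combination g1 * ef - f1 * eg
  have h1 : germ (X 1) ∈ Ideal.span {germ f, germ g} := by
    refine (Ideal.unit_mul_mem_iff_mem _ hu).1 (Ideal.mem_span_pair.2 ⟨-germ g0, germ f0, ?_⟩)
    rw [← map_neg, ← map_mul, ← map_mul, ← map_add, ← map_mul]
    congr 1
    linear_combination -g0 * ef + f0 * eg
  rw [hm, ← maximalIdeal_eq_map, Ideal.map_le_iff_le_comap]
  intro x hx
  obtain ⟨x0, x1, ex⟩ := exists_eq_C_add x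
  rw [RingHom.mem_ker.1 hx, C_0, zero_add] at ex
  change germ x ∈ Ideal.span {germ f, germ g}
  rw [ex, map_add, map_mul, map_mul]
  exact add_mem (Ideal.mul_mem_right _ _ h0) (Ideal.mul_mem_right _ _ h1)

/-- The origin is a point of multiplicity one in the plane. -/
lemma hasColength_maximalIdeal : HasColength (IsLocalRing.maximalIdeal LocalRing) 1 := by
  constructor
  · intro d hd
    by_contra hdu
    have hx : ∀ i : Fin 2, d ∣ germ (X i) := fun i =>
      Ideal.mem_span_singleton.1 (hd (germ_mem_maximalIdeal.2 (by simp)))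
    obtain ⟨⟨d0, s⟩, hs⟩ := IsLocalization.surj originIdeal.primeCompl d
    have hsu : IsUnit (germ s) := IsLocalization.map_units LocalRing s
    have hd0 : constantCoeff d0 = 0 := by
      by_contra h
      refine hdu (isUnit_of_mul_isUnit_left (y := germ s) ?_)
      exact hs ▸ isUnit_germ.2 h
    have key : ∀ i : Fin 2, ∃ e t : MvPolynomial (Fin 2) ℂ, constantCoeff t ≠ 0 ∧
        X i * t = d0 * e := by
      intro i
      obtain ⟨e, he⟩ := hx i
      obtain ⟨⟨e0, t⟩, ht⟩ := IsLocalization.surj originIdeal.primeCompl e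
      have htu : IsUnit (germ t) := IsLocalization.map_units LocalRing t
      refine ⟨e0, s * t, isUnit_germ.1 (by rw [map_mul]; exact hsu.mul htu), ?_⟩
      apply IsLocalization.injective LocalRing originIdeal.primeCompl_le_nonZeroDivisors
      change germ _ = germ _
      rw [map_mul, map_mul, map_mul, he]
      have hs' : d * germ s = germ d0 := hs
      have ht' : e * germ t = germ e0 := ht
      rw [← hs', ← ht']
      ring
    obtain ⟨e, t, ht, h0⟩ := key 0
    obtain ⟨e', t', ht', h1⟩ := key 1
    have a := congrArg (fun p => constantCoeff (pderiv 0 p)) h0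
    have b := congrArg (fun p => constantCoeff (pderiv 1 p)) h0
    have c := congrArg (fun p => constantCoeff (pderiv 1 p)) h1
    simp [Derivation.leibniz, pderiv_X, hd0] at a b c
    rcases b with b | b
    · exact ht (by rw [a, b, zero_mul])
    · exact ht' (by rw [c, b, mul_zero])
  · have hb : Function.Bijective
        (algebraMap ℂ (LocalRing ⧸ IsLocalRing.maximalIdeal LocalRing)) := by
      refine ⟨(algebraMap ℂ _).injective, fun x => ?_⟩
      obtain ⟨x, rfl⟩ := Ideal.Quotient.mk_surjective x
      obtain ⟨⟨f, s⟩, hs⟩ := IsLocalization.surj originIdeal.primeCompl x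
      have hsu : IsUnit (germ s) := IsLocalization.map_units LocalRing s
      have hs0 : constantCoeff (s : MvPolynomial (Fin 2) ℂ) ≠ 0 := isUnit_germ.1 hsu
      refine ⟨constantCoeff f / constantCoeff (s : MvPolynomial (Fin 2) ℂ), ?_⟩
      have e1 : algebraMap ℂ (LocalRing ⧸ IsLocalRing.maximalIdeal LocalRing)
          (constantCoeff f / constantCoeff (s : MvPolynomial (Fin 2) ℂ)) =
          Ideal.Quotient.mk _
            (germ (C (constantCoeff f / constantCoeff (s : MvPolynomial (Fin 2) ℂ)))) := by
        rw [show (C (constantCoeff f / constantCoeff (s : MvPolynomial (Fin 2) ℂ)) :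
          MvPolynomial (Fin 2) ℂ) = algebraMap ℂ _ _ from rfl, AlgHom.commutes]
        rfl
      rw [e1, Ideal.Quotient.eq]
      refine (Ideal.unit_mul_mem_iff_mem _ hsu).1 ?_
      have hs' : x * germ s = germ f := hs
      rw [mul_sub, mul_comm _ x, hs', ← map_mul, ← map_sub, germ_mem_maximalIdeal]
      simp [mul_div_cancel₀ _ hs0]
    let e : ℂ ≃ₗ[ℂ] (LocalRing ⧸ IsLocalRing.maximalIdeal LocalRing) :=
      LinearEquiv.ofBijective (Algebra.linearMap ℂ _) hb
    rw [colength, ← e.rank_eq]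
    simp

end OriginGerms

/-! ### Germs in the standard charts of the projective plane -/

section Chart

/-- Dehomogenization in the chart `xᵢ = 1`, with the point `n` moved to the origin. -/
def dehom (i : Fin 3) (n : Fin 3 → ℂ) : S →ₐ[ℂ] MvPolynomial (Fin 2) ℂ :=
  aeval fun l : Fin 3 =>
    C (n l) + Fin.insertNth (α := fun _ => MvPolynomial (Fin 2) ℂ) i 0 X l

lemma localEquation_eq (F : S) (p : Plane) :
    localEquation F p = dehom (chartIndex p.rep) (normalized p) F := rfl

lemma constantCoeff_dehom (i : Fin 3) (n : Fin 3 → ℂ) (G : S) :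
    constantCoeff (dehom i n G) = eval n G := by
  induction G using MvPolynomial.induction_on with
  | C a => simp [dehom]
  | add p q hp hq => simp [hp, hq]
  | mul_X p l hp =>
    rw [map_mul, map_mul, map_mul, hp, eval_X]
    congr 1
    rw [dehom, aeval_X]
    rcases Fin.eq_self_or_eq_succAbove i l with rfl | ⟨k, rfl⟩ <;> simp

lemma pderiv_dehom (i : Fin 3) (n : Fin 3 → ℂ) (k : Fin 2) (G : S) :
    pderiv k (dehom i n G) = dehom i n (pderiv (i.succAbove k) G) := by
  induction G using MvPolynomial.induction_on with
  | C a => simp [dehom]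
  | add p q hp hq => simp [hp, hq]
  | mul_X p l hp =>
    have hX : pderiv k (dehom i n (X l)) = dehom i n (pderiv (i.succAbove k) (X l)) := by
      rw [dehom, aeval_X, map_add, pderiv_C, zero_add]
      rcases Fin.eq_self_or_eq_succAbove i l with rfl | ⟨k', rfl⟩
      · simp [pderiv_X]
      · simp only [Fin.insertNth_apply_succAbove, pderiv_X]
        by_cases h : k' = k
        · subst h; simp
        · rw [Pi.single_eq_of_ne (by simpa using h), Pi.single_eq_of_ne (by simpa using h), map_zero]
    rw [map_mul, Derivation.leibniz, hp, hX, Derivation.leibniz]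
    simp [smul_eq_mul]

lemma dehom_X_self (i : Fin 3) (n : Fin 3 → ℂ) : dehom i n (X i) = C (n i) := by
  simp [dehom]

lemma exists_unit_smul_normalized (p : Plane) :
    ∃ l : ℂ, l ≠ 0 ∧ normalized p = l • p.rep ∧ normalized p (chartIndex p.rep) = 1 := by
  have h : p.rep (chartIndex p.rep) ≠ 0 := by
    unfold chartIndex
    split_ifs with h0 h1
    · exact h0
    · exact h1
    · intro h2
      apply p.rep_nonzero
      rw [not_not] at h0 h1
      funext i
      fin_cases i
      · exact h0
      · exact h1
      · exact h2
  exact ⟨(p.rep (chartIndex p.rep))⁻¹, inv_ne_zero h, rfl, by simp [normalized, h]⟩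

lemma localDim_span_pair (f g : MvPolynomial (Fin 2) ℂ) :
    localDim (Ideal.span {f, g}) = colength (Ideal.span {germ f, germ g}) := by
  unfold localDim colength
  rw [Ideal.map_span, Set.image_pair]
  rfl

lemma localDim_span_triple (f g h : MvPolynomial (Fin 2) ℂ) :
    localDim (Ideal.span {f, g, h}) = colength (Ideal.span {germ f, germ g, germ h}) := by
  unfold localDim colength
  rw [Ideal.map_span, Set.image_insert_eq, Set.image_pair]
  rfl

/-- The germ of a homogeneous polynomial at a point of the plane, in the standard chart. -/
def germAt (p : Plane) : S →ₐ[ℂ] LocalRing := germ.comp (dehom (chartIndex p.rep) (normalized p))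

lemma milnorNumber_eq (F : S) (p : Plane) :
    milnorNumber F p = colength (Ideal.span {germAt p (pderiv ((chartIndex p.rep).succAbove 0) F),
      germAt p (pderiv ((chartIndex p.rep).succAbove 1) F)}) := by
  rw [milnorNumber, localDim_span_pair, localEquation_eq, pderiv_dehom, pderiv_dehom]
  rfl

lemma tjurinaNumber_eq (F : S) (p : Plane) :
    tjurinaNumber F p = colength (Ideal.span {germAt p F,
      germAt p (pderiv ((chartIndex p.rep).succAbove 0) F),
      germAt p (pderiv ((chartIndex p.rep).succAbove 1) F)}) := by
  rw [tjurinaNumber, localDim_span_triple, localEquation_eq, pderiv_dehom, pderiv_dehom]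
  rfl

lemma germAt_mem {p : Plane} {G : S} :
    germAt p G ∈ IsLocalRing.maximalIdeal LocalRing ↔ eval (normalized p) G = 0 := by
  rw [germAt, AlgHom.comp_apply, germ_mem_maximalIdeal, constantCoeff_dehom]

lemma isUnit_germAt {p : Plane} {G : S} :
    IsUnit (germAt p G) ↔ eval (normalized p) G ≠ 0 := by
  rw [germAt, AlgHom.comp_apply, isUnit_germ, constantCoeff_dehom]

lemma span_germAt_eq_maximalIdeal {p : Plane} {f g : S} (hf : eval (normalized p) f = 0)
    (hg : eval (normalized p) g = 0)
    (hfg : eval (normalized p)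
      (pderiv ((chartIndex p.rep).succAbove 0) f * pderiv ((chartIndex p.rep).succAbove 1) g -
      pderiv ((chartIndex p.rep).succAbove 1) f * pderiv ((chartIndex p.rep).succAbove 0) g) ≠ 0) :
    Ideal.span {germAt p f, germAt p g} = IsLocalRing.maximalIdeal LocalRing := by
  simp only [germAt, AlgHom.comp_apply]
  apply span_germ_eq_maximalIdeal
  · rwa [constantCoeff_dehom]
  · rwa [constantCoeff_dehom]
  · rwa [pderiv_dehom, pderiv_dehom, pderiv_dehom, pderiv_dehom, ← map_mul, ← map_mul, ← map_sub,
      constantCoeff_dehom]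

end Chart

/-! ### The four triples of conics -/

section Frames

variable {ω : ℂ}

lemma one_add_omega (hω : IsPrimitiveRoot ω 3) : ω ^ 2 + ω + 1 = 0 := by
  have := hω.geom_sum_eq_zero (by norm_num)
  simp [Finset.sum_range_succ] at this
  linear_combination this

lemma pow_add_fin (hω : IsPrimitiveRoot ω 3) (i j : Fin 3) :
    ω ^ ((i + j : Fin 3) : ℕ) = ω ^ (i : ℕ) * ω ^ (j : ℕ) := by
  rw [← pow_add, Fin.val_add, ← pow_eq_pow_mod _ hω.pow_eq_one]

lemma pow_fin_cube (hω : IsPrimitiveRoot ω 3) (i : Fin 3) : (ω ^ (i : ℕ)) ^ 3 = 1 := by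
  rw [← pow_mul, mul_comm, pow_mul, hω.pow_eq_one, one_pow]

lemma pow_sub_fin_mul (hω : IsPrimitiveRoot ω 3) (i j : Fin 3) :
    ω ^ ((i - j : Fin 3) : ℕ) * ω ^ (j : ℕ) = ω ^ (i : ℕ) := by
  rw [← pow_add_fin hω, sub_add_cancel]

/-- The index of the conics, arranged in four triples: the triple `none` consists of the conics
`x_{k+1} x_{k+2} = a x_k²`, and the triple `some m` of the conics with index `i + j = m`. Each
triple is a special member of the Halphen pencil. -/
def conicIdx : Option (Fin 3) → Fin 3 → ConicIndex
  | none, k => Sum.inl k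
  | some m, k => Sum.inr (k, m - k)

/-- The sorting of the twelve conics into four triples. -/
def conicEquiv : Option (Fin 3) × Fin 3 ≃ ConicIndex :=
  Equiv.ofBijective (fun x => conicIdx x.1 x.2) (by decide)

/-- The linear forms `L₀, L₁, L₂` in which the three conics of a triple are, up to scalars,
`L_{k+1} L_{k+2} = b L_k²`. -/
def frameForm (ω : ℂ) : Option (Fin 3) → Fin 3 → S
  | none, k => X k
  | some m, k => X 0 + C (ω ^ (k : ℕ)) * X 1 + C (ω ^ ((m - k : Fin 3) : ℕ)) * X 2

/-- The parameter `b` of the arrangement in the coordinates `frameForm`. -/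
def frameParam (a ω : ℂ) : Option (Fin 3) → ℂ
  | none => a
  | some m => (a * ω ^ (m : ℕ) + 2) / (a * ω ^ (m : ℕ) - 1)

/-- The scalar by which a conic differs from its equation in the coordinates `frameForm`. -/
def frameScale (a ω : ℂ) : Option (Fin 3) → ℂ
  | none => 1
  | some m => -(a * ω ^ (m : ℕ) - 1) / 3

/-- The vertices of the coordinate triangles: `frameForm ω c l` vanishes at `frameVertex ω c k` for
`l ≠ k`. -/
def frameVertex (ω : ℂ) : Option (Fin 3) → Fin 3 → Fin 3 → ℂ
  | none, k => Pi.single k 1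
  | some m, k => ![1, ω ^ ((-k : Fin 3) : ℕ), ω ^ ((k - m : Fin 3) : ℕ)]

/-- The value of `frameForm` at the vertex opposite to the line it defines. -/
def frameNorm : Option (Fin 3) → ℂ
  | none => 1
  | some _ => 3

lemma frameNorm_ne_zero (c : Option (Fin 3)) : frameNorm c ≠ 0 := by
  cases c <;> simp [frameNorm]

lemma eval_frameForm_some (v : Fin 3 → ℂ) (m k : Fin 3) :
    eval v (frameForm ω (some m) k) =
      v 0 + ω ^ (k : ℕ) * v 1 + ω ^ ((m - k : Fin 3) : ℕ) * v 2 := by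
  simp [frameForm]

lemma eval_frameForm_vertex (hω : IsPrimitiveRoot ω 3) (c : Option (Fin 3)) (k l : Fin 3) :
    eval (frameVertex ω c k) (frameForm ω c l) = if l = k then frameNorm c else 0 := by
  cases c with
  | none => simp [frameVertex, frameForm, frameNorm, Pi.single_apply]
  | some m =>
    have h := one_add_omega hω
    have e1 : ω ^ (l : ℕ) * ω ^ ((-k : Fin 3) : ℕ) = ω ^ ((l - k : Fin 3) : ℕ) := by
      rw [← pow_add_fin hω, sub_eq_add_neg]
    have e2 : ω ^ ((m - l : Fin 3) : ℕ) * ω ^ ((k - m : Fin 3) : ℕ) =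
        ω ^ ((k - l : Fin 3) : ℕ) := by
      rw [← pow_add_fin hω]; congr 2; abel
    rw [eval_frameForm_some]
    simp only [frameVertex, Matrix.cons_val, e1, e2, frameNorm]
    clear e1 e2
    fin_cases k <;> fin_cases l <;>
      simp [show (-2 : Fin 3) = 1 from rfl, show (-1 : Fin 3) = 2 from rfl] <;>
      first
        | (norm_num; done)
        | linear_combination h

lemma eval_smul_frameForm (t : ℂ) (v : Fin 3 → ℂ) (c : Option (Fin 3)) (k : Fin 3) :
    eval (t • v) (frameForm ω c k) = t * eval v (frameForm ω c k) := by
  cases c <;> simp [frameForm]; ring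

lemma eval_add_frameForm (v w : Fin 3 → ℂ) (c : Option (Fin 3)) (k : Fin 3) :
    eval (v + w) (frameForm ω c k) = eval v (frameForm ω c k) + eval w (frameForm ω c k) := by
  cases c <;> simp [frameForm]; ring

/-- The values of the three forms, shifted cyclically by `k`. -/
lemma eval_frameForm_shift (hω : IsPrimitiveRoot ω 3) (v : Fin 3 → ℂ) (m k : Fin 3) :
    eval v (frameForm ω (some m) (k + 1)) =
      v 0 + ω * ω ^ (k : ℕ) * v 1 + ω ^ 2 * ω ^ ((m - k : Fin 3) : ℕ) * v 2 ∧
    eval v (frameForm ω (some m) (k + 2)) =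
      v 0 + ω ^ 2 * ω ^ (k : ℕ) * v 1 + ω * ω ^ ((m - k : Fin 3) : ℕ) * v 2 := by
  have e1 : m - (k + 1) = 2 + (m - k) := by revert m k; decide
  have e2 : m - (k + 2) = 1 + (m - k) := by revert m k; decide
  rw [eval_frameForm_some, eval_frameForm_some, e1, e2, add_comm k 1, add_comm k 2,
    pow_add_fin hω, pow_add_fin hω, pow_add_fin hω, pow_add_fin hω]
  simp

lemma omega_mul_omega {K : Type*} [CommRing K] {w : K} (h : w ^ 2 + w + 1 = 0) (x y z : K) :
    (x + w * y + w ^ 2 * z) * (x + w ^ 2 * y + w * z) =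
      x ^ 2 + y ^ 2 + z ^ 2 - x * y - x * z - y * z := by
  linear_combination h * (x * y + x * z + y * z * (w ^ 2 - w + 1) + (w - 1) * (y ^ 2 + z ^ 2))

lemma omega_add_omega {K : Type*} [CommRing K] {w : K} (h : w ^ 2 + w + 1 = 0) (x y z : K) :
    (x + w * y + w ^ 2 * z) + (x + w ^ 2 * y + w * z) = 2 * x - y - z := by
  linear_combination h * (y + z)

/-- A vector is determined by the values of the three forms. -/
lemma eq_zero_of_frameForm (hω : IsPrimitiveRoot ω 3) (c : Option (Fin 3)) {v : Fin 3 → ℂ}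
    (h : ∀ k, eval v (frameForm ω c k) = 0) : v = 0 := by
  cases c with
  | none => funext k; simpa [frameForm] using h k
  | some m =>
    have h1 := h 0
    have h2 := h (0 + 1)
    have h3 := h (0 + 2)
    rw [(eval_frameForm_shift hω v m 0).1] at h2
    rw [(eval_frameForm_shift hω v m 0).2] at h3
    rw [eval_frameForm_some] at h1
    simp only [sub_zero, Fin.val_zero, pow_zero, mul_one, one_mul] at h1 h2 h3
    have hw := one_add_omega hω
    have hm : ω ^ (m : ℕ) ≠ 0 := pow_ne_zero _ (hω.ne_zero (by norm_num))
    have x0 : v 0 = 0 := by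
      linear_combination (h1 + h2 + h3) / 3 - (v 1 + ω ^ (m : ℕ) * v 2) / 3 * hw
    have x1 : v 1 = 0 := by
      linear_combination (h1 + ω ^ 2 * h2 + ω * h3) / 3 - (v 0 + ω ^ (m : ℕ) * v 2 *
        (ω ^ 2 - ω + 1) + 2 * v 1 * (ω - 1)) / 3 * hw
    have x2 : ω ^ (m : ℕ) * v 2 = 0 := by
      linear_combination h1 - x0 - x1
    funext k
    fin_cases k
    · exact x0
    · exact x1
    · exact (mul_eq_zero.1 x2).resolve_left hm

lemma eq_sum_frameVertex (hω : IsPrimitiveRoot ω 3) (c : Option (Fin 3)) (v : Fin 3 → ℂ) :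
    v = ∑ k, (eval v (frameForm ω c k) / frameNorm c) • frameVertex ω c k := by
  rw [← sub_eq_zero]
  apply eq_zero_of_frameForm hω c
  intro l
  rw [sub_eq_add_neg, ← neg_one_smul ℂ (∑ k, _), eval_add_frameForm, eval_smul_frameForm,
    Fin.sum_univ_three, eval_add_frameForm, eval_add_frameForm, eval_smul_frameForm,
    eval_smul_frameForm, eval_smul_frameForm, eval_frameForm_vertex hω, eval_frameForm_vertex hω,
    eval_frameForm_vertex hω]
  have := frameNorm_ne_zero c
  fin_cases l <;> simp <;> field_simp <;> ring

end Frames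

/-! ### The Halphen pencil -/

section Pencil

/-- The product `xyz` of the coordinates. -/
def triangle : S := X 0 * X 1 * X 2

/-- The cubic of the Hesse pencil through the point `(a : 1 : 1)`. -/
def cubic (a : ℂ) : S := C a * (X 0 ^ 3 + X 1 ^ 3 + X 2 ^ 3) - C (a ^ 3 + 2) * triangle

/-- The product of the three conics `x_{k+1} x_{k+2} = a x_k²`. -/
def sextic (a : ℂ) : S :=
  C (1 - a ^ 3) * triangle ^ 2 - C a * triangle * (X 0 ^ 3 + X 1 ^ 3 + X 2 ^ 3) +
    C (a ^ 2) * (X 0 ^ 3 * X 1 ^ 3 + X 1 ^ 3 * X 2 ^ 3 + X 2 ^ 3 * X 0 ^ 3)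

/-- The product of the nine mirrors of the reflection group generated by the permutations of the
coordinates and the diagonal matrices of order three and determinant one, times `a³`. -/
def mirrors (a : ℂ) : S :=
  C (a ^ 3) * ((X 0 ^ 3 - X 1 ^ 3) * (X 1 ^ 3 - X 2 ^ 3) * (X 2 ^ 3 - X 0 ^ 3))

lemma eval_triangle (v : Fin 3 → ℂ) : eval v triangle = v 0 * v 1 * v 2 := by
  simp [triangle]

lemma eval_cubic (a : ℂ) (v : Fin 3 → ℂ) : eval v (cubic a) =
    a * (v 0 ^ 3 + v 1 ^ 3 + v 2 ^ 3) - (a ^ 3 + 2) * (v 0 * v 1 * v 2) := by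
  simp [cubic, triangle]

lemma eval_sextic (a : ℂ) (v : Fin 3 → ℂ) : eval v (sextic a) =
    (1 - a ^ 3) * (v 0 * v 1 * v 2) ^ 2 - a * (v 0 * v 1 * v 2) * (v 0 ^ 3 + v 1 ^ 3 + v 2 ^ 3) +
    a ^ 2 * (v 0 ^ 3 * v 1 ^ 3 + v 1 ^ 3 * v 2 ^ 3 + v 2 ^ 3 * v 0 ^ 3) := by
  simp [sextic, triangle]

variable {a ω : ℂ}

lemma eval_conic_inr (v : Fin 3 → ℂ) (i j : Fin 3) :
    eval v (chileanConic a ω (Sum.inr (i, j))) =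
      v 0 ^ 2 + (ω ^ (i : ℕ)) ^ 2 * v 1 ^ 2 + (ω ^ (j : ℕ)) ^ 2 * v 2 ^ 2 +
      (1 + a * (ω ^ (i : ℕ) * ω ^ (j : ℕ))) * (ω ^ (i : ℕ) * (v 0 * v 1) +
        ω ^ (j : ℕ) * (v 0 * v 2) + ω ^ (i : ℕ) * ω ^ (j : ℕ) * (v 1 * v 2)) := by
  simp only [chileanConic, map_add, map_mul, map_pow, eval_C, eval_X]
  ring

lemma conic_eq_frame (hω : IsPrimitiveRoot ω 3) (h1 : ∀ m : Fin 3, a * ω ^ (m : ℕ) - 1 ≠ 0)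
    (c : Option (Fin 3)) (k : Fin 3) :
    chileanConic a ω (conicIdx c k) = C (frameScale a ω c) *
      (frameForm ω c (k + 1) * frameForm ω c (k + 2) -
        C (frameParam a ω c) * frameForm ω c k ^ 2) := by
  cases c with
  | none => simp [conicIdx, chileanConic, frameScale, frameForm, frameParam]
  | some m =>
    apply MvPolynomial.funext
    intro v
    rw [conicIdx, eval_conic_inr]
    rw [map_mul, map_sub, map_mul, map_mul, map_pow, eval_C, eval_C,
      (eval_frameForm_shift hω v m k).1, (eval_frameForm_shift hω v m k).2, eval_frameForm_some]
    simp only [frameScale, frameParam]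
    have e : ω ^ (m : ℕ) = ω ^ (k : ℕ) * ω ^ ((m - k : Fin 3) : ℕ) := by
      rw [mul_comm, pow_sub_fin_mul hω]
    have h1 := h1 m
    rw [e] at h1 ⊢
    have := omega_mul_omega (one_add_omega hω) (v 0) (ω ^ (k : ℕ) * v 1)
      (ω ^ ((m - k : Fin 3) : ℕ) * v 2)
    simp only [← mul_assoc] at this
    simp only [← mul_assoc] at h1 ⊢
    rw [this]
    clear this e
    generalize ω ^ (k : ℕ) = η at *
    generalize ω ^ ((m - k : Fin 3) : ℕ) = ζ at *
    have hb := div_mul_cancel₀ (a * η * ζ + 2) h1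
    generalize (a * η * ζ + 2) / (a * η * ζ - 1) = b at *
    linear_combination (-(v 0 + η * v 1 + ζ * v 2) ^ 2 / 3) * hb

/-- Up to scalars, the cubic of the arrangement is the same cubic in all four frames. -/
lemma exists_cubic_frame (hω : IsPrimitiveRoot ω 3) (h1 : ∀ m : Fin 3, a * ω ^ (m : ℕ) - 1 ≠ 0)
    (c : Option (Fin 3)) : ∃ u : ℂ, u ≠ 0 ∧ ∀ v : Fin 3 → ℂ,
      eval (fun k => eval v (frameForm ω c k)) (cubic (frameParam a ω c)) =
        u * eval v (cubic a) := by
  cases c with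
  | none => exact ⟨1, one_ne_zero, fun v => by simp [frameForm, frameParam]⟩
  | some m =>
    have h1 := h1 m
    have hm : ω ^ (m : ℕ) ≠ 0 := pow_ne_zero _ (hω.ne_zero (by norm_num))
    refine ⟨-27 * ω ^ (m : ℕ) / (a * ω ^ (m : ℕ) - 1) ^ 3, ?_, fun v => ?_⟩
    · exact div_ne_zero (mul_ne_zero (by norm_num) hm) (pow_ne_zero _ h1)
    rw [eval_cubic, eval_cubic]
    have e1 := (eval_frameForm_shift hω v m 0).1
    have e2 := (eval_frameForm_shift hω v m 0).2
    rw [zero_add] at e1 e2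
    rw [e1, e2, eval_frameForm_some]
    simp only [sub_zero, Fin.val_zero, pow_zero, mul_one, one_mul, frameParam]
    have hc := pow_fin_cube hω m
    set ε := ω ^ (m : ℕ) with hε
    have hp := omega_mul_omega (one_add_omega hω) (v 0) (v 1) (ε * v 2)
    have hs := omega_add_omega (one_add_omega hω) (v 0) (v 1) (ε * v 2)
    simp only [← mul_assoc] at hp hs
    set p := v 0 + ω * v 1 + ω ^ 2 * ε * v 2
    set q := v 0 + ω ^ 2 * v 1 + ω * ε * v 2
    have e3 : p ^ 3 + q ^ 3 = (2 * v 0 - v 1 - ε * v 2) ^ 3 - 3 * (v 0 ^ 2 + v 1 ^ 2 +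
      (ε * v 2) ^ 2 - v 0 * v 1 - v 0 * ε * v 2 - v 1 * ε * v 2) * (2 * v 0 - v 1 - ε * v 2) := by
      rw [← hp, ← hs]; ring
    rw [mul_assoc _ p q, hp, add_assoc _ (p ^ 3), e3]
    field_simp
    linear_combination (-27 * (a * ε * v 2 ^ 3 - a ^ 3 * ε * v 0 * v 1 * v 2)) * hc

lemma prod_conic_none : ∏ k, chileanConic a ω (conicIdx none k) = sextic a := by
  simp only [Fin.prod_univ_three, conicIdx, chileanConic, sextic, triangle]
  simp only [show (0 : Fin 3) + 1 = 1 from rfl, show (0 : Fin 3) + 2 = 2 from rfl,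
    show (1 : Fin 3) + 1 = 2 from rfl, show (1 : Fin 3) + 2 = 0 from rfl,
    show (2 : Fin 3) + 1 = 0 from rfl, show (2 : Fin 3) + 2 = 1 from rfl, map_sub, map_pow, map_one]
  ring

/-- The triple `some m` is a member of the pencil spanned by the square of the cubic and the
sextic. -/
lemma prod_conic_some (hω : IsPrimitiveRoot ω 3) (m : Fin 3) :
    C (a ^ 2) * ∏ k, chileanConic a ω (conicIdx (some m) k) =
      cubic a ^ 2 + C (a ^ 3 - 4 + 3 * (a * ω ^ (m : ℕ)) ^ 2) * sextic a := by
  apply MvPolynomial.funext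
  intro v
  rw [Fin.prod_univ_three]
  simp only [conicIdx, map_mul, map_add, map_pow, eval_C, eval_conic_inr, eval_cubic, eval_sextic]
  have hc := pow_fin_cube hω m
  have e1 : ω ^ ((m - 1 : Fin 3) : ℕ) = ω ^ 2 * ω ^ (m : ℕ) := by
    have : m - 1 = 2 + m := by clear hc; revert m; decide
    rw [this, pow_add_fin hω]; rfl
  have e2 : ω ^ ((m - 2 : Fin 3) : ℕ) = ω * ω ^ (m : ℕ) := by
    have : m - 2 = 1 + m := by clear hc e1; revert m; decide
    rw [this, pow_add_fin hω]; simp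
  rw [e1, e2, sub_zero]
  simp only [Fin.val_zero, Fin.val_one, Fin.val_two, pow_zero, pow_one, one_mul, one_pow]
  have h3 := hω.pow_eq_one
  have hw := one_add_omega hω
  set ε := ω ^ (m : ℕ) with hε
  have hε0 : ε ≠ 0 := pow_ne_zero _ (hω.ne_zero (by norm_num))
  set x := v 0
  set y := v 1
  set z := v 2
  -- in terms of `z' = ε z`, the three conics are `α + ω ^ k β + ω ^ (2 k) γ`
  set α := x ^ 2 + (1 + a * ε) * (y * (ε * z)) with hα
  set β := (ε * z) ^ 2 + (1 + a * ε) * (x * y) with hβ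
  set γ := y ^ 2 + (1 + a * ε) * (x * (ε * z)) with hγ
  have hp := omega_mul_omega hw α β γ
  have q0 : x ^ 2 + y ^ 2 + ε ^ 2 * z ^ 2 + (1 + a * ε) * (x * y + ε * (x * z) + ε * (y * z)) =
      α + β + γ := by rw [hα, hβ, hγ]; ring
  have q1 : x ^ 2 + ω ^ 2 * y ^ 2 + (ω ^ 2 * ε) ^ 2 * z ^ 2 + (1 + a * (ω * (ω ^ 2 * ε))) *
      (ω * (x * y) + ω ^ 2 * ε * (x * z) + ω * (ω ^ 2 * ε) * (y * z)) =
      α + ω * β + ω ^ 2 * γ := by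
    have : ω * (ω ^ 2 * ε) = ε := by linear_combination ε * h3
    rw [this, hα, hβ, hγ]
    linear_combination (ω * ε ^ 2 * z ^ 2) * h3
  have q2 : x ^ 2 + (ω ^ 2) ^ 2 * y ^ 2 + (ω * ε) ^ 2 * z ^ 2 + (1 + a * (ω ^ 2 * (ω * ε))) *
      (ω ^ 2 * (x * y) + ω * ε * (x * z) + ω ^ 2 * (ω * ε) * (y * z)) =
      α + ω ^ 2 * β + ω * γ := by
    have : ω ^ 2 * (ω * ε) = ε := by linear_combination ε * h3
    rw [this, hα, hβ, hγ]
    linear_combination (ω * y ^ 2) * h3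
  rw [q0, q1, q2, mul_assoc (α + β + γ), hp]
  have hC : (a * ε) * (x ^ 3 + y ^ 3 + (ε * z) ^ 3) - ((a * ε) ^ 3 + 2) * (x * y * (ε * z)) =
      ε * (a * (x ^ 3 + y ^ 3 + z ^ 3) - (a ^ 3 + 2) * (x * y * z)) := by
    linear_combination ε * (a * z ^ 3 - a ^ 3 * (x * y * z)) * hc
  have hG : (1 - (a * ε) ^ 3) * (x * y * (ε * z)) ^ 2 -
      a * ε * (x * y * (ε * z)) * (x ^ 3 + y ^ 3 + (ε * z) ^ 3) +
      (a * ε) ^ 2 * (x ^ 3 * y ^ 3 + y ^ 3 * (ε * z) ^ 3 + (ε * z) ^ 3 * x ^ 3) =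
      ε ^ 2 * ((1 - a ^ 3) * (x * y * z) ^ 2 - a * (x * y * z) * (x ^ 3 + y ^ 3 + z ^ 3) +
        a ^ 2 * (x ^ 3 * y ^ 3 + y ^ 3 * z ^ 3 + z ^ 3 * x ^ 3)) := by
    linear_combination ε ^ 2 * (-a ^ 3 * (x * y * z) ^ 2 - a * (x * y * z) * z ^ 3 +
      a ^ 2 * (y ^ 3 * z ^ 3 + z ^ 3 * x ^ 3)) * hc
  have ht : (a * ε) ^ 3 = a ^ 3 := by linear_combination a ^ 3 * hc
  apply mul_left_cancel₀ (pow_ne_zero 2 hε0)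
  set Cv := a * (x ^ 3 + y ^ 3 + z ^ 3) - (a ^ 3 + 2) * (x * y * z)
  set Gv := (1 - a ^ 3) * (x * y * z) ^ 2 - a * (x * y * z) * (x ^ 3 + y ^ 3 + z ^ 3) +
        a ^ 2 * (x ^ 3 * y ^ 3 + y ^ 3 * z ^ 3 + z ^ 3 * x ^ 3)
  have e5 : ε ^ 2 * (Cv ^ 2 + (a ^ 3 - 4 + 3 * (a * ε) ^ 2) * Gv) =
      (ε * Cv) ^ 2 + ((a * ε) ^ 3 - 4 + 3 * (a * ε) ^ 2) * (ε ^ 2 * Gv) := by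
    rw [ht]; ring
  rw [e5, ← hC, ← hG, hα, hβ, hγ]
  ring

/-- The Chilean arrangement as a composition of a binary form with the Halphen pencil. -/
theorem chilean_eq_octic (hω : IsPrimitiveRoot ω 3) :
    C (a ^ 6) * chilean a ω = octic (C (a ^ 3)) (sextic a) (cubic a) := by
  have h : chilean a ω = ∏ c : Option (Fin 3), ∏ k, chileanConic a ω (conicIdx c k) := by
    rw [chilean, ← conicEquiv.prod_comp, Fintype.prod_prod_type]
    rfl
  have hw : (C ω : S) ^ 2 + C ω + 1 = 0 := by
    rw [← C_pow, ← C_add, ← C_1, ← C_add, one_add_omega hω, C_0]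
  rw [h, Fintype.prod_option, prod_conic_none]
  have h2 : (C (a ^ 6) : S) * ∏ m : Fin 3, ∏ k, chileanConic a ω (conicIdx (some m) k) =
      ∏ m : Fin 3, (cubic a ^ 2 + C (a ^ 3 - 4 + 3 * (a * ω ^ (m : ℕ)) ^ 2) * sextic a) := by
    rw [Finset.prod_congr rfl fun m _ => (prod_conic_some hω m).symm, Finset.prod_mul_distrib]
    simp [← pow_mul]
  rw [mul_left_comm, h2, Fin.prod_univ_three]
  simp only [Fin.val_zero, Fin.val_one, Fin.val_two, pow_zero, pow_one, mul_one, octic, map_add,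
    map_sub, map_mul, map_pow, map_ofNat]
  have hp := omega_mul_omega hw (cubic a ^ 2 + (C a ^ 3 - 4) * sextic a) 0
    (3 * C a ^ 2 * sextic a)
  have h3 : (C ω : S) ^ 3 = 1 := by linear_combination (C ω - 1) * hw
  linear_combination (sextic a * (cubic a ^ 2 + (C a ^ 3 - 4 + 3 * C a ^ 2) * sextic a)) * (hp +
    3 * C a ^ 2 * C ω * sextic a * (cubic a ^ 2 + (C a ^ 3 - 4 + 3 * C a ^ 2 * C ω ^ 2) * sextic a)
      * h3)

end Pencil

/-! ### Derivatives of the invariants -/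

section Discriminant

lemma fin_three_shift : (0 : Fin 3) + 1 = 1 ∧ (0 : Fin 3) + 2 = 2 ∧ (1 : Fin 3) + 1 = 2 ∧
    (1 : Fin 3) + 2 = 0 ∧ (2 : Fin 3) + 1 = 0 ∧ (2 : Fin 3) + 2 = 1 := by decide

lemma pderiv_X_eq (i j : Fin 3) : pderiv i (X j : S) = if j = i then 1 else 0 := by
  rw [pderiv_X, Pi.single_apply]

lemma pderiv_triangle (i : Fin 3) : pderiv i triangle = X (i + 1) * X (i + 2) := by
  obtain ⟨h1, h2, h3, h4, h5, h6⟩ := fin_three_shift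
  fin_cases i <;> simp [triangle, Derivation.leibniz, h1, h2, h3, h4, h5, h6]; ring

lemma pderiv_cubic (a : ℂ) (i : Fin 3) :
    pderiv i (cubic a) = 3 * C a * X i ^ 2 - C (a ^ 3 + 2) * (X (i + 1) * X (i + 2)) := by
  rw [cubic, map_sub, Derivation.leibniz, Derivation.leibniz, pderiv_triangle]
  fin_cases i <;> simp [Derivation.leibniz_pow] <;> ring

lemma pderiv_sextic (a : ℂ) (i : Fin 3) :
    pderiv i (sextic a) = 2 * C (1 - a ^ 3) * triangle * (X (i + 1) * X (i + 2)) -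
      C a * (X (i + 1) * X (i + 2)) * (X 0 ^ 3 + X 1 ^ 3 + X 2 ^ 3) -
      3 * C a * triangle * X i ^ 2 + 3 * C (a ^ 2) * X i ^ 2 * (X (i + 1) ^ 3 + X (i + 2) ^ 3) := by
  obtain ⟨h1, h2, h3, h4, h5, h6⟩ := fin_three_shift
  rw [sextic]
  simp only [map_add, map_sub, Derivation.leibniz, Derivation.leibniz_pow, pderiv_triangle,
    pderiv_C, pderiv_X_eq, smul_eq_mul, nsmul_eq_mul]
  fin_cases i <;> simp [h1, h2, h3, h4, h5, h6] <;> ring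

lemma sq_mirrors (a : ℂ) :
    mirrors a ^ 2 = disc (C (a ^ 3)) (cubic a) triangle (sextic a) := by
  -- the discriminant of the cubic polynomial with elementary symmetric functions `s`, `q`, `p³`
  have h1 : ∀ A s p q : S, disc (A ^ 3) (A * s - (A ^ 3 + 2) * p) p
      ((1 - A ^ 3) * p ^ 2 - A * p * s + A ^ 2 * q) = A ^ 6 * (18 * s * q * p ^ 3 -
        4 * s ^ 3 * p ^ 3 + s ^ 2 * q ^ 2 - 4 * q ^ 3 - 27 * p ^ 6) := by
    intro A s p q
    simp only [disc]
    ring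
  have h2 := h1 (C a) (X 0 ^ 3 + X 1 ^ 3 + X 2 ^ 3) triangle
    (X 0 ^ 3 * X 1 ^ 3 + X 1 ^ 3 * X 2 ^ 3 + X 2 ^ 3 * X 0 ^ 3)
  simp only [cubic, sextic, map_add, map_sub, map_pow, map_one, map_ofNat, mirrors]
  rw [h2]
  have h3 : (triangle : S) ^ 3 = X 0 ^ 3 * X 1 ^ 3 * X 2 ^ 3 := by rw [triangle]; ring
  have h6 : (triangle : S) ^ 6 = (X 0 ^ 3 * X 1 ^ 3 * X 2 ^ 3) ^ 2 := by rw [← h3]; ring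
  rw [h3, h6]
  generalize (X 0 : S) ^ 3 = x
  generalize (X 1 : S) ^ 3 = y
  generalize (X 2 : S) ^ 3 = z
  ring

/-- The Jacobian of the basic invariants is the product of the mirrors. -/
lemma jacobian_mirrors (a : ℂ) :
    3 * triangle * (pderiv 1 (cubic a) * pderiv 2 (sextic a) -
        pderiv 2 (cubic a) * pderiv 1 (sextic a)) -
      6 * sextic a * (pderiv 1 (cubic a) * pderiv 2 triangle -
        pderiv 2 (cubic a) * pderiv 1 triangle) +
      3 * cubic a * (pderiv 1 (sextic a) * pderiv 2 triangle -
        pderiv 2 (sextic a) * pderiv 1 triangle) = -9 * X 0 * mirrors a := by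
  obtain ⟨-, -, h3, h4, h5, h6⟩ := fin_three_shift
  simp only [pderiv_triangle, pderiv_cubic, pderiv_sextic, h3, h4, h5, h6]
  simp only [cubic, sextic, triangle, mirrors, map_add, map_sub, map_pow, map_one, map_ofNat]
  generalize (X 0 : S) = x
  generalize (X 1 : S) = y
  generalize (X 2 : S) = z
  generalize (C a : S) = A
  ring

lemma pderiv_disc (A : ℂ) (c p g : S) (i : Fin 3) :
    pderiv i (disc (C A) c p g) = discC (C A) c p g * pderiv i c + discP (C A) c p g * pderiv i p +
      discG (C A) c p g * pderiv i g := by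
  have hn : ∀ n : ℕ, pderiv i ((n : S)) = 0 := fun n => Derivation.map_natCast _ n
  have h2 : pderiv i (2 : S) = 0 := hn 2
  have h4 : pderiv i (4 : S) = 0 := hn 4
  have h5 : pderiv i (5 : S) = 0 := hn 5
  have h8 : pderiv i (8 : S) = 0 := hn 8
  have h20 : pderiv i (20 : S) = 0 := hn 20
  simp only [disc, discC, discP, discG, map_add, map_sub, Derivation.leibniz,
    Derivation.leibniz_pow, pderiv_C, Derivation.map_one_eq_zero, smul_eq_mul, nsmul_eq_mul, h2,
    h4, h5, h8, h20]
  push_cast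
  ring

lemma pderiv_octic (A : ℂ) (g c : S) (i : Fin 3) :
    pderiv i (octic (C A) g c) = octicG (C A) g c * pderiv i g +
      octicC (C A) g c * pderiv i c := by
  have hn : ∀ n : ℕ, pderiv i ((n : S)) = 0 := fun n => Derivation.map_natCast _ n
  have h4 : pderiv i (4 : S) = 0 := hn 4
  have h27 : pderiv i (27 : S) = 0 := hn 27
  simp only [octic, octicC, octicG, map_add, map_sub, Derivation.leibniz,
    Derivation.leibniz_pow, pderiv_C, smul_eq_mul, nsmul_eq_mul, h4, h27]
  push_cast
  ring

lemma two_mul_mirrors (a : ℂ) (i : Fin 3) :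
    2 * mirrors a * pderiv i (mirrors a) =
      discC (C (a ^ 3)) (cubic a) triangle (sextic a) * pderiv i (cubic a) +
      discP (C (a ^ 3)) (cubic a) triangle (sextic a) * pderiv i triangle +
      discG (C (a ^ 3)) (cubic a) triangle (sextic a) * pderiv i (sextic a) := by
  rw [← pderiv_disc, ← sq_mirrors, Derivation.leibniz_pow]
  simp [mul_assoc]

end Discriminant

/-! ### The base points of the pencil -/

section BasePoints

variable {a ω : ℂ}

/-- The points of the Heisenberg orbit of `(a : 1 : 1)`: the coordinate with index `k` is `a`, the
two others are `ω ^ i` and `ω ^ (2 i)`. -/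
def basePoint (a ω : ℂ) (k i : Fin 3) : Fin 3 → ℂ := fun l =>
  if l = k then a else if l = k + 1 then ω ^ (i : ℕ) else (ω ^ (i : ℕ)) ^ 2

lemma basePoint_self (k i : Fin 3) : basePoint a ω k i k = a := by simp [basePoint]

lemma basePoint_add_one (k i : Fin 3) : basePoint a ω k i (k + 1) = ω ^ (i : ℕ) := by
  simp [basePoint]

lemma basePoint_add_two (k i : Fin 3) : basePoint a ω k i (k + 2) = (ω ^ (i : ℕ)) ^ 2 := by
  simp [basePoint]

lemma basePoint_zero (i : Fin 3) :
    basePoint a ω 0 i = ![a, ω ^ (i : ℕ), (ω ^ (i : ℕ)) ^ 2] := by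
  funext l; fin_cases l <;> simp [basePoint]

lemma basePoint_one (i : Fin 3) :
    basePoint a ω 1 i = ![(ω ^ (i : ℕ)) ^ 2, a, ω ^ (i : ℕ)] := by
  funext l; fin_cases l <;> simp [basePoint]

lemma basePoint_two (i : Fin 3) :
    basePoint a ω 2 i = ![ω ^ (i : ℕ), (ω ^ (i : ℕ)) ^ 2, a] := by
  funext l; fin_cases l <;> simp [basePoint, show (2 : Fin 3) + 1 = 0 from rfl]

lemma eval_basePoint (hω : IsPrimitiveRoot ω 3) (k i : Fin 3) (t : ℂ) :
    eval (t • basePoint a ω k i) (cubic a) = 0 ∧ eval (t • basePoint a ω k i) (sextic a) = 0 ∧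
      eval (t • basePoint a ω k i) triangle = t ^ 3 * a := by
  have hε := pow_fin_cube hω i
  rw [eval_cubic, eval_sextic, eval_triangle]
  have e0 := basePoint_zero (a := a) (ω := ω) i
  have e1 := basePoint_one (a := a) (ω := ω) i
  have e2 := basePoint_two (a := a) (ω := ω) i
  generalize ω ^ (i : ℕ) = ε at *
  have h6 : ε ^ 6 = 1 := by linear_combination (ε ^ 3 + 1) * hε
  have ht : ∀ k, (t • basePoint a ω k i) 0 * (t • basePoint a ω k i) 1 *
      (t • basePoint a ω k i) 2 = t ^ 3 * a := by
    intro k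
    fin_cases k
    · simp only [Fin.mk_zero, Fin.isValue, e0, Pi.smul_apply, smul_eq_mul, Matrix.cons_val]
      linear_combination t ^ 3 * a * hε
    · simp only [Fin.mk_one, Fin.isValue, e1, Pi.smul_apply, smul_eq_mul, Matrix.cons_val]
      linear_combination t ^ 3 * a * hε
    · simp only [Fin.reduceFinMk, Fin.isValue, e2, Pi.smul_apply, smul_eq_mul, Matrix.cons_val]
      linear_combination t ^ 3 * a * hε
  refine ⟨?_, ?_, ht k⟩
  · rw [ht k]
    fin_cases k
    · simp only [Fin.mk_zero, Fin.isValue, e0, Pi.smul_apply, smul_eq_mul, Matrix.cons_val]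
      linear_combination t ^ 3 * a * (hε + h6)
    · simp only [Fin.mk_one, Fin.isValue, e1, Pi.smul_apply, smul_eq_mul, Matrix.cons_val]
      linear_combination t ^ 3 * a * (hε + h6)
    · simp only [Fin.reduceFinMk, Fin.isValue, e2, Pi.smul_apply, smul_eq_mul, Matrix.cons_val]
      linear_combination t ^ 3 * a * (hε + h6)
  · rw [ht k]
    have h9 : ε ^ 9 = 1 := by linear_combination (ε ^ 6 + ε ^ 3 + 1) * hε
    fin_cases k
    · simp only [Fin.mk_zero, Fin.isValue, e0, Pi.smul_apply, smul_eq_mul, Matrix.cons_val]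
      linear_combination t ^ 6 * a ^ 2 * (-hε - h6 + h9 + a ^ 3 * (hε + h6))
    · simp only [Fin.mk_one, Fin.isValue, e1, Pi.smul_apply, smul_eq_mul, Matrix.cons_val]
      linear_combination t ^ 6 * a ^ 2 * (-hε - h6 + h9 + a ^ 3 * (hε + h6))
    · simp only [Fin.reduceFinMk, Fin.isValue, e2, Pi.smul_apply, smul_eq_mul, Matrix.cons_val]
      linear_combination t ^ 6 * a ^ 2 * (-hε - h6 + h9 + a ^ 3 * (hε + h6))

lemma eval_mirrors_basePoint (hω : IsPrimitiveRoot ω 3) (k i : Fin 3) (t : ℂ) :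
    eval (t • basePoint a ω k i) (mirrors a) = 0 := by
  have h := congrArg (eval (t • basePoint a ω k i)) (sq_mirrors a)
  have h1 := eval_basePoint (a := a) hω k i t
  rw [map_pow, map_disc, h1.1, h1.2.1] at h
  simpa [disc] using h

lemma eval_pderiv_cubic (v : Fin 3 → ℂ) (i : Fin 3) :
    eval v (pderiv i (cubic a)) = 3 * a * v i ^ 2 - (a ^ 3 + 2) * (v (i + 1) * v (i + 2)) := by
  rw [pderiv_cubic]; simp

lemma eval_pderiv_mirrors (v : Fin 3 → ℂ) :
    eval v (pderiv 1 (mirrors a)) = 3 * a ^ 3 * v 1 ^ 2 * ((v 2 ^ 3 - v 0 ^ 3) *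
      ((v 0 ^ 3 - v 1 ^ 3) - (v 1 ^ 3 - v 2 ^ 3))) ∧
    eval v (pderiv 2 (mirrors a)) = 3 * a ^ 3 * v 2 ^ 2 * ((v 0 ^ 3 - v 1 ^ 3) *
      ((v 1 ^ 3 - v 2 ^ 3) - (v 2 ^ 3 - v 0 ^ 3))) := by
  constructor <;>
  · rw [mirrors]
    simp [Derivation.leibniz, Derivation.leibniz_pow]
    ring

/-- The cubic and the mirror through a base point meet transversally, and the tangent line of the
cubic is not vertical in the chart `x = 1`. -/
lemma transversal_basePoint (hω : IsPrimitiveRoot ω 3) (ha0 : a ≠ 0) (ha1 : a ^ 3 ≠ 1)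
    (k i : Fin 3) {t : ℂ} (ht : t ≠ 0) :
    eval (t • basePoint a ω k i) (pderiv 1 (cubic a)) ≠ 0 ∧
    eval (t • basePoint a ω k i) (pderiv 1 (mirrors a) * pderiv 2 (cubic a) -
      pderiv 2 (mirrors a) * pderiv 1 (cubic a)) ≠ 0 := by
  obtain ⟨-, -, h3, h4, h5, h6⟩ := fin_three_shift
  have hε := pow_fin_cube hω i
  have hε0 : ω ^ (i : ℕ) ≠ 0 := pow_ne_zero _ (hω.ne_zero (by norm_num))
  have e0 := basePoint_zero (a := a) (ω := ω) i
  have e1 := basePoint_one (a := a) (ω := ω) i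
  have e2 := basePoint_two (a := a) (ω := ω) i
  have hA : a ^ 3 - 1 ≠ 0 := sub_ne_zero.2 ha1
  rw [map_sub, map_mul, map_mul, (eval_pderiv_mirrors _).1, (eval_pderiv_mirrors _).2,
    eval_pderiv_cubic, eval_pderiv_cubic, h3, h4, h5, h6]
  generalize ω ^ (i : ℕ) = ε at *
  have hε6 : ε ^ 6 = 1 := by linear_combination (ε ^ 3 + 1) * hε
  set v := t • basePoint a ω k i with hv
  have hcase : (v 0 = t * a ∧ v 1 = t * ε ∧ v 2 = t * ε ^ 2) ∨
      (v 0 = t * ε ^ 2 ∧ v 1 = t * a ∧ v 2 = t * ε) ∨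
      (v 0 = t * ε ∧ v 1 = t * ε ^ 2 ∧ v 2 = t * a) := by
    rw [hv]
    fin_cases k
    · left; simp [e0]
    · right; left; simp [e1]
    · right; right; simp [e2]
  clear_value v
  clear hv e0 e1 e2
  rcases hcase with ⟨x0, x1, x2⟩ | ⟨x0, x1, x2⟩ | ⟨x0, x1, x2⟩
  · rw [x0, x1, x2]
    constructor
    · rw [show 3 * a * (t * ε) ^ 2 - (a ^ 3 + 2) * (t * ε ^ 2 * (t * a)) =
        -(a * t ^ 2 * ε ^ 2 * (a ^ 3 - 1)) by ring]
      simp [ha0, ht, hε0, hA]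
    · have : (t * ε ^ 2) ^ 3 = t ^ 3 := by linear_combination t ^ 3 * hε6
      rw [this]
      have : (t * ε) ^ 3 = t ^ 3 := by linear_combination t ^ 3 * hε
      rw [this]
      have key : 3 * a ^ 3 * (t * ε) ^ 2 * ((t ^ 3 - (t * a) ^ 3) * ((t * a) ^ 3 - t ^ 3 -
          (t ^ 3 - t ^ 3))) * (3 * a * (t * ε ^ 2) ^ 2 - (a ^ 3 + 2) * (t * a * (t * ε))) -
          3 * a ^ 3 * (t * ε ^ 2) ^ 2 * (((t * a) ^ 3 - t ^ 3) * (t ^ 3 - t ^ 3 -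
          (t ^ 3 - (t * a) ^ 3))) * (3 * a * (t * ε) ^ 2 - (a ^ 3 + 2) * (t * ε ^ 2 * (t * a))) =
          6 * a ^ 4 * t ^ 10 * (a ^ 3 - 1) ^ 3 := by
        linear_combination (-18 * a ^ 4 * t ^ 10 * (a ^ 3 - 1) ^ 2 * hε6 +
          3 * a ^ 4 * (a ^ 3 + 2) * t ^ 10 * (a ^ 3 - 1) ^ 2 * (hε + hε6))
      rw [key]
      simp [ha0, ht, hA]
  · rw [x0, x1, x2]
    have hc : 3 * a * (t * a) ^ 2 - (a ^ 3 + 2) * (t * ε * (t * ε ^ 2)) =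
        2 * t ^ 2 * (a ^ 3 - 1) := by
      linear_combination -(a ^ 3 + 2) * t ^ 2 * hε
    have hc0 : 2 * t ^ 2 * (a ^ 3 - 1) ≠ 0 := by simp [ht, hA]
    rw [hc]
    refine ⟨hc0, ?_⟩
    have : (t * ε ^ 2) ^ 3 = t ^ 3 := by linear_combination t ^ 3 * hε6
    rw [this]
    have : (t * ε) ^ 3 = t ^ 3 := by linear_combination t ^ 3 * hε
    rw [this]
    rw [sub_self, zero_mul, mul_zero, zero_mul, zero_sub, neg_ne_zero]
    refine mul_ne_zero ?_ hc0
    rw [show 3 * a ^ 3 * (t * ε) ^ 2 * ((t ^ 3 - (t * a) ^ 3) * ((t * a) ^ 3 - t ^ 3 - 0)) =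
      -(3 * a ^ 3 * t ^ 8 * ε ^ 2 * (a ^ 3 - 1) ^ 2) by ring]
    simp [ha0, ht, hε0, hA]
  · rw [x0, x1, x2]
    have hc : 3 * a * (t * a) ^ 2 - (a ^ 3 + 2) * (t * ε * (t * ε ^ 2)) =
        2 * t ^ 2 * (a ^ 3 - 1) := by
      linear_combination -(a ^ 3 + 2) * t ^ 2 * hε
    have hc0 : 2 * t ^ 2 * (a ^ 3 - 1) ≠ 0 := by simp [ht, hA]
    rw [hc]
    constructor
    · rw [show 3 * a * (t * ε ^ 2) ^ 2 - (a ^ 3 + 2) * (t * a * (t * ε)) =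
        -(a * t ^ 2 * ε * (a ^ 3 - 1)) by linear_combination 3 * a * t ^ 2 * ε * hε]
      simp [ha0, ht, hε0, hA]
    · have : (t * ε ^ 2) ^ 3 = t ^ 3 := by linear_combination t ^ 3 * hε6
      rw [this]
      have : (t * ε) ^ 3 = t ^ 3 := by linear_combination t ^ 3 * hε
      rw [this]
      rw [sub_self, zero_mul, mul_zero, zero_mul, sub_zero]
      refine mul_ne_zero ?_ hc0
      rw [show 3 * a ^ 3 * (t * ε ^ 2) ^ 2 * (((t * a) ^ 3 - t ^ 3) * (0 - (t ^ 3 - (t * a) ^ 3))) =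
        3 * a ^ 3 * t ^ 8 * ε ^ 4 * (a ^ 3 - 1) ^ 2 by ring]
      simp [ha0, ht, hε0, hA]

/-- The germs of the basic invariants at a base point satisfy the hypotheses of the local
computation. -/
lemma isBaseGerm_germAt (hω : IsPrimitiveRoot ω 3) (ha0 : a ≠ 0) (ha1 : a ^ 3 ≠ 1)
    (ha8 : a ^ 3 ≠ -8) {p : Plane} {k i : Fin 3} {t : ℂ} (ht : t ≠ 0)
    (hp : normalized p = t • basePoint a ω k i) (hc : chartIndex p.rep = 0)
    (hn : normalized p 0 = 1) :
    IsBaseGerm (algebraMap ℂ LocalRing (a ^ 3)) (-9) (germAt p (cubic a)) (germAt p (sextic a))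
      (germAt p triangle) (germAt p (mirrors a))
      (germAt p (pderiv 1 (cubic a))) (germAt p (pderiv 2 (cubic a)))
      (germAt p (pderiv 1 (sextic a))) (germAt p (pderiv 2 (sextic a)))
      (germAt p (pderiv 1 triangle)) (germAt p (pderiv 2 triangle))
      (germAt p (pderiv 1 (mirrors a))) (germAt p (pderiv 2 (mirrors a))) := by
  have hu : ∀ x : ℂ, x ≠ 0 → IsUnit (algebraMap ℂ LocalRing x) := fun x hx =>
    (IsUnit.mk0 x hx).map _
  have h1 := eval_basePoint (a := a) hω k i t
  have hm := eval_mirrors_basePoint (a := a) hω k i t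
  have htr := transversal_basePoint hω ha0 ha1 k i ht
  rw [← hp] at h1 hm htr
  have hC : germAt p (C (a ^ 3)) = algebraMap ℂ LocalRing (a ^ 3) := (germAt p).commutes _
  have hX : germAt p (X 0) = 1 := by
    have : dehom (chartIndex p.rep) (normalized p) (X 0) = 1 := by
      rw [hc, dehom_X_self, hn, C_1]
    rw [germAt, AlgHom.comp_apply, this, map_one]
  have hd : ∀ c p' g : S, germAt p (disc (C (a ^ 3)) c p' g) =
      disc (algebraMap ℂ LocalRing (a ^ 3)) (germAt p c) (germAt p p') (germAt p g) := by
    intro c p' g; rw [← hC]; exact map_disc (germAt p) _ _ _ _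
  have hj : ∀ l : Fin 3, 2 * germAt p (mirrors a) * germAt p (pderiv l (mirrors a)) =
      discC (algebraMap ℂ LocalRing (a ^ 3)) (germAt p (cubic a)) (germAt p triangle)
        (germAt p (sextic a)) * germAt p (pderiv l (cubic a)) +
      discP (algebraMap ℂ LocalRing (a ^ 3)) (germAt p (cubic a)) (germAt p triangle)
        (germAt p (sextic a)) * germAt p (pderiv l triangle) +
      discG (algebraMap ℂ LocalRing (a ^ 3)) (germAt p (cubic a)) (germAt p triangle)
        (germAt p (sextic a)) * germAt p (pderiv l (sextic a)) := by
    intro l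
    rw [← hC]
    exact map_relation (germAt p) (two_mul_mirrors a l)
  constructor
  · have := hu 2 two_ne_zero
    rwa [map_ofNat] at this
  · have := hu 3 three_ne_zero
    rwa [map_ofNat] at this
  · exact hu _ (pow_ne_zero _ ha0)
  · have := hu (a ^ 3 - 1) (sub_ne_zero.2 ha1)
    rwa [map_sub, map_one] at this
  · have := hu (a ^ 3 + 8) (fun h => ha8 (by linear_combination h))
    rwa [map_add, map_ofNat] at this
  · have := hu (-9) (by norm_num)
    rwa [map_neg, map_ofNat] at this
  · rw [isUnit_germAt, h1.2.2]
    exact mul_ne_zero (pow_ne_zero _ ht) ha0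
  · exact isUnit_germAt.2 htr.1
  · rw [span_germAt_eq_maximalIdeal hm h1.1]
    · exact hasColength_maximalIdeal
    · rw [hc]
      exact htr.2
  · exact germAt_mem.2 hm
  · exact germAt_mem.2 h1.1
  · exact germAt_mem.2 h1.2.1
  · rw [← map_pow, sq_mirrors, hd]
  · exact hj 1
  · exact hj 2
  · have e := congrArg (germAt p) (jacobian_mirrors a)
    simp only [map_sub, map_add, map_mul, map_ofNat, map_neg, hX, mul_one] at e
    exact e

lemma colength_germAt_base (hω : IsPrimitiveRoot ω 3) (ha0 : a ≠ 0) (ha1 : a ^ 3 ≠ 1)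
    (ha8 : a ^ 3 ≠ -8) {p : Plane} {k i : Fin 3} {t : ℂ} (ht : t ≠ 0)
    (hp : normalized p = t • basePoint a ω k i) (hc : chartIndex p.rep = 0)
    (hn : normalized p 0 = 1) :
    milnorNumber (chilean a ω) p = 49 ∧ tjurinaNumber (chilean a ω) p = 45 := by
  have h := isBaseGerm_germAt hω ha0 ha1 ha8 ht hp hc hn
  have hC : germAt p (C (a ^ 3)) = algebraMap ℂ LocalRing (a ^ 3) := (germAt p).commutes _
  have hu : IsUnit (germAt p (C (a ^ 6))) := by
    rw [isUnit_germAt, eval_C]; exact pow_ne_zero _ ha0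
  have h0 : germAt p (C (a ^ 6)) * germAt p (chilean a ω) =
      octic (algebraMap ℂ LocalRing (a ^ 3)) (germAt p (sextic a)) (germAt p (cubic a)) := by
    rw [← map_mul, chilean_eq_octic hω, ← hC]
    exact map_octic (germAt p) _ _ _
  have hd : ∀ l : Fin 3, germAt p (C (a ^ 6)) * germAt p (pderiv l (chilean a ω)) =
      octicG (algebraMap ℂ LocalRing (a ^ 3)) (germAt p (sextic a)) (germAt p (cubic a)) *
        germAt p (pderiv l (sextic a)) +
      octicC (algebraMap ℂ LocalRing (a ^ 3)) (germAt p (sextic a)) (germAt p (cubic a)) *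
        germAt p (pderiv l (cubic a)) := by
    intro l
    rw [← map_mul, ← pderiv_C_mul, chilean_eq_octic hω, pderiv_octic, ← hC, map_add, map_mul,
      map_mul]
    congr 2
    · exact map_octicG (germAt p) _ _ _
    · exact map_octicC (germAt p) _ _ _
  have hspan : ∀ x y : LocalRing, Ideal.span {germAt p (C (a ^ 6)) * x, germAt p (C (a ^ 6)) * y} =
      Ideal.span {x, y} := by
    intro x y
    rw [Ideal.span_insert, Ideal.span_insert, Ideal.span_singleton_mul_left_unit hu,
      Ideal.span_singleton_mul_left_unit hu]
  rw [milnorNumber_eq, tjurinaNumber_eq, hc]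
  have e1 : Fin.succAbove (0 : Fin 3) 0 = 1 := rfl
  have e2 : Fin.succAbove (0 : Fin 3) 1 = 2 := rfl
  rw [e1, e2]
  constructor
  · rw [← hspan]
    exact h.colength_milnor (hd 1) (hd 2)
  · have := h.colength_tjurina h0 (hd 1) (hd 2)
    rwa [Ideal.span_insert, hspan, Ideal.span_singleton_mul_left_unit hu,
      ← Ideal.span_insert] at this

end BasePoints

/-! ### Saito's criterion -/

section Saito

lemma derivation_apply (θ : Derivation ℂ S S) (F : S) :
    θ F = θ (X 0) * pderiv 0 F + θ (X 1) * pderiv 1 F + θ (X 2) * pderiv 2 F := by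
  have h : θ = θ (X 0) • pderiv 0 + θ (X 1) • pderiv 1 + θ (X 2) • pderiv 2 := by
    apply MvPolynomial.derivation_ext
    intro i
    fin_cases i <;> simp
  conv_lhs => rw [h]
  simp

/-- Two vectors are proportional by a polynomial factor if their cross product vanishes and the
entries of the second one have no common factor. -/
lemma exists_eq_mul_of_cross_eq_zero {R : Type*} [CommRing R] [IsDomain R]
    [UniqueFactorizationMonoid R] {t f : Fin 3 → R}
    (hf : ∀ d, (∀ i, d ∣ f i) → IsUnit d) (h01 : t 0 * f 1 = t 1 * f 0)
    (h02 : t 0 * f 2 = t 2 * f 0) (h12 : t 1 * f 2 = t 2 * f 1) : ∃ k, ∀ i, t i = k * f i := by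
  have h : ∀ i j, t i * f j = t j * f i := by
    intro i j
    fin_cases i <;> fin_cases j <;>
      first
        | exact h01
        | exact h02
        | exact h12
        | exact h01.symm
        | exact h02.symm
        | exact h12.symm
        | rfl
  let := UniqueFactorizationMonoid.toGCDMonoid R
  obtain ⟨i0, hi0⟩ : ∃ i, f i ≠ 0 := by
    by_contra! h0
    exact not_isUnit_zero (hf 0 (fun i => by rw [h0 i]))
  have hu : IsUnit (gcd (f 0) (gcd (f 1) (f 2))) := by
    apply hf
    intro i
    fin_cases i
    · exact gcd_dvd_left _ _
    · exact (gcd_dvd_right _ _).trans (gcd_dvd_left _ _)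
    · exact (gcd_dvd_right _ _).trans (gcd_dvd_right _ _)
  have hd : ∀ j, f i0 ∣ t i0 * f j := fun j => ⟨t j, by rw [h i0 j]; ring⟩
  have h1 : f i0 ∣ t i0 * gcd (f 0) (gcd (f 1) (f 2)) := by
    have e1 : f i0 ∣ t i0 * gcd (f 1) (f 2) :=
      (dvd_gcd (hd 1) (hd 2)).trans (gcd_mul_left' _ _ _).dvd
    exact (dvd_gcd (hd 0) e1).trans (gcd_mul_left' _ _ _).dvd
  obtain ⟨k, hk⟩ := hu.dvd_mul_right.1 h1
  refine ⟨k, fun j => mul_right_cancel₀ hi0 ?_⟩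
  rw [← h i0 j, hk]
  ring

/-- Saito's criterion, for the module of syzygies of three elements without a common factor: two
syzygies whose cross product is a unit multiple of `f` form a basis. -/
theorem exists_basis_syzygies {R M : Type*} [CommRing R] [IsDomain R]
    [UniqueFactorizationMonoid R] [AddCommGroup M] [Module R M] (N : Submodule R M)
    (ev : M →ₗ[R] (Fin 3 → R)) (hev : Function.Injective ev) {f : Fin 3 → R} {κ : R}
    (hκ : IsUnit κ) (hf : ∀ d, (∀ i, d ∣ f i) → IsUnit d)
    (hN : ∀ θ, θ ∈ N ↔ ev θ 0 * f 0 + ev θ 1 * f 1 + ev θ 2 * f 2 = 0) (θ₀ θ₁ : M)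
    (h0 : ev θ₀ 1 * ev θ₁ 2 - ev θ₀ 2 * ev θ₁ 1 = κ * f 0)
    (h1 : ev θ₀ 2 * ev θ₁ 0 - ev θ₀ 0 * ev θ₁ 2 = κ * f 1)
    (h2 : ev θ₀ 0 * ev θ₁ 1 - ev θ₀ 1 * ev θ₁ 0 = κ * f 2) :
    ∃ b : Module.Basis (Fin 2) R N, (b 0 : M) = θ₀ ∧ (b 1 : M) = θ₁ := by
  have mu : θ₀ ∈ N := by
    rw [hN]
    apply hκ.mul_left_cancel
    linear_combination -ev θ₀ 0 * h0 - ev θ₀ 1 * h1 - ev θ₀ 2 * h2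
  have mw : θ₁ ∈ N := by
    rw [hN]
    apply hκ.mul_left_cancel
    linear_combination -ev θ₁ 0 * h0 - ev θ₁ 1 * h1 - ev θ₁ 2 * h2
  let v : Fin 2 → N := ![⟨θ₀, mu⟩, ⟨θ₁, mw⟩]
  have hv : ∀ (g : Fin 2 → R), ((∑ i, g i • v i : N) : M) = g 0 • θ₀ + g 1 • θ₁ := by
    intro g
    simp [v, Fin.sum_univ_two]
  have hve : ∀ (g : Fin 2 → R) (j : Fin 3),
      ev ((∑ i, g i • v i : N) : M) j = g 0 * ev θ₀ j + g 1 * ev θ₁ j := by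
    intro g j
    rw [hv]
    simp
  generalize hu : ev θ₀ = u at *
  generalize hw : ev θ₁ = w at *
  have hwg : ∀ d, (∀ i, d ∣ w i) → IsUnit d := by
    intro d hd
    apply hf
    intro i
    rw [← hκ.dvd_mul_left]
    fin_cases i
    · change d ∣ κ * f 0
      rw [← h0]
      exact dvd_sub ((hd 2).mul_left _) ((hd 1).mul_left _)
    · change d ∣ κ * f 1
      rw [← h1]
      exact dvd_sub ((hd 0).mul_left _) ((hd 2).mul_left _)
    · change d ∣ κ * f 2
      rw [← h2]
      exact dvd_sub ((hd 1).mul_left _) ((hd 0).mul_left _)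
  have hli : LinearIndependent R v := by
    refine Fintype.linearIndependent_iff.2 fun g hg => ?_
    have e : ∀ j, g 0 * u j + g 1 * w j = 0 := fun j => by
      rw [← hve, hg, Submodule.coe_zero, map_zero, Pi.zero_apply]
    have a0 : ∀ i, g 0 * (κ * f i) = 0 := by
      intro i
      fin_cases i
      · change g 0 * (κ * f 0) = 0
        rw [← h0]; linear_combination w 2 * e 1 - w 1 * e 2
      · change g 0 * (κ * f 1) = 0
        rw [← h1]; linear_combination w 0 * e 2 - w 2 * e 0
      · change g 0 * (κ * f 2) = 0
        rw [← h2]; linear_combination w 1 * e 0 - w 0 * e 1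
    have g0 : g 0 = 0 := by
      by_contra hne
      refine not_isUnit_zero (hf 0 fun i => ?_)
      have := ((mul_eq_zero.1 (a0 i)).resolve_left hne)
      rw [(mul_eq_zero.1 this).resolve_left hκ.ne_zero]
    have g1 : g 1 = 0 := by
      by_contra hne
      refine not_isUnit_zero (hwg 0 fun i => ?_)
      have := e i
      rw [g0, zero_mul, zero_add] at this
      rw [(mul_eq_zero.1 this).resolve_left hne]
    intro i
    fin_cases i
    · exact g0
    · exact g1
  have hsp : ⊤ ≤ Submodule.span R (Set.range v) := by
    rintro ⟨θ, hθ⟩ -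
    have e' := (hN θ).1 hθ
    set t : Fin 3 → R := ev θ with ht
    have ew : w 0 * f 0 + w 1 * f 1 + w 2 * f 2 = 0 := by
      have := (hN θ₁).1 mw
      rwa [hw] at this
    have e01 : (t 1 * w 2 - t 2 * w 1) * f 1 = (t 2 * w 0 - t 0 * w 2) * f 0 := by
      linear_combination w 2 * e' - t 2 * ew
    have e02 : (t 1 * w 2 - t 2 * w 1) * f 2 = (t 0 * w 1 - t 1 * w 0) * f 0 := by
      linear_combination -w 1 * e' + t 1 * ew
    have e12 : (t 2 * w 0 - t 0 * w 2) * f 2 = (t 0 * w 1 - t 1 * w 0) * f 1 := by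
      linear_combination w 0 * e' - t 0 * ew
    -- `t × w` and `u × w` are both multiples of `f`
    obtain ⟨k, hk⟩ := exists_eq_mul_of_cross_eq_zero
      (t := ![t 1 * w 2 - t 2 * w 1, t 2 * w 0 - t 0 * w 2, t 0 * w 1 - t 1 * w 0])
      (f := f) hf e01 e02 e12
    obtain ⟨κ', hκ'⟩ : ∃ κ', κ' * κ = 1 := hκ.exists_left_inv
    have k0 : t 1 * w 2 - t 2 * w 1 = k * f 0 := hk 0
    have k1 : t 2 * w 0 - t 0 * w 2 = k * f 1 := hk 1
    have k2 : t 0 * w 1 - t 1 * w 0 = k * f 2 := hk 2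
    have f12 : (t 1 - k * κ' * u 1) * w 2 = (t 2 - k * κ' * u 2) * w 1 := by
      linear_combination k0 - k * κ' * h0 + k * f 0 * (-hκ')
    have f02 : (t 0 - k * κ' * u 0) * w 2 = (t 2 - k * κ' * u 2) * w 0 := by
      linear_combination -k1 + k * κ' * h1 + k * f 1 * hκ'
    have f01 : (t 0 - k * κ' * u 0) * w 1 = (t 1 - k * κ' * u 1) * w 0 := by
      linear_combination k2 - k * κ' * h2 + k * f 2 * (-hκ')
    obtain ⟨l, hl⟩ := exists_eq_mul_of_cross_eq_zero (t := fun i => t i - k * κ' * u i) (f := w)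
      hwg f01 f02 f12
    have hmem : (⟨θ, hθ⟩ : N) = ∑ i, ![k * κ', l] i • v i := by
      apply Subtype.ext
      apply hev
      funext j
      rw [hve]
      have := hl j
      simp only [Matrix.cons_val_zero, Matrix.cons_val_one] at this ⊢
      linear_combination this
    rw [hmem]
    exact Submodule.sum_mem _ fun i _ => Submodule.smul_mem _ _ (Submodule.subset_span ⟨i, rfl⟩)
  refine ⟨Module.Basis.mk hli hsp, ?_, ?_⟩
  · rw [Module.Basis.mk_apply]; rfl
  · rw [Module.Basis.mk_apply]; rfl

/-- Saito's criterion for the syzygies of the Jacobian ideal of a reduced polynomial. -/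
theorem exists_basis_logDerZero {F : S} {u w : Fin 3 → S} {κ : ℂ} (hκ : κ ≠ 0)
    (hF : ∀ d, (∀ i, d ∣ pderiv i F) → IsUnit d)
    (h0 : u 1 * w 2 - u 2 * w 1 = C κ * pderiv 0 F)
    (h1 : u 2 * w 0 - u 0 * w 2 = C κ * pderiv 1 F)
    (h2 : u 0 * w 1 - u 1 * w 0 = C κ * pderiv 2 F) :
    ∃ b : Module.Basis (Fin 2) S (logDerZero F),
      (∀ j, (b 0 : Derivation ℂ S S) (X j) = u j) ∧
      ∀ j, (b 1 : Derivation ℂ S S) (X j) = w j := by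
  have hCu : IsUnit (C κ : S) := (IsUnit.mk0 κ hκ).map C
  let ev : Derivation ℂ S S →ₗ[S] (Fin 3 → S) :=
    { toFun := fun θ j => θ (X j)
      map_add' := fun θ η => rfl
      map_smul' := fun c θ => rfl }
  have hu : ev (mkDerivation ℂ u) = u := funext fun j => mkDerivation_X _ _ _
  have hw : ev (mkDerivation ℂ w) = w := funext fun j => mkDerivation_X _ _ _
  obtain ⟨b, hb0, hb1⟩ := exists_basis_syzygies (logDerZero F) ev
    (fun θ η h => MvPolynomial.derivation_ext fun j => congrFun h j) hCu hF
    (fun θ => (show θ F = 0 ↔ _ by rw [derivation_apply θ F]; rfl))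
    (mkDerivation ℂ u) (mkDerivation ℂ w)
    (by rw [hu, hw, h0]) (by rw [hu, hw, h1]) (by rw [hu, hw, h2])
  refine ⟨b, fun j => ?_, fun j => ?_⟩
  · rw [hb0]; exact congrFun hu j
  · rw [hb1]; exact congrFun hw j

/-- The module of logarithmic derivations of a homogeneous polynomial is the direct sum of the
syzygy module and the multiples of the Euler derivation. -/
theorem free_logDer {F : S} {n : ℕ} (hn : n ≠ 0) (hF : F.IsHomogeneous n) (hF0 : F ≠ 0)
    [Module.Free S (logDerZero F)] : IsFree F := by
  let E : Derivation ℂ S S := mkDerivation ℂ X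
  have hE : E F = (n : S) * F := by
    have h := hF.sum_X_mul_pderiv
    rw [Fin.sum_univ_three] at h
    rw [derivation_apply]
    simp only [E, mkDerivation_X]
    rw [h, nsmul_eq_mul]
  have hn' : (n : S) ≠ 0 := by exact_mod_cast hn
  have mE : E ∈ logDer F := by
    change E F ∈ Ideal.span {F}
    rw [hE]
    exact Ideal.mul_mem_left _ _ (Ideal.mem_span_singleton_self F)
  have hle : logDerZero F ≤ logDer F := by
    intro θ hθ
    have h : θ F = 0 := hθ
    change θ F ∈ Ideal.span {F}
    rw [h]
    exact zero_mem _
  let f : (S × logDerZero F) →ₗ[S] logDer F :=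
    LinearMap.coprod (LinearMap.toSpanSingleton S _ ⟨E, mE⟩) (Submodule.inclusion hle)
  have hf : ∀ x : S × logDerZero F, ((f x : logDer F) : Derivation ℂ S S) = x.1 • E + x.2 := by
    intro x
    simp [f]
  have hbij : Function.Bijective f := by
    constructor
    · intro x y hxy
      have h1 : x.1 • E + (x.2 : Derivation ℂ S S) = y.1 • E + y.2 := by rw [← hf, ← hf, hxy]
      have hx : (x.2 : Derivation ℂ S S) F = 0 := x.2.2
      have hy : (y.2 : Derivation ℂ S S) F = 0 := y.2.2
      have h3 := congrArg (fun D : Derivation ℂ S S => D F) h1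
      simp only [Derivation.add_apply, Derivation.smul_apply, hE, hx, hy, add_zero,
        smul_eq_mul] at h3
      have h4 : x.1 = y.1 := mul_right_cancel₀ (mul_ne_zero hn' hF0) h3
      rw [h4] at h1
      exact Prod.ext h4 (Subtype.ext (add_left_cancel h1))
    · rintro ⟨θ, hθ⟩
      obtain ⟨c, hc⟩ := Ideal.mem_span_singleton'.1 (show θ F ∈ Ideal.span {F} from hθ)
      obtain ⟨k, hk⟩ : ∃ k : S, k * (n : S) = 1 := ⟨C (n : ℂ)⁻¹, by
        rw [← map_natCast (C : ℂ →+* S), ← C_mul, inv_mul_cancel₀ (by exact_mod_cast hn), C_1]⟩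
      refine ⟨⟨c * k, θ - (c * k) • E, ?_⟩, ?_⟩
      · change (θ - (c * k) • E) F = 0
        rw [Derivation.sub_apply, Derivation.smul_apply, hE, ← hc, smul_eq_mul]
        linear_combination -c * F * hk
      · apply Subtype.ext
        rw [hf]
        simp
  exact Module.Free.of_equiv (LinearEquiv.ofBijective f hbij)

end Saito

/-! ### The two syzygies -/

section Syzygies

variable {a ω : ℂ}

/-- The syzygy of degree `7`: the Hamiltonian derivation `∇G × ∇C`, which kills both generators of
the pencil. -/
def syzygySeven (a : ℂ) (i : Fin 3) : S :=
  pderiv (i + 1) (sextic a) * pderiv (i + 2) (cubic a) -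
    pderiv (i + 2) (sextic a) * pderiv (i + 1) (cubic a)

/-- The coefficient of the Euler derivation in the syzygy of degree `16`. -/
def coeffEuler (a : ℂ) : S :=
  C (-2 * (a ^ 3 - 1) ^ 2 * (a ^ 3 + 8)) * (cubic a ^ 2 * triangle ^ 3) +
  C (a ^ 3 * (a ^ 3 - 1) * (a ^ 3 + 11)) * (cubic a ^ 3 * triangle ^ 2) +
  C ((a ^ 3) ^ 2 + 19 * a ^ 3 + 28) * (cubic a ^ 4 * triangle) +
  C 11 * cubic a ^ 5 +
  C (-8 * (a ^ 3 - 1) ^ 3 * (a ^ 3 + 8)) * (triangle ^ 3 * sextic a) +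
  C (3 * a ^ 3 * (a ^ 3 - 1) * ((a ^ 3) ^ 2 + 9 * a ^ 3 - 28)) *
    (cubic a * triangle ^ 2 * sextic a) +
  C (4 * (a ^ 3) ^ 3 + 62 * (a ^ 3) ^ 2 + 38 * a ^ 3 - 176) *
    (cubic a ^ 2 * triangle * sextic a) +
  C ((a ^ 3) ^ 2 + 41 * a ^ 3 - 72) * (cubic a ^ 3 * sextic a) +
  C (-(a ^ 3) ^ 4 - 19 * (a ^ 3) ^ 3 - 108 * (a ^ 3) ^ 2 - 128 * a ^ 3 + 256) *
    (triangle * sextic a ^ 2) +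
  C (-(a ^ 3) ^ 3 - 12 * (a ^ 3) ^ 2 - 72 * a ^ 3 + 112) * (cubic a * sextic a ^ 2)

/-- The coefficient of the vector field `(x⁴, y⁴, z⁴)` in the syzygy of degree `16`. -/
def coeffFourth (a : ℂ) : S :=
  C ((a ^ 3) ^ 3 + 6 * (a ^ 3) ^ 2 - 15 * a ^ 3 + 8) * (cubic a ^ 2 * triangle ^ 2) +
  C (-(a ^ 3) ^ 2 + 5 * a ^ 3 - 4) * (cubic a ^ 3 * triangle) +
  C (-12) * cubic a ^ 4 +
  C (4 * (a ^ 3) ^ 4 + 20 * (a ^ 3) ^ 3 - 84 * (a ^ 3) ^ 2 + 92 * a ^ 3 - 32) *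
    (triangle ^ 2 * sextic a) +
  C (-(a ^ 3) ^ 3 + 45 * (a ^ 3) ^ 2 - 60 * a ^ 3 + 16) * (cubic a * triangle * sextic a) +
  C (-(a ^ 3) ^ 2 - 43 * a ^ 3 + 80) * (cubic a ^ 2 * sextic a) +
  C (2 * (a ^ 3) ^ 3 + 30 * (a ^ 3) ^ 2 + 96 * a ^ 3 - 128) * sextic a ^ 2

/-- The coefficient of the vector field `(y²z², z²x², x²y²)` in the syzygy of degree `16`. -/
def coeffPolar (a : ℂ) : S :=
  C ((a ^ 3) ^ 3 + 6 * (a ^ 3) ^ 2 - 15 * a ^ 3 + 8) * (cubic a ^ 2 * triangle ^ 2) +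
  C ((a ^ 3) ^ 2 + 19 * a ^ 3 - 20) * (cubic a ^ 3 * triangle) +
  C 12 * cubic a ^ 4 +
  C (4 * (a ^ 3) ^ 4 + 20 * (a ^ 3) ^ 3 - 84 * (a ^ 3) ^ 2 + 92 * a ^ 3 - 32) *
    (triangle ^ 2 * sextic a) +
  C (7 * (a ^ 3) ^ 3 + 93 * (a ^ 3) ^ 2 - 180 * a ^ 3 + 80) * (cubic a * triangle * sextic a) +
  C (3 * (a ^ 3) ^ 2 + 81 * a ^ 3 - 48) * (cubic a ^ 2 * sextic a)

/-- The syzygy of degree `16`: a combination of the Euler derivation and of two vector fields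
invariant under the symmetries of the arrangement, with coefficients that are polynomials in the
basic invariants. -/
def syzygySixteen (a : ℂ) (i : Fin 3) : S :=
  coeffEuler a * X i + C a * coeffFourth a * X i ^ 4 +
    C (a ^ 2) * coeffPolar a * (X (i + 1) * X (i + 2)) ^ 2

lemma cubic_isHomogeneous (a : ℂ) : (cubic a).IsHomogeneous 3 := by
  have h : ∀ i : Fin 3, (X i ^ 3 : S).IsHomogeneous 3 := fun i => (isHomogeneous_X ℂ i).pow 3
  exact ((((h 0).add (h 1)).add (h 2)).C_mul a).sub
    ((((isHomogeneous_X ℂ 0).mul (isHomogeneous_X ℂ 1)).mul (isHomogeneous_X ℂ 2)).C_mul _)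

lemma triangle_isHomogeneous : triangle.IsHomogeneous 3 :=
  ((isHomogeneous_X ℂ 0).mul (isHomogeneous_X ℂ 1)).mul (isHomogeneous_X ℂ 2)

lemma sextic_isHomogeneous (a : ℂ) : (sextic a).IsHomogeneous 6 := by
  have h : ∀ i : Fin 3, (X i ^ 3 : S).IsHomogeneous 3 := fun i => (isHomogeneous_X ℂ i).pow 3
  have ht := triangle_isHomogeneous
  exact ((((ht.pow 2).C_mul _).sub ((ht.C_mul a).mul (((h 0).add (h 1)).add (h 2)))).add
    (((((h 0).mul (h 1)).add ((h 1).mul (h 2))).add ((h 2).mul (h 0))).C_mul _))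

lemma syzygySeven_isHomogeneous (a : ℂ) (i : Fin 3) : (syzygySeven a i).IsHomogeneous 7 :=
  (((sextic_isHomogeneous a).pderiv).mul (cubic_isHomogeneous a).pderiv).sub
    (((sextic_isHomogeneous a).pderiv).mul (cubic_isHomogeneous a).pderiv)

lemma syzygySixteen_isHomogeneous (a : ℂ) (i : Fin 3) : (syzygySixteen a i).IsHomogeneous 16 := by
  have hc := cubic_isHomogeneous a
  have hg := sextic_isHomogeneous a
  have hp := triangle_isHomogeneous
  have h1 : (coeffEuler a).IsHomogeneous 15 := by
    refine .add (.add (.add (.add (.add (.add (.add (.add (.add ?_ ?_) ?_) ?_) ?_) ?_) ?_) ?_) ?_) ?_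
    · exact ((hc.pow 2).mul (hp.pow 3)).C_mul _
    · exact ((hc.pow 3).mul (hp.pow 2)).C_mul _
    · exact ((hc.pow 4).mul hp).C_mul _
    · exact (hc.pow 5).C_mul _
    · exact ((hp.pow 3).mul hg).C_mul _
    · exact ((hc.mul (hp.pow 2)).mul hg).C_mul _
    · exact (((hc.pow 2).mul hp).mul hg).C_mul _
    · exact ((hc.pow 3).mul hg).C_mul _
    · exact (hp.mul (hg.pow 2)).C_mul _
    · exact (hc.mul (hg.pow 2)).C_mul _
  have h2 : (coeffFourth a).IsHomogeneous 12 := by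
    refine .add (.add (.add (.add (.add (.add ?_ ?_) ?_) ?_) ?_) ?_) ?_
    · exact ((hc.pow 2).mul (hp.pow 2)).C_mul _
    · exact ((hc.pow 3).mul hp).C_mul _
    · exact (hc.pow 4).C_mul _
    · exact ((hp.pow 2).mul hg).C_mul _
    · exact ((hc.mul hp).mul hg).C_mul _
    · exact ((hc.pow 2).mul hg).C_mul _
    · exact (hg.pow 2).C_mul _
  have h3 : (coeffPolar a).IsHomogeneous 12 := by
    refine .add (.add (.add (.add (.add ?_ ?_) ?_) ?_) ?_) ?_
    · exact ((hc.pow 2).mul (hp.pow 2)).C_mul _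
    · exact ((hc.pow 3).mul hp).C_mul _
    · exact (hc.pow 4).C_mul _
    · exact ((hp.pow 2).mul hg).C_mul _
    · exact ((hc.mul hp).mul hg).C_mul _
    · exact ((hc.pow 2).mul hg).C_mul _
  have hX : ∀ i, (X i : S).IsHomogeneous 1 := isHomogeneous_X ℂ
  exact ((h1.mul (hX i)).add ((h2.C_mul a).mul ((hX i).pow 4))).add
    ((h3.C_mul _).mul (((hX _).mul (hX _)).pow 2))

/-- The action of the two invariant vector fields on the cubic, in terms of the basic invariants. -/
lemma fields_cubic (a : ℂ) :
    C a * (X 0 ^ 4 * pderiv 0 (cubic a) + X 1 ^ 4 * pderiv 1 (cubic a) +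
      X 2 ^ 4 * pderiv 2 (cubic a)) =
      3 * ((cubic a + C (a ^ 3 + 2) * triangle) ^ 2 - 2 * (sextic a + triangle * cubic a +
        C (2 * a ^ 3 + 1) * triangle ^ 2)) -
        C (a ^ 3 + 2) * triangle * (cubic a + C (a ^ 3 + 2) * triangle) ∧
    C (a ^ 2) * ((X 1 * X 2) ^ 2 * pderiv 0 (cubic a) + (X 2 * X 0) ^ 2 * pderiv 1 (cubic a) +
      (X 0 * X 1) ^ 2 * pderiv 2 (cubic a)) =
      C (9 * a ^ 3) * triangle ^ 2 - C (a ^ 3 + 2) * (sextic a + triangle * cubic a +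
        C (2 * a ^ 3 + 1) * triangle ^ 2) := by
  obtain ⟨h1, h2, h3, h4, h5, h6⟩ := fin_three_shift
  constructor <;>
  · simp only [pderiv_cubic, h1, h2, h3, h4, h5, h6]
    simp only [cubic, sextic, triangle, map_add, map_sub, map_mul, map_pow, map_one, map_ofNat]
    ring

/-- The action of the two invariant vector fields on the sextic, in terms of the basic
invariants. -/
lemma fields_sextic (a : ℂ) :
    C a * (X 0 ^ 4 * pderiv 0 (sextic a) + X 1 ^ 4 * pderiv 1 (sextic a) +
      X 2 ^ 4 * pderiv 2 (sextic a)) =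
      2 * C (1 - a ^ 3) * triangle ^ 2 * (cubic a + C (a ^ 3 + 2) * triangle) -
        (4 * triangle * (cubic a + C (a ^ 3 + 2) * triangle) ^ 2 -
          6 * triangle * (sextic a + triangle * cubic a + C (2 * a ^ 3 + 1) * triangle ^ 2)) +
        3 * ((cubic a + C (a ^ 3 + 2) * triangle) * (sextic a + triangle * cubic a +
          C (2 * a ^ 3 + 1) * triangle ^ 2) - C (3 * a ^ 3) * triangle ^ 3) ∧
    C (a ^ 2) * ((X 1 * X 2) ^ 2 * pderiv 0 (sextic a) + (X 2 * X 0) ^ 2 * pderiv 1 (sextic a) +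
      (X 0 * X 1) ^ 2 * pderiv 2 (sextic a)) =
      2 * C (1 - a ^ 3) * triangle * (sextic a + triangle * cubic a +
          C (2 * a ^ 3 + 1) * triangle ^ 2) -
        ((cubic a + C (a ^ 3 + 2) * triangle) * (sextic a + triangle * cubic a +
          C (2 * a ^ 3 + 1) * triangle ^ 2) + C (9 * a ^ 3) * triangle ^ 3) +
        C (6 * a ^ 3) * triangle ^ 2 * (cubic a + C (a ^ 3 + 2) * triangle) := by
  obtain ⟨h1, h2, h3, h4, h5, h6⟩ := fin_three_shift
  constructor <;>
  · simp only [pderiv_sextic, h1, h2, h3, h4, h5, h6]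
    simp only [cubic, sextic, triangle, map_add, map_sub, map_mul, map_pow, map_one, map_ofNat]
    ring

lemma syzygySixteen_cubic (a : ℂ) :
    syzygySixteen a 0 * pderiv 0 (cubic a) + syzygySixteen a 1 * pderiv 1 (cubic a) +
      syzygySixteen a 2 * pderiv 2 (cubic a) =
      -3 * octicG (C (a ^ 3)) (sextic a) (cubic a) := by
  obtain ⟨e1, e2⟩ := fields_cubic a
  have e0 := (cubic_isHomogeneous a).sum_X_mul_pderiv
  rw [Fin.sum_univ_three, nsmul_eq_mul] at e0
  push_cast at e0
  obtain ⟨h1, h2, h3, h4, h5, h6⟩ := fin_three_shift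
  have key : coeffEuler a * (3 * cubic a) + coeffFourth a * (3 * ((cubic a + C (a ^ 3 + 2) *
      triangle) ^ 2 - 2 * (sextic a + triangle * cubic a +
        C (2 * a ^ 3 + 1) * triangle ^ 2)) -
        C (a ^ 3 + 2) * triangle * (cubic a + C (a ^ 3 + 2) * triangle)) +
      coeffPolar a * (C (9 * a ^ 3) * triangle ^ 2 - C (a ^ 3 + 2) * (sextic a +
        triangle * cubic a + C (2 * a ^ 3 + 1) * triangle ^ 2)) =
      -3 * octicG (C (a ^ 3)) (sextic a) (cubic a) := by
    simp only [coeffEuler, coeffFourth, coeffPolar, octicG, map_add, map_sub, map_neg, map_mul,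
      map_pow, map_one, map_ofNat]
    generalize cubic a = c
    generalize sextic a = g
    generalize triangle = p
    generalize (C a : S) = α
    ring
  simp only [syzygySixteen, h1, h2, h3, h4, h5, h6]
  linear_combination coeffEuler a * e0 + coeffFourth a * e1 + coeffPolar a * e2 + key

lemma syzygySixteen_sextic (a : ℂ) :
    syzygySixteen a 0 * pderiv 0 (sextic a) + syzygySixteen a 1 * pderiv 1 (sextic a) +
      syzygySixteen a 2 * pderiv 2 (sextic a) =
      3 * octicC (C (a ^ 3)) (sextic a) (cubic a) := by
  obtain ⟨e1, e2⟩ := fields_sextic a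
  have e0 := (sextic_isHomogeneous a).sum_X_mul_pderiv
  rw [Fin.sum_univ_three, nsmul_eq_mul] at e0
  push_cast at e0
  obtain ⟨h1, h2, h3, h4, h5, h6⟩ := fin_three_shift
  have key : coeffEuler a * (6 * sextic a) + coeffFourth a * (2 * C (1 - a ^ 3) * triangle ^ 2 *
      (cubic a + C (a ^ 3 + 2) * triangle) -
        (4 * triangle * (cubic a + C (a ^ 3 + 2) * triangle) ^ 2 -
          6 * triangle * (sextic a + triangle * cubic a + C (2 * a ^ 3 + 1) * triangle ^ 2)) +
        3 * ((cubic a + C (a ^ 3 + 2) * triangle) * (sextic a + triangle * cubic a +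
          C (2 * a ^ 3 + 1) * triangle ^ 2) - C (3 * a ^ 3) * triangle ^ 3)) +
      coeffPolar a * (2 * C (1 - a ^ 3) * triangle * (sextic a + triangle * cubic a +
          C (2 * a ^ 3 + 1) * triangle ^ 2) -
        ((cubic a + C (a ^ 3 + 2) * triangle) * (sextic a + triangle * cubic a +
          C (2 * a ^ 3 + 1) * triangle ^ 2) + C (9 * a ^ 3) * triangle ^ 3) +
        C (6 * a ^ 3) * triangle ^ 2 * (cubic a + C (a ^ 3 + 2) * triangle)) =
      3 * octicC (C (a ^ 3)) (sextic a) (cubic a) := by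
    simp only [coeffEuler, coeffFourth, coeffPolar, octicC, map_add, map_sub, map_neg, map_mul,
      map_pow, map_one, map_ofNat]
    generalize cubic a = c
    generalize sextic a = g
    generalize triangle = p
    generalize (C a : S) = α
    ring
  simp only [syzygySixteen, h1, h2, h3, h4, h5, h6]
  linear_combination coeffEuler a * e0 + coeffFourth a * e1 + coeffPolar a * e2 + key

/-- The cross product of the two syzygies is a multiple of the gradient. -/
lemma cross_syzygies (hω : IsPrimitiveRoot ω 3) (i : Fin 3) :
    syzygySeven a (i + 1) * syzygySixteen a (i + 2) -
      syzygySeven a (i + 2) * syzygySixteen a (i + 1) =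
      C (3 * a ^ 6) * pderiv i (chilean a ω) := by
  have h1 := syzygySixteen_cubic a
  have h2 := syzygySixteen_sextic a
  have h3 : C (a ^ 6) * pderiv i (chilean a ω) = octicG (C (a ^ 3)) (sextic a) (cubic a) *
      pderiv i (sextic a) + octicC (C (a ^ 3)) (sextic a) (cubic a) * pderiv i (cubic a) := by
    rw [← pderiv_C_mul, chilean_eq_octic hω, pderiv_octic]
  have h4 : (C (3 * a ^ 6) : S) = 3 * C (a ^ 6) := by rw [C_mul, map_ofNat]
  rw [h4, mul_assoc, h3]
  have h5 : ∀ j : Fin 3, j + 1 + 1 = j + 2 ∧ j + 1 + 2 = j ∧ j + 2 + 1 = j ∧ j + 2 + 2 = j + 1 := by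
    decide
  obtain ⟨k1, k2, k3, k4⟩ := h5 i
  have hs : ∀ f : Fin 3 → S, f 0 + f 1 + f 2 = f i + f (i + 1) + f (i + 2) := by
    intro f
    fin_cases i
    · rfl
    · change f 0 + f 1 + f 2 = f 1 + f 2 + f 0; ring
    · change f 0 + f 1 + f 2 = f 2 + f 0 + f 1; ring
  rw [hs (fun j => syzygySixteen a j * pderiv j (cubic a))] at h1
  rw [hs (fun j => syzygySixteen a j * pderiv j (sextic a))] at h2
  simp only [syzygySeven, k1, k2, k3, k4]
  linear_combination pderiv i (cubic a) * h2 - pderiv i (sextic a) * h1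

theorem hasExponents_chilean (hω : IsPrimitiveRoot ω 3) (ha0 : a ≠ 0)
    (hF : ∀ d, (∀ i, d ∣ pderiv i (chilean a ω)) → IsUnit d) :
    HasExponents (chilean a ω) 7 16 := by
  obtain ⟨b, hb0, hb1⟩ := exists_basis_logDerZero (u := syzygySeven a) (w := syzygySixteen a)
    (κ := 3 * a ^ 6) (mul_ne_zero three_ne_zero (pow_ne_zero _ ha0)) hF
    (cross_syzygies hω 0) (cross_syzygies hω 1) (cross_syzygies hω 2)
  refine ⟨b, fun j => ⟨?_, ?_⟩⟩
  · rw [hb0]; exact syzygySeven_isHomogeneous a j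
  · rw [hb1]; exact syzygySixteen_isHomogeneous a j

end Syzygies

/-! ### Smooth conics are irreducible -/

section Smooth

/-- A projective plane curve is smooth if its gradient vanishes at no nonzero vector; for
polynomials of nonzero degree this includes the points outside of the curve, by Euler's identity. -/
def IsSmooth (Q : S) : Prop := ∀ v : Fin 3 → ℂ, v ≠ 0 → ∃ i, eval v (pderiv i Q) ≠ 0

lemma eval_smul_of_isHomogeneous {F : S} {n : ℕ} (hF : F.IsHomogeneous n) (t : ℂ)
    (v : Fin 3 → ℂ) : eval (t • v) F = t ^ n * eval v F := by
  rw [eval_eq', eval_eq', Finset.mul_sum]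
  refine Finset.sum_congr rfl fun d hd => ?_
  have h : d 0 + d 1 + d 2 = n := by
    have h := hF (mem_support_iff.1 hd)
    change Finsupp.weight (fun _ => 1) d = n at h
    rwa [← Finsupp.degree_eq_weight_one, Finsupp.degree_eq_sum, Fin.sum_univ_three] at h
  simp only [Fin.prod_univ_three, Pi.smul_apply, smul_eq_mul, mul_pow, ← h, pow_add]
  ring

lemma exists_eq_of_totalDegree_le_one {f : S} (hf : f.totalDegree ≤ 1) :
    ∃ (c₀ : ℂ) (c : Fin 3 → ℂ), f = C c₀ + ∑ i, C (c i) * X i := by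
  have h1 : homogeneousComponent 1 f ∈ Submodule.span ℂ (Set.range (X : Fin 3 → S)) := by
    rw [← homogeneousSubmodule_one_eq_span_X]
    exact homogeneousComponent_isHomogeneous 1 f
  obtain ⟨c, hc⟩ := (Submodule.mem_span_range_iff_exists_fun ℂ).1 h1
  refine ⟨coeff 0 f, c, ?_⟩
  have h2 : f = homogeneousComponent 0 f + homogeneousComponent 1 f := by
    conv_lhs => rw [← sum_homogeneousComponent f]
    have h3 : ∀ i ∈ Finset.range 2, i ∉ Finset.range (f.totalDegree + 1) →
        homogeneousComponent i f = 0 := fun i _ hi =>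
      homogeneousComponent_eq_zero _ _ (by simpa using hi)
    rw [Finset.sum_subset (Finset.range_subset_range.2 (by omega)) h3]
    simp [Finset.sum_range_succ]
  rw [homogeneousComponent_zero, ← hc] at h2
  simpa only [smul_eq_C_mul] using h2

lemma exists_ne_zero_dotProduct_eq_zero (c d : Fin 3 → ℂ) :
    ∃ v : Fin 3 → ℂ, v ≠ 0 ∧ ∑ i, c i * v i = 0 ∧ ∑ i, d i * v i = 0 := by
  obtain ⟨v, hv, h⟩ := Matrix.exists_mulVec_eq_zero_iff.2
    (Matrix.det_eq_zero_of_row_eq_zero (A := Matrix.of ![c, d, 0]) 2 fun j => rfl)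
  exact ⟨v, hv, congrFun h 0, congrFun h 1⟩

/-- If a product of two affine linear forms is a quadratic form, then its gradient vanishes on the
intersection of the two lines at infinity. -/
theorem IsSmooth.irreducible {Q : S} (hs : IsSmooth Q) (hQ : Q.IsHomogeneous 2) :
    Irreducible Q := by
  have hQ0 : Q ≠ 0 := by
    rintro rfl
    obtain ⟨i, hi⟩ := hs 1 one_ne_zero
    simp at hi
  have hd := hQ.totalDegree hQ0
  have hu : ∀ f : S, f ≠ 0 → f.totalDegree = 0 → IsUnit f := by
    intro f hf h
    rw [totalDegree_eq_zero_iff_eq_C] at h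
    rw [h] at hf ⊢
    exact (IsUnit.mk0 _ (C_ne_zero.1 hf)).map C
  refine ⟨fun h => ?_, fun f g hfg => ?_⟩
  · have := (isUnit_iff_totalDegree_of_isReduced.1 h).2
    omega
  · have hf0 : f ≠ 0 := by rintro rfl; simp [hfg] at hQ0
    have hg0 : g ≠ 0 := by rintro rfl; simp [hfg] at hQ0
    have hdeg : f.totalDegree + g.totalDegree = 2 := by
      rw [← totalDegree_mul_of_isDomain hf0 hg0, ← hfg, hd]
    by_contra! hne
    have h1 : f.totalDegree ≠ 0 := fun h => hne.1 (hu f hf0 h)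
    have h2 : g.totalDegree ≠ 0 := fun h => hne.2 (hu g hg0 h)
    obtain ⟨c₀, c, hc⟩ := exists_eq_of_totalDegree_le_one (f := f) (by omega)
    obtain ⟨d₀, d, hd⟩ := exists_eq_of_totalDegree_le_one (f := g) (by omega)
    obtain ⟨v, hv, h3, h4⟩ := exists_ne_zero_dotProduct_eq_zero c d
    obtain ⟨i, hi⟩ := hs v hv
    -- the gradient takes the same value at `v` and at the origin
    have key : ∀ w : Fin 3 → ℂ, ∑ i, c i * w i = 0 → ∑ i, d i * w i = 0 →
        eval w (pderiv i Q) = c₀ * d i + d₀ * c i := by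
      intro w hw hw'
      have e : ∀ c : Fin 3 → ℂ, ∀ j, (pderiv j) (∑ i, C (c i) * X i : S) = C (c j) := by
        intro c j
        simp [Derivation.leibniz, Pi.single_apply]
      rw [hfg, Derivation.leibniz, hc, hd]
      simp only [map_add, pderiv_C, zero_add, e, smul_eq_mul, map_mul, eval_C, map_sum, eval_X, hw,
        hw', add_zero]
    apply hi
    rw [key v h3 h4, ← key 0 (by simp) (by simp)]
    simpa using eval_smul_of_isHomogeneous (hQ.pderiv (i := i)) 0 0

end Smooth

/-! ### Smoothness of the twelve conics -/

section Conics

variable {a ω : ℂ}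

lemma pow_fin_mul_cube (hω : IsPrimitiveRoot ω 3) (m : Fin 3) : (a * ω ^ (m : ℕ)) ^ 3 = a ^ 3 := by
  rw [mul_pow, pow_fin_cube hω, mul_one]

lemma mul_pow_sub_one_ne_zero (hω : IsPrimitiveRoot ω 3) (ha1 : a ^ 3 ≠ 1) (m : Fin 3) :
    a * ω ^ (m : ℕ) - 1 ≠ 0 := by
  intro h
  apply ha1
  rw [← pow_fin_mul_cube hω m, sub_eq_zero.1 h, one_pow]

lemma mul_pow_add_two_ne_zero (hω : IsPrimitiveRoot ω 3) (ha8 : a ^ 3 ≠ -8) (m : Fin 3) :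
    a * ω ^ (m : ℕ) + 2 ≠ 0 := by
  intro h
  apply ha8
  rw [← pow_fin_mul_cube hω m, eq_neg_of_add_eq_zero_left h]
  norm_num

lemma chileanConic_isHomogeneous (a ω : ℂ) (k : ConicIndex) :
    (chileanConic a ω k).IsHomogeneous 2 := by
  have h1 : ∀ i : Fin 3, (X i ^ 2 : S).IsHomogeneous 2 := fun i => (isHomogeneous_X ℂ i).pow 2
  have h2 : ∀ i j : Fin 3, (X i * X j : S).IsHomogeneous 2 := fun i j =>
    (isHomogeneous_X ℂ i).mul (isHomogeneous_X ℂ j)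
  rcases k with k | ⟨i, j⟩
  · simp only [chileanConic]
    exact (h2 _ _).sub ((h1 _).C_mul _)
  · simp only [chileanConic]
    refine ((h1 _).add ((h1 _).C_mul _)).add ((h1 _).C_mul _) |>.add ?_
    refine IsHomogeneous.C_mul ?_ _
    exact (((h2 _ _).C_mul _).add ((h2 _ _).C_mul _)).add ((h2 _ _).C_mul _)

lemma chilean_isHomogeneous (a ω : ℂ) : (chilean a ω).IsHomogeneous 24 := by
  have h := IsHomogeneous.prod Finset.univ (chileanConic a ω) (fun _ => 2)
    fun k _ => chileanConic_isHomogeneous a ω k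
  have e : ∑ _k : ConicIndex, 2 = 24 := by simp
  rw [e] at h
  exact h

lemma isSmooth_chileanConic (hω : IsPrimitiveRoot ω 3) (ha0 : a ≠ 0) (ha1 : a ^ 3 ≠ 1)
    (ha8 : a ^ 3 ≠ -8) (k : ConicIndex) : IsSmooth (chileanConic a ω k) := by
  intro v hv
  by_contra! h
  apply hv
  rcases k with k | ⟨i, j⟩
  · have e0 := h k
    have e1 := h (k + 1)
    have e2 := h (k + 2)
    simp [chileanConic, Derivation.leibniz, Derivation.leibniz_pow, ha0] at e0 e1 e2
    funext l
    have : l = k ∨ l = k + 1 ∨ l = k + 2 := by clear * -; revert l k; decide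
    rcases this with rfl | rfl | rfl
    · exact e0
    · exact e2
    · exact e1
  · have hi : ω ^ (i : ℕ) ≠ 0 := pow_ne_zero _ (hω.ne_zero (by norm_num))
    have hj : ω ^ (j : ℕ) ≠ 0 := pow_ne_zero _ (hω.ne_zero (by norm_num))
    have h1 := mul_pow_sub_one_ne_zero (a := a) hω ha1 (i + j)
    have h2 := mul_pow_add_two_ne_zero (a := a) hω ha8 (i + j)
    rw [pow_add_fin hω] at h1 h2
    have e0 := h 0
    have e1 := h 1
    have e2 := h 2
    simp [chileanConic, Derivation.leibniz, Derivation.leibniz_pow, pow_mul', pow_add] at e0 e1 e2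
    generalize ω ^ (i : ℕ) = η at *
    generalize ω ^ (j : ℕ) = ζ at *
    generalize hb : a * (η * ζ) = t at *
    have e1' : 2 * (η * v 1) + (1 + t) * (v 0 + ζ * v 2) = 0 := by
      apply mul_left_cancel₀ hi
      linear_combination e1
    have e2' : 2 * (ζ * v 2) + (1 + t) * (v 0 + η * v 1) = 0 := by
      apply mul_left_cancel₀ hj
      linear_combination e2
    have f1 : v 0 - η * v 1 = 0 := by
      apply mul_left_cancel₀ h1
      linear_combination e1' - e0
    have f2 : v 0 - ζ * v 2 = 0 := by
      apply mul_left_cancel₀ h1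
      linear_combination e2' - e0
    have f0 : v 0 = 0 := by
      apply mul_left_cancel₀ (mul_ne_zero two_ne_zero h2)
      linear_combination e0 + (1 + t) * (f1 + f2)
    rw [f0, zero_sub, neg_eq_zero] at f1 f2
    funext l
    fin_cases l
    · exact f0
    · exact (mul_eq_zero.1 f1).resolve_left hi
    · exact (mul_eq_zero.1 f2).resolve_left hj

end Conics

/-! ### Intersections within one triple -/

section OneTriple

variable {b ω : ℂ}

lemma eval_cubic_shift (b : ℂ) (x : Fin 3 → ℂ) (k : Fin 3) : eval x (cubic b) =
    b * (x k ^ 3 + x (k + 1) ^ 3 + x (k + 2) ^ 3) - (b ^ 3 + 2) * (x k * x (k + 1) * x (k + 2)) := by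
  obtain ⟨h1, h2, h3, h4, h5, h6⟩ := fin_three_shift
  rw [eval_cubic]
  fin_cases k
  · rfl
  · change _ = b * (x 1 ^ 3 + x 2 ^ 3 + x 0 ^ 3) - (b ^ 3 + 2) * (x 1 * x 2 * x 0); ring
  · change _ = b * (x 2 ^ 3 + x 0 ^ 3 + x 1 ^ 3) - (b ^ 3 + 2) * (x 2 * x 0 * x 1); ring

lemma eq_of_shift {M : Type*} {f g : Fin 3 → M} (k : Fin 3) (h0 : f k = g k)
    (h1 : f (k + 1) = g (k + 1)) (h2 : f (k + 2) = g (k + 2)) : f = g := by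
  funext l
  have : l = k ∨ l = k + 1 ∨ l = k + 2 := by clear * -; revert l k; decide
  rcases this with rfl | rfl | rfl
  · exact h0
  · exact h1
  · exact h2

lemma shift_shift (k : Fin 3) : k + 1 + 1 = k + 2 ∧ k + 1 + 2 = k ∧ k + 2 + 1 = k ∧
    k + 2 + 2 = k + 1 := by
  revert k; decide

/-- A cube root of unity is a power of `ω`. -/
lemma exists_pow_eq (hω : IsPrimitiveRoot ω 3) {ζ : ℂ} (h : ζ ^ 3 = 1) :
    ∃ i : Fin 3, ω ^ (i : ℕ) = ζ := by
  obtain ⟨i, hi, rfl⟩ := hω.eq_pow_of_pow_eq_one h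
  exact ⟨⟨i, hi⟩, rfl⟩

/-- The intersection points of a conic of the coordinate triple with the cubic are base points of
the pencil. -/
lemma exists_eq_basePoint (hω : IsPrimitiveRoot ω 3) (hb : b ≠ 0) {x : Fin 3 → ℂ} (hx : x ≠ 0)
    (hc : eval x (cubic b) = 0) {k : Fin 3} (hk : x (k + 1) * x (k + 2) = b * x k ^ 2) :
    ∃ (l i : Fin 3) (t : ℂ), t ≠ 0 ∧ x = t • basePoint b ω l i := by
  obtain ⟨s1, s2, s3, s4⟩ := shift_shift k
  rw [eval_cubic_shift b x k] at hc
  have h0 : x k ≠ 0 := by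
    intro h0
    rw [h0] at hk hc
    have h1 : x (k + 1) ^ 3 + x (k + 2) ^ 3 = 0 := by
      apply mul_left_cancel₀ hb
      linear_combination hc
    have h2 : x (k + 1) * x (k + 2) = 0 := by rw [hk]; ring
    rcases mul_eq_zero.1 h2 with h | h
    · rw [h] at h1
      exact hx (eq_of_shift k h0 h (by simpa using h1))
    · rw [h] at h1
      exact hx (eq_of_shift k h0 (by simpa using h1) h)
  -- the cubes of the other two coordinates have sum `(b³ + 1) x k³` and product `b³ x k⁶`
  have h3 : (x (k + 1) ^ 3 - x k ^ 3) * (x (k + 2) ^ 3 - x k ^ 3) = 0 := by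
    apply mul_left_cancel₀ hb
    linear_combination (-x k ^ 3) * hc + (b * ((x (k + 1) * x (k + 2)) ^ 2 +
      x (k + 1) * x (k + 2) * (b * x k ^ 2) + (b * x k ^ 2) ^ 2) - (b ^ 3 + 2) * x k ^ 4) * hk
  have key : ∀ y : ℂ, y ^ 3 - x k ^ 3 = 0 → ∃ ζ : ℂ, ζ ^ 3 = 1 ∧ y = ζ * x k := by
    intro y hy
    refine ⟨y / x k, ?_, by field_simp⟩
    rw [div_pow, sub_eq_zero.1 hy, div_self (pow_ne_zero _ h0)]
  rcases mul_eq_zero.1 h3 with h | h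
  · obtain ⟨ζ, hζ, hy⟩ := key _ h
    obtain ⟨i, rfl⟩ := exists_pow_eq hω hζ
    have hi : ω ^ (i : ℕ) ≠ 0 := pow_ne_zero _ (hω.ne_zero (by norm_num))
    refine ⟨k + 2, i, (ω ^ (i : ℕ)) ^ 2 * x k, mul_ne_zero (pow_ne_zero _ hi) h0,
      eq_of_shift (k + 2) ?_ ?_ ?_⟩
    · rw [Pi.smul_apply, basePoint_self, smul_eq_mul]
      apply mul_left_cancel₀ (mul_ne_zero hi h0)
      rw [hy] at hk
      linear_combination hk - b * x k ^ 2 * hζ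
    · rw [Pi.smul_apply, basePoint_add_one, smul_eq_mul, s3]
      linear_combination -x k * hζ
    · rw [Pi.smul_apply, basePoint_add_two, smul_eq_mul, s4, hy]
      linear_combination -ω ^ (i : ℕ) * x k * hζ
  · obtain ⟨ζ, hζ, hy⟩ := key _ h
    have h6 : (ζ ^ 2) ^ 3 = 1 := by rw [← pow_mul, mul_comm, pow_mul, hζ, one_pow]
    obtain ⟨i, hi⟩ := exists_pow_eq hω h6
    have hζ0 : ζ ≠ 0 := by rintro rfl; simp at hζ
    refine ⟨k + 1, i, ζ ^ 2 * x k, mul_ne_zero (pow_ne_zero _ hζ0) h0,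
      eq_of_shift (k + 1) ?_ ?_ ?_⟩
    · rw [Pi.smul_apply, basePoint_self, smul_eq_mul]
      apply mul_left_cancel₀ (mul_ne_zero hζ0 h0)
      rw [hy] at hk
      linear_combination hk - b * x k ^ 2 * hζ
    · rw [Pi.smul_apply, basePoint_add_one, smul_eq_mul, s1, hy, hi]
      linear_combination -ζ * x k * hζ
    · rw [Pi.smul_apply, basePoint_add_two, smul_eq_mul, s2, hi]
      linear_combination -x k * h6

/-- A base point lies on two of the three conics of the coordinate triple. -/
lemma basePoint_mem_conic (hω : IsPrimitiveRoot ω 3) (hb : b ^ 3 ≠ 1) {t : ℂ} (ht : t ≠ 0)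
    (l i j : Fin 3) : (t • basePoint b ω l i) (j + 1) * (t • basePoint b ω l i) (j + 2) =
      b * (t • basePoint b ω l i) j ^ 2 ↔ j ≠ l := by
  have hε := pow_fin_cube hω i
  obtain ⟨s1, s2, s3, s4⟩ := shift_shift l
  have hj : j = l ∨ j = l + 1 ∨ j = l + 2 := by clear * -; revert l j; decide
  have h1 : l + 1 ≠ l := by clear * -; revert l; decide
  have h2 : l + 2 ≠ l := by clear * -; revert l; decide
  simp only [Pi.smul_apply, smul_eq_mul]
  rcases hj with rfl | rfl | rfl
  · rw [basePoint_self, basePoint_add_one, basePoint_add_two]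
    refine iff_of_false (fun h => hb ?_) (by simp)
    apply mul_left_cancel₀ (pow_ne_zero 2 ht)
    linear_combination -h + t ^ 2 * hε
  · rw [s1, s2, basePoint_self, basePoint_add_one, basePoint_add_two]
    refine iff_of_true ?_ h1
    ring
  · rw [s3, s4, basePoint_self, basePoint_add_one, basePoint_add_two]
    refine iff_of_true ?_ h2
    linear_combination -b * t ^ 2 * ω ^ (i : ℕ) * hε

/-- Outside of the cubic, two conics of the coordinate triple meet in a vertex only. -/
lemma eq_zero_of_two_conics (hb : b ≠ 0) {x : Fin 3 → ℂ} (hc : eval x (cubic b) ≠ 0) (m : Fin 3)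
    (h1 : x (m + 2) * x m = b * x (m + 1) ^ 2) (h2 : x m * x (m + 1) = b * x (m + 2) ^ 2) :
    x (m + 1) = 0 ∧ x (m + 2) = 0 := by
  by_cases hy : x (m + 1) = 0
  · refine ⟨hy, ?_⟩
    rw [hy, mul_zero, eq_comm, mul_eq_zero] at h2
    simpa using h2.resolve_left hb
  -- otherwise the cubes of the coordinates have the ratio `b³ : 1 : 1`, and `x` lies on the cubic
  · exfalso
    apply hc
    rw [eval_cubic_shift b x m]
    have h3 : x (m + 1) ^ 3 - x (m + 2) ^ 3 = 0 := by
      apply mul_left_cancel₀ hb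
      linear_combination x (m + 2) * h2 - x (m + 1) * h1
    have h4 : x m ^ 3 - b ^ 3 * x (m + 1) ^ 3 = 0 := by
      apply mul_left_cancel₀ (pow_ne_zero 3 hy)
      linear_combination x m ^ 3 * h3 + ((x (m + 2) * x m) ^ 2 + (x (m + 2) * x m) *
        (b * x (m + 1) ^ 2) + (b * x (m + 1) ^ 2) ^ 2) * h1
    linear_combination b * h4 - b * h3 - (b ^ 3 + 2) * x (m + 1) * h1

end OneTriple

/-! ### The points lying on several conics -/

section Incidence

variable {a ω : ℂ}

lemma frameParam_ne (hω : IsPrimitiveRoot ω 3) (ha0 : a ≠ 0) (ha1 : a ^ 3 ≠ 1)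
    (ha8 : a ^ 3 ≠ -8) (c : Option (Fin 3)) :
    frameParam a ω c ≠ 0 ∧ frameParam a ω c ^ 3 ≠ 1 := by
  cases c with
  | none => exact ⟨ha0, ha1⟩
  | some m =>
    have h1 := mul_pow_sub_one_ne_zero (a := a) hω ha1 m
    have h2 := mul_pow_add_two_ne_zero (a := a) hω ha8 m
    have h3 := pow_fin_mul_cube (a := a) hω m
    simp only [frameParam]
    generalize a * ω ^ (m : ℕ) = t at *
    refine ⟨div_ne_zero h2 h1, fun h => ha1 ?_⟩
    rw [div_pow, div_eq_one_iff_eq (pow_ne_zero _ h1)] at h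
    linear_combination -h3 + (t - 1) / 9 * h

lemma frameScale_ne_zero (hω : IsPrimitiveRoot ω 3) (ha1 : a ^ 3 ≠ 1) (c : Option (Fin 3)) :
    frameScale a ω c ≠ 0 := by
  cases c with
  | none => exact one_ne_zero
  | some m =>
    have h1 := mul_pow_sub_one_ne_zero (a := a) hω ha1 m
    simp only [frameScale]
    exact div_ne_zero (neg_ne_zero.2 h1) three_ne_zero

lemma eval_conic_eq_zero_iff (hω : IsPrimitiveRoot ω 3) (ha1 : a ^ 3 ≠ 1) (c : Option (Fin 3))
    (k : Fin 3) (v : Fin 3 → ℂ) : eval v (chileanConic a ω (conicIdx c k)) = 0 ↔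
      eval v (frameForm ω c (k + 1)) * eval v (frameForm ω c (k + 2)) =
        frameParam a ω c * eval v (frameForm ω c k) ^ 2 := by
  rw [conic_eq_frame hω (mul_pow_sub_one_ne_zero hω ha1)]
  simp only [map_mul, map_sub, map_pow, eval_C, mul_eq_zero, frameScale_ne_zero hω ha1, false_or,
    sub_eq_zero]

/-- The square of the cubic is not one of the four special members of the pencil; the constant is
`(t + 2)² (t - 1)` with `t = a ω ^ m`. -/
lemma fibre_ne_zero (hω : IsPrimitiveRoot ω 3) (ha1 : a ^ 3 ≠ 1) (ha8 : a ^ 3 ≠ -8) (m : Fin 3) :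
    a ^ 3 - 4 + 3 * (a * ω ^ (m : ℕ)) ^ 2 ≠ 0 := by
  have h1 := mul_pow_sub_one_ne_zero (a := a) hω ha1 m
  have h2 := mul_pow_add_two_ne_zero (a := a) hω ha8 m
  have h3 := pow_fin_mul_cube (a := a) hω m
  intro h
  apply mul_ne_zero h1 (pow_ne_zero 2 h2)
  linear_combination h + h3

lemma eval_sextic_eq_zero {v : Fin 3 → ℂ} {k : Fin 3}
    (h : eval v (chileanConic a ω (conicIdx none k)) = 0) : eval v (sextic a) = 0 := by
  rw [← prod_conic_none (ω := ω), map_prod]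
  exact Finset.prod_eq_zero (Finset.mem_univ k) h

lemma eval_fibre_eq_zero_iff (hω : IsPrimitiveRoot ω 3) (ha0 : a ≠ 0) {v : Fin 3 → ℂ}
    {m : Fin 3} : eval v (cubic a) ^ 2 +
      (a ^ 3 - 4 + 3 * (a * ω ^ (m : ℕ)) ^ 2) * eval v (sextic a) = 0 ↔
      ∃ k, eval v (chileanConic a ω (conicIdx (some m) k)) = 0 := by
  have e := congrArg (eval v) (prod_conic_some (a := a) hω m)
  simp only [map_mul, map_add, map_pow, map_prod, eval_C] at e
  rw [← e, mul_eq_zero, Finset.prod_eq_zero_iff]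
  simp [ha0]

/-- Two fibres of the pencil meet only on the cubic. -/
lemma fibre_unique (hω : IsPrimitiveRoot ω 3) (ha0 : a ≠ 0) {v : Fin 3 → ℂ}
    (hv : eval v (cubic a) ≠ 0) {c c' : Option (Fin 3)} {k k' : Fin 3}
    (h : eval v (chileanConic a ω (conicIdx c k)) = 0)
    (h' : eval v (chileanConic a ω (conicIdx c' k')) = 0) : c = c' := by
  have hmix : ∀ m, eval v (sextic a) = 0 →
      ¬ ∃ k, eval v (chileanConic a ω (conicIdx (some m) k)) = 0 := by
    intro m h0 h1
    rw [← eval_fibre_eq_zero_iff hω ha0, h0, mul_zero, add_zero] at h1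
    exact hv (pow_eq_zero_iff two_ne_zero |>.1 h1)
  cases c with
  | none =>
    cases c' with
    | none => rfl
    | some m => exact (hmix m (eval_sextic_eq_zero h) ⟨_, h'⟩).elim
  | some m =>
    cases c' with
    | none => exact (hmix m (eval_sextic_eq_zero h') ⟨_, h⟩).elim
    | some m' =>
      have e := (eval_fibre_eq_zero_iff hω ha0).2 ⟨_, h⟩
      have e' := (eval_fibre_eq_zero_iff hω ha0).2 ⟨_, h'⟩
      by_contra hne
      have h0 : eval v (sextic a) ≠ 0 := fun h0 => hmix m h0 ⟨_, h⟩
      have h2 : (ω ^ (m : ℕ)) ^ 2 = (ω ^ (m' : ℕ)) ^ 2 := by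
        apply mul_left_cancel₀ (mul_ne_zero (mul_ne_zero three_ne_zero (pow_ne_zero 2 ha0)) h0)
        linear_combination e - e'
      have h3 : ω ^ (m : ℕ) = ω ^ (m' : ℕ) := by
        have e3 := pow_fin_cube hω m
        have e3' := pow_fin_cube hω m'
        calc ω ^ (m : ℕ) = ((ω ^ (m : ℕ)) ^ 2) ^ 2 := by linear_combination -ω ^ (m : ℕ) * e3
          _ = ((ω ^ (m' : ℕ)) ^ 2) ^ 2 := by rw [h2]
          _ = ω ^ (m' : ℕ) := by linear_combination ω ^ (m' : ℕ) * e3'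
      exact hne (congrArg some (Fin.ext (hω.pow_inj m.2 m'.2 h3)))

/-- If a conic passes through a point of the cubic, this is a base point of the pencil. -/
lemma eval_sextic_of_conic (hω : IsPrimitiveRoot ω 3) (ha0 : a ≠ 0) (ha1 : a ^ 3 ≠ 1)
    (ha8 : a ^ 3 ≠ -8) {v : Fin 3 → ℂ} (hv : eval v (cubic a) = 0) {c : Option (Fin 3)}
    {k : Fin 3} (h : eval v (chileanConic a ω (conicIdx c k)) = 0) : eval v (sextic a) = 0 := by
  cases c with
  | none => exact eval_sextic_eq_zero h
  | some m =>
    have e := (eval_fibre_eq_zero_iff hω ha0).2 ⟨_, h⟩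
    rw [hv, zero_pow two_ne_zero, zero_add, mul_eq_zero] at e
    exact e.resolve_left (fibre_ne_zero hω ha1 ha8 m)

lemma exists_conic_of_base (hω : IsPrimitiveRoot ω 3) (ha0 : a ≠ 0) {v : Fin 3 → ℂ}
    (hc : eval v (cubic a) = 0) (hg : eval v (sextic a) = 0) (c : Option (Fin 3)) :
    ∃ k, eval v (chileanConic a ω (conicIdx c k)) = 0 := by
  cases c with
  | none =>
    rw [← prod_conic_none (ω := ω), map_prod, Finset.prod_eq_zero_iff] at hg
    obtain ⟨k, -, hk⟩ := hg
    exact ⟨k, hk⟩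
  | some m =>
    rw [← eval_fibre_eq_zero_iff hω ha0, hc, hg]
    ring

/-- In each of the four frames the nine base points look alike. -/
lemma exists_frame_basePoint (hω : IsPrimitiveRoot ω 3) (ha0 : a ≠ 0) (ha1 : a ^ 3 ≠ 1)
    (ha8 : a ^ 3 ≠ -8) {v : Fin 3 → ℂ} (hv : v ≠ 0) (hc : eval v (cubic a) = 0)
    (hg : eval v (sextic a) = 0) (c : Option (Fin 3)) : ∃ (l i : Fin 3) (t : ℂ), t ≠ 0 ∧
      (fun k => eval v (frameForm ω c k)) = t • basePoint (frameParam a ω c) ω l i := by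
  obtain ⟨k, hk⟩ := exists_conic_of_base hω ha0 hc hg c
  rw [eval_conic_eq_zero_iff hω ha1] at hk
  obtain ⟨u, -, hu⟩ := exists_cubic_frame hω (mul_pow_sub_one_ne_zero hω ha1) c
  refine exists_eq_basePoint hω (frameParam_ne hω ha0 ha1 ha8 c).1 (fun h => hv ?_) ?_ hk
  · exact eq_zero_of_frameForm hω c (congrFun h)
  · rw [hu, hc, mul_zero]

lemma conic_basePoint_iff (hω : IsPrimitiveRoot ω 3) (ha0 : a ≠ 0) (ha1 : a ^ 3 ≠ 1)
    (ha8 : a ^ 3 ≠ -8) {v : Fin 3 → ℂ} {c : Option (Fin 3)} {l i : Fin 3} {t : ℂ} (ht : t ≠ 0)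
    (h : (fun k => eval v (frameForm ω c k)) = t • basePoint (frameParam a ω c) ω l i)
    (k : Fin 3) : eval v (chileanConic a ω (conicIdx c k)) = 0 ↔ k ≠ l := by
  have e : ∀ k, eval v (frameForm ω c k) =
      (t • basePoint (frameParam a ω c) ω l i) k := congrFun h
  rw [eval_conic_eq_zero_iff hω ha1, e, e, e]
  exact basePoint_mem_conic hω (frameParam_ne hω ha0 ha1 ha8 c).2 ht l i k

/-- A set of conics that omits one conic of each triple has eight elements. -/
lemma ncard_eq_eight {Z : Set ConicIndex} {l : Option (Fin 3) → Fin 3}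
    (h : ∀ c k, conicIdx c k ∈ Z ↔ k ≠ l c) : Z.ncard = 8 := by
  have e : Z = conicEquiv '' {x | x.2 ≠ l x.1} := by
    ext κ
    obtain ⟨⟨c, k⟩, rfl⟩ := conicEquiv.surjective κ
    rw [conicEquiv.injective.mem_set_image]
    exact h c k
  rw [e, Set.ncard_image_of_injective _ conicEquiv.injective, Set.ncard_eq_toFinset_card']
  have e2 : ({x : Option (Fin 3) × Fin 3 | x.2 ≠ l x.1} : Set _).toFinset =
      Finset.univ.filter fun x : Option (Fin 3) × Fin 3 => x.2 ≠ l x.1 := by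
    ext; simp
  rw [e2, Finset.card_filter, Fintype.sum_prod_type]
  have e3 : ∀ m : Fin 3, (∑ k : Fin 3, if k ≠ m then 1 else 0) = 2 := by decide
  simp only [e3]
  simp

/-- A triple with one conic omitted has two elements. -/
lemma ncard_eq_two {Z : Set ConicIndex} {c : Option (Fin 3)} {l : Fin 3}
    (h : ∀ c' k, conicIdx c' k ∈ Z ↔ c' = c ∧ k ≠ l) : Z.ncard = 2 := by
  have e : Z = conicEquiv '' {x | x.1 = c ∧ x.2 ≠ l} := by
    ext κ
    obtain ⟨⟨c, k⟩, rfl⟩ := conicEquiv.surjective κ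
    rw [conicEquiv.injective.mem_set_image]
    exact h c k
  have e2 : {x : Option (Fin 3) × Fin 3 | x.1 = c ∧ x.2 ≠ l} = {(c, l + 1), (c, l + 2)} := by
    ext ⟨c', k⟩
    have hk : k ≠ l ↔ k = l + 1 ∨ k = l + 2 := by clear * -; revert k l; decide
    simp [hk, ← and_or_left]
  rw [e, Set.ncard_image_of_injective _ conicEquiv.injective, e2, Set.ncard_pair]
  simp

lemma ncard_conics_base (hω : IsPrimitiveRoot ω 3) (ha0 : a ≠ 0) (ha1 : a ^ 3 ≠ 1)
    (ha8 : a ^ 3 ≠ -8) {v : Fin 3 → ℂ} (hv : v ≠ 0) (hc : eval v (cubic a) = 0)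
    (hg : eval v (sextic a) = 0) : {κ | eval v (chileanConic a ω κ) = 0}.ncard = 8 := by
  choose l i t ht h using exists_frame_basePoint hω ha0 ha1 ha8 hv hc hg
  exact ncard_eq_eight (l := l) fun c k => conic_basePoint_iff hω ha0 ha1 ha8 (ht c) (h c) k

lemma frameVertex_ne_zero (hω : IsPrimitiveRoot ω 3) (c : Option (Fin 3)) (k : Fin 3) :
    frameVertex ω c k ≠ 0 := by
  intro h
  have := eval_frameForm_vertex hω c k k
  rw [h, if_pos rfl] at this
  have h0 := eval_smul_frameForm (ω := ω) 0 0 c k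
  rw [zero_smul, zero_mul] at h0
  exact frameNorm_ne_zero c (this.symm.trans h0)

/-- The vertices do not lie on the cubic. -/
lemma eval_cubic_vertex (hω : IsPrimitiveRoot ω 3) (ha0 : a ≠ 0) (ha1 : a ^ 3 ≠ 1)
    (ha8 : a ^ 3 ≠ -8) (c : Option (Fin 3)) (l : Fin 3) :
    eval (frameVertex ω c l) (cubic a) ≠ 0 := by
  obtain ⟨u, hu0, hu⟩ := exists_cubic_frame hω (mul_pow_sub_one_ne_zero hω ha1) c
  intro h
  have e := hu (frameVertex ω c l)
  have h1 : l + 1 ≠ l := by clear * -; revert l; decide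
  have h2 : l + 2 ≠ l := by clear * -; revert l; decide
  rw [h, mul_zero, eval_cubic_shift _ _ l] at e
  simp only [eval_frameForm_vertex hω, if_neg h1, if_neg h2] at e
  simp [(frameParam_ne hω ha0 ha1 ha8 c).1, frameNorm_ne_zero] at e

lemma conic_vertex_iff (hω : IsPrimitiveRoot ω 3) (ha0 : a ≠ 0) (ha1 : a ^ 3 ≠ 1)
    (ha8 : a ^ 3 ≠ -8) (c c' : Option (Fin 3)) (l k : Fin 3) :
    eval (frameVertex ω c l) (chileanConic a ω (conicIdx c' k)) = 0 ↔ c' = c ∧ k ≠ l := by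
  have h1 : l + 1 ≠ l := by clear * -; revert l; decide
  have h2 : l + 2 ≠ l := by clear * -; revert l; decide
  have key : ∀ k, eval (frameVertex ω c l) (chileanConic a ω (conicIdx c k)) = 0 ↔ k ≠ l := by
    intro k
    rw [eval_conic_eq_zero_iff hω ha1]
    simp only [eval_frameForm_vertex hω]
    obtain ⟨s1, s2, s3, s4⟩ := shift_shift l
    have hk : k = l ∨ k = l + 1 ∨ k = l + 2 := by clear * -; revert l k; decide
    rcases hk with rfl | rfl | rfl
    · simp [(frameParam_ne hω ha0 ha1 ha8 c).1, frameNorm_ne_zero, h1]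
    · simp [s1, s2, h1, h2]
    · simp [s3, s4, h1, h2]
  constructor
  · intro h
    have hc := fibre_unique hω ha0 (eval_cubic_vertex hω ha0 ha1 ha8 c l) h ((key (l + 1)).2 h1)
    subst hc
    exact ⟨rfl, (key k).1 h⟩
  · rintro ⟨rfl, h⟩
    exact (key k).2 h

lemma ncard_conics_vertex (hω : IsPrimitiveRoot ω 3) (ha0 : a ≠ 0) (ha1 : a ^ 3 ≠ 1)
    (ha8 : a ^ 3 ≠ -8) (c : Option (Fin 3)) (l : Fin 3) {t : ℂ} (ht : t ≠ 0) :
    {κ | eval (t • frameVertex ω c l) (chileanConic a ω κ) = 0}.ncard = 2 := by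
  refine ncard_eq_two (c := c) (l := l) fun c' k => ?_
  rw [← conic_vertex_iff hω ha0 ha1 ha8, Set.mem_ofPred_eq,
    eval_smul_of_isHomogeneous (chileanConic_isHomogeneous a ω _)]
  simp [ht]

/-- A point lying on two conics of the same triple, but not on the cubic, is a vertex. -/
lemma exists_eq_vertex (hω : IsPrimitiveRoot ω 3) (ha0 : a ≠ 0) (ha1 : a ^ 3 ≠ 1)
    (ha8 : a ^ 3 ≠ -8) {v : Fin 3 → ℂ} (hv : v ≠ 0) (hc : eval v (cubic a) ≠ 0)
    {c : Option (Fin 3)} {k k' : Fin 3} (hk : k ≠ k')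
    (h : eval v (chileanConic a ω (conicIdx c k)) = 0)
    (h' : eval v (chileanConic a ω (conicIdx c k')) = 0) :
    ∃ (l : Fin 3) (t : ℂ), t ≠ 0 ∧ v = t • frameVertex ω c l := by
  obtain ⟨l, hl⟩ : ∃ l : Fin 3, (k = l + 1 ∧ k' = l + 2) ∨ (k = l + 2 ∧ k' = l + 1) := by
    clear * - hk; revert k k'; decide
  have h2 : eval v (chileanConic a ω (conicIdx c (l + 1))) = 0 ∧
      eval v (chileanConic a ω (conicIdx c (l + 2))) = 0 := by
    rcases hl with ⟨rfl, rfl⟩ | ⟨rfl, rfl⟩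
    · exact ⟨h, h'⟩
    · exact ⟨h', h⟩
  obtain ⟨s1, s2, s3, s4⟩ := shift_shift l
  rw [eval_conic_eq_zero_iff hω ha1, eval_conic_eq_zero_iff hω ha1, s1, s2, s3, s4] at h2
  obtain ⟨u, hu0, hu⟩ := exists_cubic_frame hω (mul_pow_sub_one_ne_zero hω ha1) c
  have h3 := eq_zero_of_two_conics (frameParam_ne hω ha0 ha1 ha8 c).1
    (x := fun k => eval v (frameForm ω c k)) (by rw [hu]; exact mul_ne_zero hu0 hc) l h2.1 h2.2
  have e := eq_sum_frameVertex hω c v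
  have hs : ∑ k, (eval v (frameForm ω c k) / frameNorm c) • frameVertex ω c k =
      (eval v (frameForm ω c l) / frameNorm c) • frameVertex ω c l := by
    refine Finset.sum_eq_single_of_mem l (Finset.mem_univ l) fun k _ hkl => ?_
    have : k = l + 1 ∨ k = l + 2 := by clear * - hkl; revert k l; decide
    rcases this with rfl | rfl
    · rw [h3.1]; simp
    · rw [h3.2]; simp
  rw [hs] at e
  refine ⟨l, _, fun h0 => hv ?_, e⟩
  rw [e, h0, zero_smul]

/-- A point on at least two of the conics is a base point or a vertex. -/
lemma base_or_vertex (hω : IsPrimitiveRoot ω 3) (ha0 : a ≠ 0) (ha1 : a ^ 3 ≠ 1)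
    (ha8 : a ^ 3 ≠ -8) {v : Fin 3 → ℂ} (hv : v ≠ 0) :
    (eval v (cubic a) = 0 ∧ eval v (sextic a) = 0) ∨
    (∃ (c : Option (Fin 3)) (l : Fin 3) (t : ℂ), t ≠ 0 ∧ v = t • frameVertex ω c l) ∨
    {κ | eval v (chileanConic a ω κ) = 0}.Subsingleton := by
  by_cases hc : eval v (cubic a) = 0
  · by_cases hg : eval v (sextic a) = 0
    · exact Or.inl ⟨hc, hg⟩
    · refine Or.inr (Or.inr fun κ h => (hg ?_).elim)
      obtain ⟨⟨c, k⟩, rfl⟩ := conicEquiv.surjective κ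
      exact eval_sextic_of_conic hω ha0 ha1 ha8 hc h
  · refine Or.inr (or_iff_not_imp_right.2 fun hs => ?_)
    rw [Set.not_subsingleton_iff] at hs
    obtain ⟨κ, h, κ', h', hne⟩ := hs
    obtain ⟨⟨c, k⟩, rfl⟩ := conicEquiv.surjective κ
    obtain ⟨⟨c', k'⟩, rfl⟩ := conicEquiv.surjective κ'
    have e : c = c' := fibre_unique hω ha0 hc h h'
    subst e
    exact ⟨c, exists_eq_vertex hω ha0 ha1 ha8 hv hc (k := k) (k' := k')
      (fun e => hne (by rw [e])) h h'⟩

end Incidence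

/-! ### The conics are pairwise distinct -/

section Arrangement

variable {a ω : ℂ}

lemma irreducible_chileanConic (hω : IsPrimitiveRoot ω 3) (ha0 : a ≠ 0) (ha1 : a ^ 3 ≠ 1)
    (ha8 : a ^ 3 ≠ -8) (κ : ConicIndex) : Irreducible (chileanConic a ω κ) :=
  (isSmooth_chileanConic hω ha0 ha1 ha8 κ).irreducible (chileanConic_isHomogeneous a ω κ)

/-- Distinct conics are distinguished by the vertices of the triangle of one of them. -/
lemma eq_of_dvd_conic (hω : IsPrimitiveRoot ω 3) (ha0 : a ≠ 0) (ha1 : a ^ 3 ≠ 1)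
    (ha8 : a ^ 3 ≠ -8) {κ κ' : ConicIndex} (h : chileanConic a ω κ ∣ chileanConic a ω κ') :
    κ = κ' := by
  obtain ⟨⟨c, k⟩, rfl⟩ := conicEquiv.surjective κ
  obtain ⟨⟨c', k'⟩, rfl⟩ := conicEquiv.surjective κ'
  obtain ⟨q, hq⟩ := h
  have key : ∀ l, k ≠ l → c' = c ∧ k' ≠ l := by
    intro l hl
    rw [← conic_vertex_iff hω ha0 ha1 ha8]
    have h0 := (conic_vertex_iff hω ha0 ha1 ha8 c c l k).2 ⟨rfl, hl⟩
    have e : chileanConic a ω (conicIdx c' k') = chileanConic a ω (conicIdx c k) * q := hq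
    rw [e, map_mul, h0, zero_mul]
  have h1 : k ≠ k + 1 := by clear * -; revert k; decide
  have h2 : k = k' := by
    by_contra h
    exact (key k' h).2 rfl
  rw [(key (k + 1) h1).1, h2]

lemma chilean_ne_zero (hω : IsPrimitiveRoot ω 3) (ha0 : a ≠ 0) (ha1 : a ^ 3 ≠ 1)
    (ha8 : a ^ 3 ≠ -8) : chilean a ω ≠ 0 :=
  Finset.prod_ne_zero_iff.2 fun κ _ => (irreducible_chileanConic hω ha0 ha1 ha8 κ).ne_zero

/-- The product of the conics different from a given one. -/
def cofactor (a ω : ℂ) (κ : ConicIndex) : S := ∏ κ' ∈ Finset.univ.erase κ, chileanConic a ω κ'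

lemma chilean_eq_mul_cofactor (a ω : ℂ) (κ : ConicIndex) :
    chilean a ω = chileanConic a ω κ * cofactor a ω κ :=
  (Finset.mul_prod_erase _ _ (Finset.mem_univ κ)).symm

/-- The partial derivatives of the defining polynomial have no common factor. -/
lemma isUnit_of_dvd_pderiv (hω : IsPrimitiveRoot ω 3) (ha0 : a ≠ 0) (ha1 : a ^ 3 ≠ 1)
    (ha8 : a ^ 3 ≠ -8) (d : S) (hd : ∀ i, d ∣ pderiv i (chilean a ω)) : IsUnit d := by
  have hF := chilean_ne_zero hω ha0 ha1 ha8
  have hE := (chilean_isHomogeneous a ω).sum_X_mul_pderiv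
  rw [nsmul_eq_mul] at hE
  have hdF : d ∣ chilean a ω := by
    have h24 : IsUnit ((24 : ℕ) : S) := by
      rw [← map_natCast (C : ℂ →+* S)]
      exact (IsUnit.mk0 _ (by norm_num)).map C
    rw [← h24.dvd_mul_left, ← hE]
    exact Finset.dvd_sum fun i _ => (hd i).mul_left _
  have hd0 : d ≠ 0 := ne_zero_of_dvd_ne_zero hF hdF
  by_contra hu
  obtain ⟨q, hq, hqd⟩ := WfDvdMonoid.exists_irreducible_factor hu hd0
  obtain ⟨κ, -, hκ⟩ := (hq.prime.dvd_finsetProd_iff _).1 (hqd.trans hdF)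
  have hQ := irreducible_chileanConic hω ha0 ha1 ha8 κ
  have hass : Associated q (chileanConic a ω κ) := hq.associated_of_dvd hQ hκ
  -- a conic dividing its own partial derivatives is singular wherever it vanishes
  have hQd : ∀ i, chileanConic a ω κ ∣ pderiv i (chileanConic a ω κ) := by
    intro i
    have h1 := hass.symm.dvd.trans (hqd.trans (hd i))
    rw [chilean_eq_mul_cofactor a ω κ, Derivation.leibniz, smul_eq_mul, smul_eq_mul,
      dvd_add_right (dvd_mul_right _ _)] at h1
    refine (hQ.prime.dvd_or_dvd h1).resolve_left fun h2 => ?_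
    obtain ⟨κ', hκ', h3⟩ := (hQ.prime.dvd_finsetProd_iff _).1 h2
    exact (Finset.mem_erase.1 hκ').1 (eq_of_dvd_conic hω ha0 ha1 ha8 h3).symm
  obtain ⟨⟨c, k⟩, rfl⟩ := conicEquiv.surjective κ
  have h1 : k ≠ k + 1 := by clear * -; revert k; decide
  obtain ⟨i, hi⟩ := isSmooth_chileanConic hω ha0 ha1 ha8 (conicIdx c k)
    (frameVertex ω c (k + 1)) (frameVertex_ne_zero hω _ _)
  apply hi
  obtain ⟨r, hr⟩ := hQd i
  have hr' : pderiv i (chileanConic a ω (conicIdx c k)) = chileanConic a ω (conicIdx c k) * r := hr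
  rw [hr', map_mul, (conic_vertex_iff hω ha0 ha1 ha8 c c (k + 1) k).2 ⟨rfl, h1⟩, zero_mul]

end Arrangement

/-! ### Enumeration of the singular points -/

section Points

variable {a ω : ℂ}

lemma eq_mk_iff {p : Plane} {v : Fin 3 → ℂ} (hv : v ≠ 0) :
    p = Projectivization.mk ℂ v hv ↔ ∃ t : ℂ, t ≠ 0 ∧ p.rep = t • v := by
  constructor
  · rintro rfl
    obtain ⟨t, ht⟩ := Projectivization.exists_smul_eq_mk_rep ℂ v hv
    exact ⟨t, t.ne_zero, ht.symm⟩
  · rintro ⟨t, -, h⟩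
    rw [← p.mk_rep, Projectivization.mk_eq_mk_iff']
    exact ⟨t, h.symm⟩

/-- The vector with coordinates `basePoint` in one of the four frames. -/
def framePoint (a ω : ℂ) (c : Option (Fin 3)) (x : Fin 3 × Fin 3) : Fin 3 → ℂ :=
  ∑ k, basePoint (frameParam a ω c) ω x.1 x.2 k • frameVertex ω c k

lemma eval_framePoint (hω : IsPrimitiveRoot ω 3) (c : Option (Fin 3)) (x : Fin 3 × Fin 3) :
    (fun k => eval (framePoint a ω c x) (frameForm ω c k)) =
      frameNorm c • basePoint (frameParam a ω c) ω x.1 x.2 := by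
  funext k
  rw [framePoint, Fin.sum_univ_three, eval_add_frameForm, eval_add_frameForm, eval_smul_frameForm,
    eval_smul_frameForm, eval_smul_frameForm, eval_frameForm_vertex hω, eval_frameForm_vertex hω,
    eval_frameForm_vertex hω, Pi.smul_apply, smul_eq_mul]
  fin_cases k <;> simp [mul_comm]

lemma eq_framePoint (hω : IsPrimitiveRoot ω 3) {c : Option (Fin 3)} {l i : Fin 3} {t : ℂ}
    {v : Fin 3 → ℂ}
    (h : (fun k => eval v (frameForm ω c k)) = t • basePoint (frameParam a ω c) ω l i) :
    v = (t / frameNorm c) • framePoint a ω c (l, i) := by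
  have e : ∀ k, eval v (frameForm ω c k) = t * basePoint (frameParam a ω c) ω l i k := congrFun h
  rw [eq_sum_frameVertex hω c v, framePoint, Finset.smul_sum]
  refine Finset.sum_congr rfl fun k _ => ?_
  rw [e, smul_smul]
  congr 1
  ring

lemma basePoint_injective {b : ℂ} (hω : IsPrimitiveRoot ω 3) (hb0 : b ≠ 0) (hb : b ^ 3 ≠ 1)
    {x y : Fin 3 × Fin 3} {t : ℂ} (ht : t ≠ 0)
    (h : basePoint b ω x.1 x.2 = t • basePoint b ω y.1 y.2) : x = y := by
  obtain ⟨l, i⟩ := x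
  obtain ⟨l', i'⟩ := y
  simp only at h
  have h1 := basePoint_mem_conic hω hb one_ne_zero l i l'
  rw [one_smul, h, basePoint_mem_conic hω hb ht l' i' l'] at h1
  have h2 : l = l' := by
    by_contra hne
    exact h1.2 (Ne.symm hne) rfl
  subst h2
  have h3 := congrFun h l
  have h4 := congrFun h (l + 1)
  rw [Pi.smul_apply, smul_eq_mul, basePoint_self, basePoint_self] at h3
  have h5 : t = 1 := mul_right_cancel₀ hb0 (by rw [one_mul, ← h3])
  rw [h5, one_smul, basePoint_add_one, basePoint_add_one] at h4
  rw [Fin.ext (hω.pow_inj i.2 i'.2 h4)]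

lemma framePoint_ne_zero (hω : IsPrimitiveRoot ω 3) (ha0 : a ≠ 0) (ha1 : a ^ 3 ≠ 1)
    (ha8 : a ^ 3 ≠ -8) (c : Option (Fin 3)) (x : Fin 3 × Fin 3) : framePoint a ω c x ≠ 0 := by
  intro h
  have e := congrFun (eval_framePoint (a := a) hω c x) x.1
  have h0 := eval_smul_frameForm (ω := ω) 0 0 c x.1
  rw [zero_smul, zero_mul] at h0
  simp only [h, h0, Pi.smul_apply, basePoint_self, smul_eq_mul] at e
  exact mul_ne_zero (frameNorm_ne_zero c) (frameParam_ne hω ha0 ha1 ha8 c).1 e.symm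

lemma framePoint_injective (hω : IsPrimitiveRoot ω 3) (ha0 : a ≠ 0) (ha1 : a ^ 3 ≠ 1)
    (ha8 : a ^ 3 ≠ -8) (c : Option (Fin 3)) : Function.Injective fun x =>
      Projectivization.mk ℂ (framePoint a ω c x) (framePoint_ne_zero hω ha0 ha1 ha8 c x) := by
  intro x y h
  obtain ⟨t, ht⟩ := (Projectivization.mk_eq_mk_iff _ _ _ _ _).1 h
  have hb := frameParam_ne hω ha0 ha1 ha8 c
  refine basePoint_injective (b := frameParam a ω c) hω hb.1 hb.2 t.ne_zero ?_
  funext k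
  have e := congrFun (eval_framePoint (a := a) hω c x) k
  have e' := congrFun (eval_framePoint (a := a) hω c y) k
  have ht' : framePoint a ω c x = (t : ℂ) • framePoint a ω c y := ht.symm
  rw [ht', eval_smul_frameForm, e'] at e
  simp only [Pi.smul_apply, smul_eq_mul] at e ⊢
  apply mul_left_cancel₀ (frameNorm_ne_zero c)
  linear_combination -e

lemma eval_cubic_framePoint (hω : IsPrimitiveRoot ω 3) (ha1 : a ^ 3 ≠ 1) (c : Option (Fin 3))
    (x : Fin 3 × Fin 3) : eval (framePoint a ω c x) (cubic a) = 0 := by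
  obtain ⟨u, hu0, hu⟩ := exists_cubic_frame hω (mul_pow_sub_one_ne_zero hω ha1) c
  have e := hu (framePoint a ω c x)
  rw [eval_framePoint hω, (eval_basePoint hω _ _ _).1] at e
  exact (mul_eq_zero.1 e.symm).resolve_left hu0

lemma eval_sextic_framePoint (hω : IsPrimitiveRoot ω 3) (ha0 : a ≠ 0) (ha1 : a ^ 3 ≠ 1)
    (ha8 : a ^ 3 ≠ -8) (c : Option (Fin 3)) (x : Fin 3 × Fin 3) :
    eval (framePoint a ω c x) (sextic a) = 0 := by
  have h1 : x.1 + 1 ≠ x.1 := by generalize x.1 = l; revert l; decide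
  exact eval_sextic_of_conic hω ha0 ha1 ha8 (eval_cubic_framePoint hω ha1 c x)
    ((conic_basePoint_iff hω ha0 ha1 ha8 (frameNorm_ne_zero c) (eval_framePoint hω c x)
      (x.1 + 1)).2 h1)

lemma passes_mk_iff {F : S} {n : ℕ} (hF : F.IsHomogeneous n) {v : Fin 3 → ℂ} (hv : v ≠ 0) :
    Passes F (Projectivization.mk ℂ v hv) ↔ eval v F = 0 := by
  obtain ⟨t, ht⟩ := Projectivization.exists_smul_eq_mk_rep ℂ v hv
  have ht' : (Projectivization.mk ℂ v hv).rep = (t : ℂ) • v := ht.symm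
  rw [Passes, ht', eval_smul_of_isHomogeneous hF]
  simp

lemma chileanMult_eq_eight_of_base (hω : IsPrimitiveRoot ω 3) (ha0 : a ≠ 0) (ha1 : a ^ 3 ≠ 1)
    (ha8 : a ^ 3 ≠ -8) {p : Plane} (hc : Passes (cubic a) p) (hg : Passes (sextic a) p) :
    chileanMult a ω p = 8 :=
  ncard_conics_base hω ha0 ha1 ha8 p.rep_nonzero hc hg

lemma chileanMult_vertex (hω : IsPrimitiveRoot ω 3) (ha0 : a ≠ 0) (ha1 : a ^ 3 ≠ 1)
    (ha8 : a ^ 3 ≠ -8) {p : Plane} {c : Option (Fin 3)} {l : Fin 3}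
    (hp : p = Projectivization.mk ℂ _ (frameVertex_ne_zero hω c l)) : chileanMult a ω p = 2 := by
  obtain ⟨t, ht, h⟩ := (eq_mk_iff _).1 hp
  have := ncard_conics_vertex hω ha0 ha1 ha8 c l ht
  rwa [← h] at this

lemma base_or_vertex_or (hω : IsPrimitiveRoot ω 3) (ha0 : a ≠ 0) (ha1 : a ^ 3 ≠ 1)
    (ha8 : a ^ 3 ≠ -8) (p : Plane) : (Passes (cubic a) p ∧ Passes (sextic a) p) ∨
    (∃ c l, p = Projectivization.mk ℂ _ (frameVertex_ne_zero hω c l)) ∨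
    {κ | Passes (chileanConic a ω κ) p}.Subsingleton := by
  rcases base_or_vertex hω ha0 ha1 ha8 p.rep_nonzero with h | ⟨c, l, h⟩ | h
  · exact Or.inl h
  · exact Or.inr (Or.inl ⟨c, l, (eq_mk_iff _).2 h⟩)
  · exact Or.inr (Or.inr h)

lemma chileanMult_eq_eight_iff (hω : IsPrimitiveRoot ω 3) (ha0 : a ≠ 0) (ha1 : a ^ 3 ≠ 1)
    (ha8 : a ^ 3 ≠ -8) (p : Plane) :
    chileanMult a ω p = 8 ↔ Passes (cubic a) p ∧ Passes (sextic a) p := by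
  refine ⟨fun h => ?_, fun h => chileanMult_eq_eight_of_base hω ha0 ha1 ha8 h.1 h.2⟩
  rcases base_or_vertex_or hω ha0 ha1 ha8 p with h' | ⟨c, l, h'⟩ | h'
  · exact h'
  · have := chileanMult_vertex hω ha0 ha1 ha8 h'
    omega
  · have := Set.ncard_le_one_iff_subsingleton.2 h'
    unfold chileanMult at h
    omega

lemma chileanMult_eq_two_iff (hω : IsPrimitiveRoot ω 3) (ha0 : a ≠ 0) (ha1 : a ^ 3 ≠ 1)
    (ha8 : a ^ 3 ≠ -8) (p : Plane) : chileanMult a ω p = 2 ↔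
      ∃ c l, p = Projectivization.mk ℂ _ (frameVertex_ne_zero hω c l) := by
  refine ⟨fun h => ?_, fun ⟨c, l, h⟩ => chileanMult_vertex hω ha0 ha1 ha8 h⟩
  rcases base_or_vertex_or hω ha0 ha1 ha8 p with h' | h' | h'
  · have := chileanMult_eq_eight_of_base hω ha0 ha1 ha8 h'.1 h'.2
    omega
  · exact h'
  · have := Set.ncard_le_one_iff_subsingleton.2 h'
    unfold chileanMult at h
    omega

/-- The points of multiplicity eight, enumerated in any of the four frames. -/
lemma exists_eq_mk_framePoint (hω : IsPrimitiveRoot ω 3) (ha0 : a ≠ 0) (ha1 : a ^ 3 ≠ 1)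
    (ha8 : a ^ 3 ≠ -8) (c : Option (Fin 3)) {p : Plane} (hp : chileanMult a ω p = 8) :
    ∃ x, Projectivization.mk ℂ _ (framePoint_ne_zero hω ha0 ha1 ha8 c x) = p := by
  obtain ⟨h1, h2⟩ := (chileanMult_eq_eight_iff hω ha0 ha1 ha8 p).1 hp
  obtain ⟨l, i, t, ht, h⟩ := exists_frame_basePoint hω ha0 ha1 ha8 p.rep_nonzero h1 h2 c
  exact ⟨(l, i), ((eq_mk_iff _).2 ⟨_, div_ne_zero ht (frameNorm_ne_zero c),
    eq_framePoint hω h⟩).symm⟩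

lemma chileanMult_mk_framePoint (hω : IsPrimitiveRoot ω 3) (ha0 : a ≠ 0) (ha1 : a ^ 3 ≠ 1)
    (ha8 : a ^ 3 ≠ -8) (c : Option (Fin 3)) (x : Fin 3 × Fin 3) : chileanMult a ω
      (Projectivization.mk ℂ _ (framePoint_ne_zero hω ha0 ha1 ha8 c x)) = 8 :=
  chileanMult_eq_eight_of_base hω ha0 ha1 ha8
    ((passes_mk_iff (cubic_isHomogeneous a) _).2 (eval_cubic_framePoint hω ha1 c x))
    ((passes_mk_iff (sextic_isHomogeneous a) _).2 (eval_sextic_framePoint hω ha0 ha1 ha8 c x))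

theorem ncard_mult_eight (hω : IsPrimitiveRoot ω 3) (ha0 : a ≠ 0) (ha1 : a ^ 3 ≠ 1)
    (ha8 : a ^ 3 ≠ -8) : {p | chileanMult a ω p = 8}.ncard = 9 := by
  have e : {p | chileanMult a ω p = 8} = (fun x => Projectivization.mk ℂ _
      (framePoint_ne_zero hω ha0 ha1 ha8 none x)) '' Set.univ := by
    ext p
    constructor
    · intro h
      obtain ⟨x, hx⟩ := exists_eq_mk_framePoint hω ha0 ha1 ha8 none h
      exact ⟨x, Set.mem_univ x, hx⟩
    · rintro ⟨x, -, rfl⟩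
      exact chileanMult_mk_framePoint hω ha0 ha1 ha8 none x
  rw [e, Set.ncard_image_of_injective _ (framePoint_injective hω ha0 ha1 ha8 none),
    Set.ncard_univ]
  simp

theorem ncard_mult_eight_conic (hω : IsPrimitiveRoot ω 3) (ha0 : a ≠ 0) (ha1 : a ^ 3 ≠ 1)
    (ha8 : a ^ 3 ≠ -8) (κ : ConicIndex) :
    {p | chileanMult a ω p = 8 ∧ Passes (chileanConic a ω κ) p}.ncard = 6 := by
  obtain ⟨⟨c, k⟩, rfl⟩ := conicEquiv.surjective κ
  have hk : ∀ x, Passes (chileanConic a ω (conicIdx c k)) (Projectivization.mk ℂ _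
      (framePoint_ne_zero hω ha0 ha1 ha8 c x)) ↔ k ≠ x.1 := by
    intro x
    rw [passes_mk_iff (chileanConic_isHomogeneous a ω _)]
    exact conic_basePoint_iff hω ha0 ha1 ha8 (frameNorm_ne_zero c) (eval_framePoint hω c x) k
  have e : {p | chileanMult a ω p = 8 ∧ Passes (chileanConic a ω (conicIdx c k)) p} =
      (fun x => Projectivization.mk ℂ _ (framePoint_ne_zero hω ha0 ha1 ha8 c x)) ''
        {x | k ≠ x.1} := by
    ext p
    constructor
    · rintro ⟨h, h'⟩
      obtain ⟨x, rfl⟩ := exists_eq_mk_framePoint hω ha0 ha1 ha8 c h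
      exact ⟨x, (hk x).1 h', rfl⟩
    · rintro ⟨x, hx, rfl⟩
      exact ⟨chileanMult_mk_framePoint hω ha0 ha1 ha8 c x, (hk x).2 hx⟩
  refine (congrArg Set.ncard e).trans ?_
  rw [Set.ncard_image_of_injective _ (framePoint_injective hω ha0 ha1 ha8 c)]
  have e2 : ({x | k ≠ x.1} : Set (Fin 3 × Fin 3)) =
      ((Finset.univ.erase k ×ˢ Finset.univ : Finset (Fin 3 × Fin 3)) : Set _) := by
    ext x
    simp [eq_comm]
  rw [e2, Set.ncard_coe_finset]
  simp

lemma frameVertex_injective (hω : IsPrimitiveRoot ω 3) (ha0 : a ≠ 0) (ha1 : a ^ 3 ≠ 1)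
    (ha8 : a ^ 3 ≠ -8) : Function.Injective fun x : Option (Fin 3) × Fin 3 =>
      Projectivization.mk ℂ _ (frameVertex_ne_zero hω x.1 x.2) := by
  rintro ⟨c, l⟩ ⟨c', l'⟩ h
  have key : ∀ k, k ≠ l → c = c' ∧ k ≠ l' := by
    intro k hk
    rw [← conic_vertex_iff hω ha0 ha1 ha8 c' c l' k,
      ← passes_mk_iff (chileanConic_isHomogeneous a ω _) (frameVertex_ne_zero hω c' l')]
    simp only at h
    rw [← h, passes_mk_iff (chileanConic_isHomogeneous a ω _),
      conic_vertex_iff hω ha0 ha1 ha8 c c l k]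
    exact ⟨rfl, hk⟩
  have h1 : l + 1 ≠ l := by clear * -; revert l; decide
  have h2 : l = l' := by
    by_contra hne
    exact (key l' (Ne.symm hne)).2 rfl
  rw [(key _ h1).1, h2]

theorem ncard_mult_two (hω : IsPrimitiveRoot ω 3) (ha0 : a ≠ 0) (ha1 : a ^ 3 ≠ 1)
    (ha8 : a ^ 3 ≠ -8) : {p | chileanMult a ω p = 2}.ncard = 12 := by
  have e : {p | chileanMult a ω p = 2} = (fun x : Option (Fin 3) × Fin 3 =>
      Projectivization.mk ℂ _ (frameVertex_ne_zero hω x.1 x.2)) '' Set.univ := by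
    ext p
    refine (chileanMult_eq_two_iff hω ha0 ha1 ha8 p).trans ?_
    constructor
    · rintro ⟨c, l, rfl⟩
      exact ⟨(c, l), Set.mem_univ _, rfl⟩
    · rintro ⟨x, -, rfl⟩
      exact ⟨x.1, x.2, rfl⟩
  rw [e, Set.ncard_image_of_injective _ (frameVertex_injective hω ha0 ha1 ha8), Set.ncard_univ]
  simp

theorem singularPoints_chilean (hω : IsPrimitiveRoot ω 3) (ha0 : a ≠ 0) (ha1 : a ^ 3 ≠ 1)
    (ha8 : a ^ 3 ≠ -8) :
    singularPoints (chilean a ω) = {p | chileanMult a ω p = 8 ∨ chileanMult a ω p = 2} := by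
  ext p
  have hsing : ∀ κ κ', κ ≠ κ' → Passes (chileanConic a ω κ) p → Passes (chileanConic a ω κ') p →
      p ∈ singularPoints (chilean a ω) := by
    intro κ κ' hne h h'
    have hco : eval p.rep (cofactor a ω κ) = 0 := by
      rw [cofactor, map_prod]
      exact Finset.prod_eq_zero (Finset.mem_erase.2 ⟨hne.symm, Finset.mem_univ _⟩) h'
    have h0 : eval p.rep (chileanConic a ω κ) = 0 := h
    constructor
    · rw [Passes, chilean_eq_mul_cofactor a ω κ, map_mul, h0, zero_mul]
    · intro i
      rw [Passes, chilean_eq_mul_cofactor a ω κ, Derivation.leibniz]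
      simp [h0, hco]
  constructor
  · rintro ⟨h, hd⟩
    rcases base_or_vertex_or hω ha0 ha1 ha8 p with h' | h' | h'
    · exact Or.inl ((chileanMult_eq_eight_iff hω ha0 ha1 ha8 p).2 h')
    · exact Or.inr ((chileanMult_eq_two_iff hω ha0 ha1 ha8 p).2 h')
    · exfalso
      rw [Passes, chilean, map_prod, Finset.prod_eq_zero_iff] at h
      obtain ⟨κ, -, hκ⟩ := h
      obtain ⟨i, hi⟩ := isSmooth_chileanConic hω ha0 ha1 ha8 κ p.rep p.rep_nonzero
      have hi' := hd i
      rw [Passes, chilean_eq_mul_cofactor a ω κ, Derivation.leibniz] at hi'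
      simp only [map_add, map_mul, smul_eq_mul, hκ, zero_mul, zero_add, mul_eq_zero, hi,
        or_false] at hi'
      rw [cofactor, map_prod, Finset.prod_eq_zero_iff] at hi'
      obtain ⟨κ', hκ', h0⟩ := hi'
      exact (Finset.mem_erase.1 hκ').1 (h' h0 hκ)
  · intro h
    have h2 : 1 < {κ | Passes (chileanConic a ω κ) p}.ncard := by
      rcases h with h | h <;>
      · unfold chileanMult at h
        omega
    obtain ⟨κ, h, κ', h', hne⟩ := (Set.one_lt_ncard_iff_nontrivial).1 h2
    exact hsing κ κ' hne h h'

end Points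

/-! ### The nodes -/

section Nodes

variable {a ω : ℂ}

/-- If two vectors orthogonal to `n` are linearly independent, then so are their projections from
a coordinate axis on which `n` does not vanish. -/
lemma minor_ne_zero {i : Fin 3} {n g h : Fin 3 → ℂ} (hn : n i = 1) (hg : ∑ j, n j * g j = 0)
    (hh : ∑ j, n j * h j = 0) {w w' : Fin 3 → ℂ}
    (hne : (∑ j, w j * g j) * (∑ j, w' j * h j) - (∑ j, w' j * g j) * (∑ j, w j * h j) ≠ 0) :
    g (i.succAbove 0) * h (i.succAbove 1) - g (i.succAbove 1) * h (i.succAbove 0) ≠ 0 := by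
  intro m
  apply hne
  -- the equations for `n` express the components with index `i` by the two others
  rw [Fin.sum_univ_three] at hg hh
  simp only [Fin.sum_univ_three]
  fin_cases i
  · have hn' : n 0 = 1 := hn
    have m' : g 1 * h 2 - g 2 * h 1 = 0 := m
    have g0 : g 0 = -(n 1 * g 1 + n 2 * g 2) := by rw [hn'] at hg; linear_combination hg
    have h0 : h 0 = -(n 1 * h 1 + n 2 * h 2) := by rw [hn'] at hh; linear_combination hh
    rw [g0, h0]
    linear_combination ((w 1 - w 0 * n 1) * (w' 2 - w' 0 * n 2) -
      (w 2 - w 0 * n 2) * (w' 1 - w' 0 * n 1)) * m'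
  · have hn' : n 1 = 1 := hn
    have m' : g 0 * h 2 - g 2 * h 0 = 0 := m
    have g0 : g 1 = -(n 0 * g 0 + n 2 * g 2) := by rw [hn'] at hg; linear_combination hg
    have h0 : h 1 = -(n 0 * h 0 + n 2 * h 2) := by rw [hn'] at hh; linear_combination hh
    rw [g0, h0]
    linear_combination ((w 0 - w 1 * n 0) * (w' 2 - w' 1 * n 2) -
      (w 2 - w 1 * n 2) * (w' 0 - w' 1 * n 0)) * m'
  · have hn' : n 2 = 1 := hn
    have m' : g 0 * h 1 - g 1 * h 0 = 0 := m
    have g0 : g 2 = -(n 0 * g 0 + n 1 * g 1) := by rw [hn'] at hg; linear_combination hg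
    have h0 : h 2 = -(n 0 * h 0 + n 1 * h 1) := by rw [hn'] at hh; linear_combination hh
    rw [g0, h0]
    linear_combination ((w 0 - w 2 * n 0) * (w' 1 - w' 2 * n 1) -
      (w 1 - w 2 * n 1) * (w' 0 - w' 2 * n 0)) * m'

lemma sum_pderiv_frameForm (n w : Fin 3 → ℂ) (c : Option (Fin 3)) (k : Fin 3) :
    ∑ j, w j * eval n (pderiv j (frameForm ω c k)) = eval w (frameForm ω c k) := by
  cases c with
  | none =>
    simp only [frameForm, pderiv_X_eq]
    simp
  | some m =>
    simp only [frameForm, Fin.sum_univ_three, map_add, Derivation.leibniz, pderiv_C, pderiv_X_eq]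
    simp
    ring

/-- The directional derivatives of a conic, in the coordinates of its triple. -/
lemma sum_pderiv_conic (hω : IsPrimitiveRoot ω 3) (ha1 : a ^ 3 ≠ 1) (n w : Fin 3 → ℂ)
    (c : Option (Fin 3)) (k : Fin 3) :
    ∑ j, w j * eval n (pderiv j (chileanConic a ω (conicIdx c k))) = frameScale a ω c *
      (eval w (frameForm ω c (k + 1)) * eval n (frameForm ω c (k + 2)) +
        eval n (frameForm ω c (k + 1)) * eval w (frameForm ω c (k + 2)) -
        2 * frameParam a ω c * eval n (frameForm ω c k) * eval w (frameForm ω c k)) := by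
  rw [conic_eq_frame hω (mul_pow_sub_one_ne_zero hω ha1)]
  rw [← sum_pderiv_frameForm n w c (k + 1), ← sum_pderiv_frameForm n w c (k + 2),
    ← sum_pderiv_frameForm n w c k]
  simp only [Fin.sum_univ_three, Derivation.leibniz, Derivation.leibniz_pow, map_sub, pderiv_C,
    smul_eq_mul, nsmul_eq_mul, map_add, map_mul, eval_C, map_pow, mul_zero, add_zero]
  simp
  ring

/-- At a point where two factors vanish to first order with independent gradients, the two partial
derivatives in the chart generate the maximal ideal. -/
lemma span_pderiv_mul_eq_maximalIdeal {p : Plane} {q q' h : S}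
    (hq : eval (normalized p) q = 0) (hq' : eval (normalized p) q' = 0)
    (hh : eval (normalized p) h ≠ 0)
    (hm : eval (normalized p) (pderiv ((chartIndex p.rep).succAbove 0) q) *
      eval (normalized p) (pderiv ((chartIndex p.rep).succAbove 1) q') -
      eval (normalized p) (pderiv ((chartIndex p.rep).succAbove 1) q) *
      eval (normalized p) (pderiv ((chartIndex p.rep).succAbove 0) q') ≠ 0) :
    Ideal.span {germAt p (pderiv ((chartIndex p.rep).succAbove 0) (q * (q' * h))),
      germAt p (pderiv ((chartIndex p.rep).succAbove 1) (q * (q' * h)))} =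
      IsLocalRing.maximalIdeal LocalRing := by
  apply span_germAt_eq_maximalIdeal
  · simp [Derivation.leibniz, hq, hq']
  · simp [Derivation.leibniz, hq, hq']
  · generalize (chartIndex p.rep).succAbove 0 = i at *
    generalize (chartIndex p.rep).succAbove 1 = j at *
    have e : ∀ i j, eval (normalized p) (pderiv j (pderiv i (q * (q' * h)))) =
        (eval (normalized p) (pderiv i q) * eval (normalized p) (pderiv j q') +
          eval (normalized p) (pderiv j q) * eval (normalized p) (pderiv i q')) *
          eval (normalized p) h := by
      intro i j
      simp only [Derivation.leibniz, smul_eq_mul, map_add, map_mul, hq, hq']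
      ring
    rw [(eval (normalized p)).map_sub, (eval (normalized p)).map_mul, (eval (normalized p)).map_mul,
      e, e, e, e]
    -- the Hessian determinant is minus the square of the determinant of the two gradients
    intro h0
    apply mul_ne_zero (pow_ne_zero 2 hm) (pow_ne_zero 2 hh)
    linear_combination -h0

/-- The vertices of the coordinate triangles are nodes of the arrangement. -/
theorem colength_vertex (hω : IsPrimitiveRoot ω 3) (ha0 : a ≠ 0) (ha1 : a ^ 3 ≠ 1)
    (ha8 : a ^ 3 ≠ -8) {p : Plane} (hp : chileanMult a ω p = 2) :
    milnorNumber (chilean a ω) p = 1 ∧ tjurinaNumber (chilean a ω) p = 1 := by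
  obtain ⟨c, l, hcl⟩ := (chileanMult_eq_two_iff hω ha0 ha1 ha8 p).1 hp
  obtain ⟨t, ht, hr⟩ := (eq_mk_iff _).1 hcl
  obtain ⟨r, hr0, hn, hn1⟩ := exists_unit_smul_normalized p
  have hv : normalized p = (r * t) • frameVertex ω c l := by rw [hn, hr, smul_smul]
  have hrt : r * t ≠ 0 := mul_ne_zero hr0 ht
  obtain ⟨s1, s2, s3, s4⟩ := shift_shift l
  have h1 : l + 1 ≠ l := by clear * -; revert l; decide
  have h2 : l + 2 ≠ l := by clear * -; revert l; decide
  have h3 : l + 1 ≠ l + 2 := by clear * -; revert l; decide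
  have hL : ∀ k, eval (normalized p) (frameForm ω c k) =
      if k = l then r * t * frameNorm c else 0 := by
    intro k
    rw [hv, eval_smul_frameForm, eval_frameForm_vertex hω]
    split_ifs <;> simp
  have hz : ∀ c' k, eval (normalized p) (chileanConic a ω (conicIdx c' k)) = 0 ↔
      c' = c ∧ k ≠ l := by
    intro c' k
    rw [hv, eval_smul_of_isHomogeneous (chileanConic_isHomogeneous a ω _),
      ← conic_vertex_iff hω ha0 ha1 ha8]
    simp [hrt]
  have hne : conicIdx c (l + 2) ≠ conicIdx c (l + 1) := by
    intro h
    have := conicEquiv.injective (show conicEquiv (c, l + 2) = conicEquiv (c, l + 1) from h)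
    exact h3 (Prod.ext_iff.1 this).2.symm
  obtain ⟨h, hF, hh⟩ : ∃ h : S, chilean a ω = chileanConic a ω (conicIdx c (l + 1)) *
      (chileanConic a ω (conicIdx c (l + 2)) * h) ∧ eval (normalized p) h ≠ 0 := by
    refine ⟨∏ κ ∈ (Finset.univ.erase (conicIdx c (l + 1))).erase (conicIdx c (l + 2)),
      chileanConic a ω κ, ?_, ?_⟩
    · rw [chilean_eq_mul_cofactor a ω (conicIdx c (l + 1)), cofactor, Finset.mul_prod_erase
        (Finset.univ.erase (conicIdx c (l + 1))) (chileanConic a ω)]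
      exact Finset.mem_erase.2 ⟨hne, Finset.mem_univ _⟩
    · rw [map_prod, Finset.prod_ne_zero_iff]
      intro κ hκ
      obtain ⟨⟨c', k⟩, rfl⟩ := conicEquiv.surjective κ
      simp only [Finset.mem_erase, Finset.mem_univ, and_true] at hκ
      intro h0
      obtain ⟨rfl, hk⟩ := (hz c' k).1 h0
      have : k = l + 1 ∨ k = l + 2 := by clear * - hk; revert l k; decide
      rcases this with rfl | rfl
      · exact hκ.2 rfl
      · exact hκ.1 rfl
  have hspan : Ideal.span {germAt p (pderiv ((chartIndex p.rep).succAbove 0) (chilean a ω)),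
      germAt p (pderiv ((chartIndex p.rep).succAbove 1) (chilean a ω))} =
      IsLocalRing.maximalIdeal LocalRing := by
    rw [hF]
    refine span_pderiv_mul_eq_maximalIdeal ((hz _ _).2 ⟨rfl, h1⟩) ((hz _ _).2 ⟨rfl, h2⟩) hh ?_
    have hN := frameNorm_ne_zero c
    have hs := frameScale_ne_zero hω ha1 (a := a) c
    refine minor_ne_zero (n := normalized p)
      (g := fun j => eval (normalized p) (pderiv j (chileanConic a ω (conicIdx c (l + 1)))))
      (h := fun j => eval (normalized p) (pderiv j (chileanConic a ω (conicIdx c (l + 2)))))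
      (w := frameVertex ω c (l + 2)) (w' := frameVertex ω c (l + 1)) hn1 ?_ ?_ ?_
    · rw [sum_pderiv_conic hω ha1]
      simp [hL, s1, s2, h1, h2]
    · rw [sum_pderiv_conic hω ha1]
      simp [hL, s3, s4, h1, h2]
    · rw [sum_pderiv_conic hω ha1, sum_pderiv_conic hω ha1, sum_pderiv_conic hω ha1,
        sum_pderiv_conic hω ha1]
      simp [hL, eval_frameForm_vertex hω, s1, s2, s3, s4, h1, h2, h1.symm, h2.symm, h3, h3.symm,
        hN, hs, hr0, ht]
  have hmem : germAt p (chilean a ω) ∈ IsLocalRing.maximalIdeal LocalRing := by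
    rw [germAt_mem, hF, map_mul, (hz _ _).2 ⟨rfl, h1⟩, zero_mul]
  rw [milnorNumber_eq, tjurinaNumber_eq]
  refine ⟨?_, ?_⟩
  · rw [hspan]
    exact hasColength_maximalIdeal.colength_eq
  · rw [Ideal.span_insert, hspan, sup_eq_right.2 ((Ideal.span_singleton_le_iff_mem _).2 hmem)]
    exact hasColength_maximalIdeal.colength_eq

end Nodes

/-! ### Summation over the singular points -/

section Totals

variable {a ω : ℂ}

/-- Every base point has nonzero coordinates, so it lies in the chart `x = 1`. -/
theorem colength_base (hω : IsPrimitiveRoot ω 3) (ha0 : a ≠ 0) (ha1 : a ^ 3 ≠ 1)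
    (ha8 : a ^ 3 ≠ -8) {p : Plane} (hp : chileanMult a ω p = 8) :
    milnorNumber (chilean a ω) p = 49 ∧ tjurinaNumber (chilean a ω) p = 45 := by
  obtain ⟨h1, h2⟩ := (chileanMult_eq_eight_iff hω ha0 ha1 ha8 p).1 hp
  obtain ⟨k, i, t, ht, h⟩ := exists_frame_basePoint hω ha0 ha1 ha8 p.rep_nonzero h1 h2 none
  have hr : p.rep = t • basePoint a ω k i := by
    rw [show frameParam a ω none = a from rfl] at h
    rw [← h]
    funext j
    simp [frameForm]
  obtain ⟨r, hr0, hn, hn1⟩ := exists_unit_smul_normalized p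
  have h0 : p.rep 0 ≠ 0 := by
    have hi : ω ^ (i : ℕ) ≠ 0 := pow_ne_zero _ (hω.ne_zero (by norm_num))
    rw [hr, Pi.smul_apply, smul_eq_mul, basePoint]
    refine mul_ne_zero ht ?_
    split_ifs
    · exact ha0
    · exact hi
    · exact pow_ne_zero _ hi
  have hc : chartIndex p.rep = 0 := by simp [chartIndex, h0]
  rw [hc] at hn1
  exact colength_germAt_base hω ha0 ha1 ha8 (mul_ne_zero hr0 ht) (by rw [hn, hr, smul_smul]) hc hn1

/-- The sum over the singular points of a function that is constant on the points of each of the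
two multiplicities. -/
lemma finsum_singularPoints (hω : IsPrimitiveRoot ω 3) (ha0 : a ≠ 0) (ha1 : a ^ 3 ≠ 1)
    (ha8 : a ^ 3 ≠ -8) {f : Plane → ℕ∞} {m n : ℕ∞} (hm : ∀ p, chileanMult a ω p = 8 → f p = m)
    (hn : ∀ p, chileanMult a ω p = 2 → f p = n) :
    ∑ᶠ p ∈ singularPoints (chilean a ω), f p = 9 * m + 12 * n := by
  have hconst : ∀ (s : Set Plane) (N : ℕ) (x : ℕ∞), s.ncard = N → N ≠ 0 → (∀ p ∈ s, f p = x) →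
      ∑ᶠ p ∈ s, f p = N * x := by
    intro s N x hN hN0 hx
    have hs : s.Finite := Set.finite_of_ncard_ne_zero (hN ▸ hN0)
    rw [finsum_mem_eq_finite_toFinset_sum _ hs, Finset.sum_congr rfl (g := fun _ => x)
      (fun p hp => hx p (hs.mem_toFinset.1 hp)), Finset.sum_const, nsmul_eq_mul,
      ← Set.ncard_eq_toFinset_card s hs, hN]
  have h8 := ncard_mult_eight hω ha0 ha1 ha8
  have h2 := ncard_mult_two hω ha0 ha1 ha8
  have hu : singularPoints (chilean a ω) = {p | chileanMult a ω p = 8} ∪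
      {p | chileanMult a ω p = 2} := singularPoints_chilean hω ha0 ha1 ha8
  have hd : Disjoint {p : Plane | chileanMult a ω p = 8} {p | chileanMult a ω p = 2} := by
    rw [Set.disjoint_left]
    intro p (hp : _ = 8) (hp' : _ = 2)
    omega
  rw [hu, finsum_mem_union hd (Set.finite_of_ncard_ne_zero (by omega))
    (Set.finite_of_ncard_ne_zero (by omega)), hconst _ 9 m h8 (by norm_num) hm,
    hconst _ 12 n h2 (by norm_num) hn]
  rfl

end Totals

end PlaneCurve

end

open PlaneCurve in
theorem proposition2p1 (a ω : ℂ) (hω : IsPrimitiveRoot ω 3)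
    (ha0 : a ≠ 0) (ha1 : a ^ 3 ≠ 1) (ha8 : a ^ 3 ≠ -8) :
    -- twelve distinct irreducible conics
    ((∀ k, (chileanConic a ω k).IsHomogeneous 2 ∧ Irreducible (chileanConic a ω k)) ∧
      (∀ k l, k ≠ l → ¬ Associated (chileanConic a ω k) (chileanConic a ω l))) ∧
    -- nine points of multiplicity 8, six of them on each conic, twelve double points, no others
    (Set.ncard {p | chileanMult a ω p = 8} = 9 ∧
      (∀ k, Set.ncard {p | chileanMult a ω p = 8 ∧ Passes (chileanConic a ω k) p} = 6) ∧
      Set.ncard {p | chileanMult a ω p = 2} = 12 ∧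
      singularPoints (chilean a ω) = {p | chileanMult a ω p = 8 ∨ chileanMult a ω p = 2}) ∧
    -- freeness and exponents
    (IsFree (chilean a ω) ∧ HasExponents (chilean a ω) 7 16) ∧
    -- total Tjurina and Milnor numbers, and a singular point that is not quasi-homogeneous
    (totalTjurina (chilean a ω) = 417 ∧ totalMilnor (chilean a ω) = 453 ∧
      ∃ p ∈ singularPoints (chilean a ω), ¬ IsQuasiHomogeneousAt (chilean a ω) p) := by
  have hexp : HasExponents (chilean a ω) 7 16 :=
    hasExponents_chilean hω ha0 (isUnit_of_dvd_pderiv hω ha0 ha1 ha8)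
  have hfree : Module.Free S (logDerZero (chilean a ω)) :=
    let ⟨b, _⟩ := hexp; Module.Free.of_basis b
  refine ⟨⟨fun κ => ⟨chileanConic_isHomogeneous a ω κ, irreducible_chileanConic hω ha0 ha1 ha8 κ⟩,
    fun κ κ' hne h => hne (eq_of_dvd_conic hω ha0 ha1 ha8 h.dvd)⟩,
    ⟨ncard_mult_eight hω ha0 ha1 ha8, ncard_mult_eight_conic hω ha0 ha1 ha8,
      ncard_mult_two hω ha0 ha1 ha8, singularPoints_chilean hω ha0 ha1 ha8⟩,
    ⟨free_logDer (by norm_num) (chilean_isHomogeneous a ω) (chilean_ne_zero hω ha0 ha1 ha8),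
      hexp⟩, ?_, ?_, ?_⟩
  · rw [totalTjurina, finsum_singularPoints hω ha0 ha1 ha8
      (fun p hp => (colength_base hω ha0 ha1 ha8 hp).2)
      (fun p hp => (colength_vertex hω ha0 ha1 ha8 hp).2)]
    norm_num
  · rw [totalMilnor, finsum_singularPoints hω ha0 ha1 ha8
      (fun p hp => (colength_base hω ha0 ha1 ha8 hp).1)
      (fun p hp => (colength_vertex hω ha0 ha1 ha8 hp).1)]
    norm_num
  · obtain ⟨p, hp⟩ : ∃ p, chileanMult a ω p = 8 :=
      ⟨_, chileanMult_mk_framePoint hω ha0 ha1 ha8 none 0⟩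
    have h := colength_base hω ha0 ha1 ha8 hp
    refine ⟨p, ?_, fun hq => ?_⟩
    · rw [singularPoints_chilean hω ha0 ha1 ha8]
      exact Or.inl hp
    · rw [IsQuasiHomogeneousAt, h.1, h.2] at hq
      norm_num at hq
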